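/- Let $\Delta\subset\mathbb{R}^2$ be a two-dimensional convex lattice polygon with $g$ interior lattice points, and let $\Delta^{(1)}$ be the convex hull of these points. Assume that $\Delta$ is nonhyperelliptic, that is, $\dim\Delta^{(1)}=2$, and let $g^{(1)}$ be the number of lattice points in the interior of $\Delta^{(1)}$. Let $\mathcal{T}$ be a unimodular triangulation of $\Delta$ (all triangles have lattice vertices and area $\tfrac12$) that is regular, i.e. induced by the lower convex hull of the graph of some height function $\omega:\Delta\cap\mathbb{Z}^2\to\mathbb{R}$. For every $\omega$ inducing $\mathcal{T}$, the tropical plane curve of $\min_{(i,j)\in\Delta\cap\mathbb{Z}^2}(\omega(i,j)+ix+jy)$ is a smooth tropical curve dual to $\mathcal{T}$; its bounded edges carry their lattice lengths. Its skeleton is the metric graph obtained by removing all rays, iteratively removing $1$-valent vertices together with their edges, and then concatenating edges that meet at $2$-valent vertices, adding their lengths. Let $\mathbb{M}_g$ be the moduli space of metric graphs of genus $g$, that is, the orthants $\mathbb{R}_{\ge 0}^{3g-3}$ of edge lengths of all connected trivalent graphs of genus $g$, glued along isomorphisms of the (vertex-weighted) metric graphs obtained by contracting the edges of length $0$. Let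 $\mathbb{M}_{\mathcal{T}}\subset\mathbb{M}_g$ be the closure of the set of skeletons of smooth tropical plane curves dual to $\mathcal{T}$, and let $\dim$ denote the dimension of a polyhedral subset of $\mathbb{M}_g$. An edge $e$ of $\mathcal{T}$ is called radial if it connects an interior lattice point of $\Delta$ to a boundary lattice point of $\Delta$ and $e\cap\Delta^{(1)}$ is a single point. Let $b_1$ be the number of lattice points on $\partial\Delta^{(1)}$ incident to exactly one radial edge, and let $b_2$ be the number of lattice points on $\partial\Delta^{(1)}$ incident to two or more radial edges such that the endpoints of these edges on $\partial\Delta$ all lie on one line. Then \[\dim(\mathbb{M}_{\mathcal{T}})=3g-3-2g^{(1)}-2b_1-b_2.\] If moreover $\mathcal{T}$ is a honeycomb triangulation, i.e. each of its triangles is a translate of the triangle with vertices $(0,0),(1,0),(0,1)$ or of the triangle with vertices $(0,0),(-1,0),(0,-1)$, then $b_1=0$ and $b_2=b$, where $b$ is the number of boundary lattice points of $\Delta^{(1)}$ that are not vertices of $\Delta^{(1)}$, and therefore \[\dim(\mathbb{M}_{\mathcal{T}})=3g-3-2g^{(1)}-b.\] -/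

import Mathlib

open scoped NNReal

namespace TropPlane

/-! ## Lattice polygons -/

/-- The inclusion of the lattice `ℤ²` in the plane `ℝ²`. -/
def toPlane (P : ℤ × ℤ) : ℝ × ℝ := ((P.1 : ℝ), (P.2 : ℝ))

/-- The convex hull in the plane of a set of lattice points. -/
def hull (S : Set (ℤ × ℤ)) : Set (ℝ × ℝ) := convexHull ℝ (toPlane '' S)

/-- Two-dimensional convex lattice polygons. -/
def IsLatticePolygon (Δ : Set (ℝ × ℝ)) : Prop :=
  (∃ V : Finset (ℤ × ℤ), Δ = hull (V : Set (ℤ × ℤ))) ∧ (interior Δ).Nonempty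

/-- The lattice points of `Δ`. -/
def latticePts (Δ : Set (ℝ × ℝ)) : Set (ℤ × ℤ) := {P | toPlane P ∈ Δ}

/-- The lattice points in the interior of `Δ`. -/
def interiorPts (Δ : Set (ℝ × ℝ)) : Set (ℤ × ℤ) := {P | toPlane P ∈ interior Δ}

/-- The lattice points on the boundary of `Δ`. -/
def boundaryPts (Δ : Set (ℝ × ℝ)) : Set (ℤ × ℤ) := {P | toPlane P ∈ frontier Δ}

/-- The genus of a polygon: the number of its interior lattice points. -/
noncomputable def genus (Δ : Set (ℝ × ℝ)) : ℕ := (interiorPts Δ).ncard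

/-- The interior polygon `Δ⁽¹⁾`. -/
def interiorPolygon (Δ : Set (ℝ × ℝ)) : Set (ℝ × ℝ) := hull (interiorPts Δ)

/-- `Δ` is nonhyperelliptic if its interior polygon is two-dimensional. -/
def IsNonhyperelliptic (Δ : Set (ℝ × ℝ)) : Prop := (interior (interiorPolygon Δ)).Nonempty

/-! ## Triangulations -/

/-- The area of the triangle with vertices `P`, `Q`, `R`. -/
noncomputable def triangleArea (P Q R : ℤ × ℤ) : ℝ :=
  |(((Q.1 - P.1) * (R.2 - P.2) - (Q.2 - P.2) * (R.1 - P.1) : ℤ) : ℝ)| / 2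

/-- `T`, the set of the vertex sets of its triangles, is a unimodular triangulation of `Δ`. -/
structure IsUnimodularTriangulation (Δ : Set (ℝ × ℝ)) (T : Finset (Finset (ℤ × ℤ))) : Prop where
  unimodular : ∀ t ∈ T, ∃ P Q R : ℤ × ℤ, t = {P, Q, R} ∧ triangleArea P Q R = 1 / 2
  covers : ⋃ t ∈ T, hull (t : Set (ℤ × ℤ)) = Δ
  face_to_face : ∀ s ∈ T, ∀ t ∈ T,
    hull (s : Set (ℤ × ℤ)) ∩ hull (t : Set (ℤ × ℤ)) = hull ((s ∩ t : Finset (ℤ × ℤ)) : Set (ℤ × ℤ))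

/-- The monomial with exponent `P` of a tropical polynomial with coefficients `ω`, evaluated
at `p`; in classical notation this is `ω P + ⟨P, p⟩`. -/
def monomialValue (ω : ℤ × ℤ → ℝ) (P : ℤ × ℤ) (p : ℝ × ℝ) : ℝ :=
  ω P + (P.1 * p.1 + P.2 * p.2)

/-- The two-dimensional cells of the subdivision of `Δ` induced by the height function `ω`: the
projections of the two-dimensional faces of the lower convex hull of the graph of `ω` on the
lattice points of `Δ`. The affine function with gradient `-p` and constant term `c` lies below the
lifted points, and the face is spanned by the lifted points on its graph. Only the values of `ω` at
lattice points of `Δ` matter. -/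
def lowerCells (Δ : Set (ℝ × ℝ)) (ω : ℤ × ℤ → ℝ) : Set (Set (ℝ × ℝ)) :=
  {C | ∃ (p : ℝ × ℝ) (c : ℝ), (∀ P ∈ latticePts Δ, c ≤ monomialValue ω P p) ∧
    C = hull {P | P ∈ latticePts Δ ∧ monomialValue ω P p = c} ∧ (interior C).Nonempty}

/-- The height function `ω` induces `T`, that is, `ω` lies in the secondary cone of `T`. -/
def Induces (Δ : Set (ℝ × ℝ)) (T : Finset (Finset (ℤ × ℤ))) (ω : ℤ × ℤ → ℝ) : Prop :=
  lowerCells Δ ω = (fun t : Finset (ℤ × ℤ) => hull (t : Set (ℤ × ℤ))) '' (T : Set (Finset (ℤ × ℤ)))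

/-- Regular triangulations. -/
def IsRegularTriangulation (Δ : Set (ℝ × ℝ)) (T : Finset (Finset (ℤ × ℤ))) : Prop := ∃ ω, Induces Δ T ω

/-- Honeycomb triangulations: every triangle is a translate of the triangle
`(0,0), (1,0), (0,1)` or of the triangle `(0,0), (-1,0), (0,-1)`. -/
def IsHoneycomb (T : Finset (Finset (ℤ × ℤ))) : Prop :=
  ∀ t ∈ T, ∃ v : ℤ × ℤ,
    t = {v, v + (1, 0), v + (0, 1)} ∨ t = {v, v + (-1, 0), v + (0, -1)}

/-! ## Radial edges -/

/-- The segment from `P` to `Q` is an edge of `T`. -/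
def IsEdge (T : Finset (Finset (ℤ × ℤ))) (P Q : ℤ × ℤ) : Prop :=
  P ≠ Q ∧ ∃ t ∈ T, P ∈ t ∧ Q ∈ t

/-- The edge from the interior lattice point `P` to the boundary lattice point `Q` is radial. -/
def IsRadial (Δ : Set (ℝ × ℝ)) (T : Finset (Finset (ℤ × ℤ))) (P Q : ℤ × ℤ) : Prop :=
  IsEdge T P Q ∧ P ∈ interiorPts Δ ∧ Q ∈ boundaryPts Δ ∧
    ∃ x, segment ℝ (toPlane P) (toPlane Q) ∩ interiorPolygon Δ = {x}

/-- The outer endpoints of the radial edges at `P`; they correspond to these edges. -/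
def radialEnds (Δ : Set (ℝ × ℝ)) (T : Finset (Finset (ℤ × ℤ))) (P : ℤ × ℤ) : Set (ℤ × ℤ) :=
  {Q | IsRadial Δ T P Q}

/-- `b₁`: the number of boundary lattice points of `Δ⁽¹⁾` with exactly one radial edge. -/
noncomputable def b₁ (Δ : Set (ℝ × ℝ)) (T : Finset (Finset (ℤ × ℤ))) : ℕ :=
  {P | P ∈ boundaryPts (interiorPolygon Δ) ∧ (radialEnds Δ T P).ncard = 1}.ncard

/-- `b₂`: the number of boundary lattice points of `Δ⁽¹⁾` with two or more radial edges, whose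
outer endpoints all lie on one line. -/
noncomputable def b₂ (Δ : Set (ℝ × ℝ)) (T : Finset (Finset (ℤ × ℤ))) : ℕ :=
  {P | P ∈ boundaryPts (interiorPolygon Δ) ∧ 2 ≤ (radialEnds Δ T P).ncard ∧
    Collinear ℝ (toPlane '' radialEnds Δ T P)}.ncard

/-- The number of boundary lattice points of a polygon that are not vertices. -/
noncomputable def nonvertexBoundaryCount (Δ : Set (ℝ × ℝ)) : ℕ :=
  {P | P ∈ boundaryPts Δ ∧ toPlane P ∉ Set.extremePoints ℝ Δ}.ncard

/-! ## The tropical curve of a height function, as a metric graph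

The tropical curve of `ω ∈ Σ(T)` is the set of points of the plane at which the minimum of the
monomials is attained at least twice. It is dual to `T`: its vertices correspond to the triangles
of `T`, its bounded edges to the edges of `T` that two triangles share, and a bounded edge joins
the two vertices of the curve that correspond to the triangles containing the dual edge. -/

/-- The cell of the tropical curve of `ω` dual to `σ`: the points at which all the monomials in `σ`
attain the minimum. -/
def dualCell (Δ : Set (ℝ × ℝ)) (ω : ℤ × ℤ → ℝ) (σ : Set (ℤ × ℤ)) : Set (ℝ × ℝ) :=
  {p | ∀ P ∈ σ, ∀ Q ∈ latticePts Δ, monomialValue ω P p ≤ monomialValue ω Q p}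

/-- The lattice length of a segment of rational slope: its length measured in multiples of a
primitive lattice vector. -/
noncomputable def latticeLength (S : Set (ℝ × ℝ)) : ℝ :=
  sSup {s : ℝ | ∃ v : ℤ × ℤ, IsCoprime v.1 v.2 ∧ ∃ p ∈ S, p + s • toPlane v ∈ S}

/-- The edges of `T` shared by two triangles, which are dual to the bounded edges of a tropical
curve dual to `T`. -/
def boundedEdges (T : Finset (Finset (ℤ × ℤ))) : Finset (Finset (ℤ × ℤ)) :=
  ((T ×ˢ T).image fun q => q.1 ∩ q.2).filter fun e => e.card = 2

/-- The bounded edges of the curve that are lost when, after all rays have been removed, one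
iteratively removes the 1-valent vertices and their edges: `e` is lost if at one of its ends `t`
all the other edges are lost. -/
inductive Pruned (T : Finset (Finset (ℤ × ℤ))) : Finset (ℤ × ℤ) → Prop
  | leaf (e t : Finset (ℤ × ℤ)) (he : e ∈ boundedEdges T) (ht : t ∈ T) (het : e ⊆ t)
      (h : ∀ e' ∈ boundedEdges T, e' ⊆ t → e' ≠ e → Pruned T e') : Pruned T e

open Classical in
/-- The bounded edges that survive the pruning. -/
noncomputable def coreEdges (T : Finset (Finset (ℤ × ℤ))) : Finset (Finset (ℤ × ℤ)) :=
  (boundedEdges T).filter fun e => ¬ Pruned T e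

/-- The valence of the vertex `t` in the pruned curve. -/
noncomputable def coreDegree (T : Finset (Finset (ℤ × ℤ))) (t : Finset (ℤ × ℤ)) : ℕ :=
  ((coreEdges T).filter fun e => e ⊆ t).card

/-- Two surviving edges are concatenated if they are linked by a chain of surviving edges in which
consecutive edges meet at a 2-valent vertex. -/
def Concatenated (T : Finset (Finset (ℤ × ℤ))) : Finset (ℤ × ℤ) → Finset (ℤ × ℤ) → Prop :=
  Relation.EqvGen fun e e' => e ∈ coreEdges T ∧ e' ∈ coreEdges T ∧
    ∃ t ∈ T, coreDegree T t = 2 ∧ e ⊆ t ∧ e' ⊆ t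

/-! ## The moduli space of metric graphs of genus `g` -/

/-- The number of ends (0, 1 or 2) that an edge with the unordered pair `s` of ends has at `v`. -/
def endCount {V : Type*} [DecidableEq V] (s : Sym2 V) (v : V) : ℕ :=
  (if v ∈ s then 1 else 0) + (if s = s(v, v) then 1 else 0)

/-- Connected trivalent graphs of genus `g`, loops and multiple edges allowed; they have `2g - 2`
vertices and `3g - 3` edges. -/
structure TrivalentGraph (g : ℕ) where
  ends : Fin (3 * g - 3) → Sym2 (Fin (2 * g - 2))
  trivalent : ∀ v, ∑ e, endCount (ends e) v = 3
  connected : ∀ u v, Relation.ReflTransGen (fun a b => ∃ e, ends e = s(a, b)) u v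

/-- Trivalent graphs with nonnegative edge lengths: the disjoint union, over all trivalent graphs,
of the orthants of edge lengths. An edge of length 0 stands for a contracted edge. -/
abbrev LengthGraph (g : ℕ) : Type := Σ _ : TrivalentGraph g, (Fin (3 * g - 3) → ℝ≥0)

namespace LengthGraph

variable {g : ℕ}

/-- The vertices after contraction of all edges of length 0. -/
def Vertex (x : LengthGraph g) : Type :=
  Quot fun a b => ∃ e, x.2 e = 0 ∧ x.1.ends e = s(a, b)

/-- The edges after contraction of all edges of length 0. -/
def Edge (x : LengthGraph g) : Type := {e // x.2 e ≠ 0}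

/-- The ends of an edge in the contracted graph. -/
def ends (x : LengthGraph g) (e : Fin (3 * g - 3)) : Sym2 x.Vertex :=
  (x.1.ends e).map (Quot.mk _)

/-- The weight of a vertex of the contracted graph: the first Betti number of the connected
subgraph contracted to it. -/
noncomputable def weight (x : LengthGraph g) (c : x.Vertex) : ℤ :=
  ({e | x.2 e = 0 ∧ c ∈ x.ends e}.ncard : ℤ) - {v | (Quot.mk _ v : x.Vertex) = c}.ncard + 1

/-- `x` and `y` represent the same metric graph: the contracted graphs are isomorphic by an
isomorphism that preserves edge lengths and vertex weights. -/
def Iso (x y : LengthGraph g) : Prop :=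
  ∃ (φ : x.Vertex ≃ y.Vertex) (σ : x.Edge ≃ y.Edge),
    (∀ e, y.2 (σ e).1 = x.2 e.1) ∧ (∀ e, y.ends (σ e).1 = (x.ends e.1).map φ) ∧
    ∀ c, y.weight (φ c) = x.weight c

theorem iso_equivalence : Equivalence (Iso (g := g)) where
  refl x := ⟨Equiv.refl _, Equiv.refl _, by simp, by simp, by simp⟩
  symm := by
    rintro x y ⟨φ, σ, h1, h2, h3⟩
    refine ⟨φ.symm, σ.symm, fun e => ?_, fun e => ?_, fun c => ?_⟩
    · simpa using (h1 (σ.symm e)).symm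
    · have h := h2 (σ.symm e)
      rw [Equiv.apply_symm_apply] at h
      rw [h, Sym2.map_map]
      simp
    · simpa using (h3 (φ.symm c)).symm
  trans := by
    rintro x y z ⟨φ, σ, h1, h2, h3⟩ ⟨φ', σ', h1', h2', h3'⟩
    refine ⟨φ.trans φ', σ.trans σ', fun e => ?_, fun e => ?_, fun c => ?_⟩
    · simp [h1, h1']
    · simp [h2, h2', Sym2.map_map]
    · simp [h3, h3']

/-- The equivalence relation of representing the same metric graph. -/
def setoid (g : ℕ) : Setoid (LengthGraph g) := ⟨Iso, iso_equivalence⟩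

end LengthGraph

/-- The moduli space `𝕄_g` of metric graphs of genus `g`, with the quotient topology: the orthants
`ℝ≥0 ^ (3g - 3)` of the trivalent graphs, glued along isomorphisms of metric graphs. -/
abbrev ModuliSpace (g : ℕ) : Type := Quotient (LengthGraph.setoid g)

/-- `X` has dimension `d`, for a polyhedral subset `X` of `𝕄_g`: the largest dimension of a simplex
contained in the part of `X` in one of the orthants from which `𝕄_g` is glued is `d`. -/
def HasDim {g : ℕ} (X : Set (ModuliSpace g)) (d : ℤ) : Prop :=
  IsGreatest ((fun k : ℕ => (k : ℤ)) ''
    {k : ℕ | ∃ (G : TrivalentGraph g) (p : Fin (k + 1) → Fin (3 * g - 3) → ℝ),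
      AffineIndependent ℝ p ∧
      convexHull ℝ (Set.range p) ⊆
        (fun (ℓ : Fin (3 * g - 3) → ℝ≥0) e => (ℓ e : ℝ)) ''
          {ℓ | (Quotient.mk (LengthGraph.setoid g) ⟨G, ℓ⟩ : ModuliSpace g) ∈ X}}) d

/-! ## Skeletons and the moduli space of a triangulation -/

/-- `x` is the skeleton of the tropical curve of `ω`: its vertices are the 3-valent vertices of the
pruned curve (labelled by `vert`), its edges the classes of concatenated edges (labelled by `cls`),
an edge has as many ends at a vertex as edges of its class meet that vertex, and its length is the
sum of the lattice lengths of the edges in its class. -/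
def IsSkeleton (Δ : Set (ℝ × ℝ)) (T : Finset (Finset (ℤ × ℤ))) (ω : ℤ × ℤ → ℝ) {g : ℕ}
    (x : LengthGraph g) : Prop :=
  ∃ (vert : Fin (2 * g - 2) → Finset (ℤ × ℤ)) (cls : Finset (ℤ × ℤ) → Fin (3 * g - 3)),
    Set.BijOn vert Set.univ {t | t ∈ T ∧ coreDegree T t = 3} ∧
    (∀ j, ∃ e ∈ coreEdges T, cls e = j) ∧
    (∀ e ∈ coreEdges T, ∀ e' ∈ coreEdges T, cls e = cls e' ↔ Concatenated T e e') ∧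
    (∀ i j, ((coreEdges T).filter fun e => e ⊆ vert i ∧ cls e = j).card
      = endCount (x.1.ends j) i) ∧
    ∀ j, (x.2 j : ℝ) = ∑ e ∈ (coreEdges T).filter fun e => cls e = j,
      latticeLength (dualCell Δ ω (e : Set (ℤ × ℤ)))

/-- `𝕄_T`: the closure in `𝕄_g` of the set of skeletons of smooth tropical plane curves dual
to `T`, where `g` is the genus of `Δ`. -/
def moduliOf (Δ : Set (ℝ × ℝ)) (T : Finset (Finset (ℤ × ℤ))) : Set (ModuliSpace (genus Δ)) :=
  closure {m | ∃ ω, Induces Δ T ω ∧ ∃ x : LengthGraph (genus Δ), IsSkeleton Δ T ω x ∧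
    m = Quotient.mk (LengthGraph.setoid (genus Δ)) x}

end TropPlane

open TropPlane

/-! The curve depends on a height function only through the lattice lengths of its bounded edges,
and these are linear in the heights: the edge dual to `PQ` has as its length the height `bend` of
the apex on one side above the affine interpolation on the triangle on the other side. The heights
inducing `T` form a convex cone cut out by finitely many strict inequalities (`Supports`), so the
dimension sought is the rank of the linear map `classLength` from heights to skeleton lengths. This
rank is computed through the relations that the lengths satisfy.

Relations. Let there be `g` interior and `r` boundary lattice points. A sweep by a generic line
gives `3g + r - 3` bounded edges (`card_boundedEdges`), while heights modulo affine functions have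
dimension `g + r - 3`; so there are at most `2g` independent relations. On the other hand the edges
dual to those at an interior vertex close up to a polygon (`sum_edges_at`). Pairing these closing
conditions with a vector `u P` at each interior vertex, and setting `u = 0` on the boundary, yields
a relation with coefficient `⟨u P - u Q, Q - P⟩` at `PQ`, its stress. If all stresses vanish, `u` is
an infinitesimal motion of the triangulation with fixed boundary that preserves all edge lengths,
hence zero (`eq_zero_of_stress`). Therefore the stresses are all the relations
(`mem_range_stressMap_iff`).

Skeleton. An edge survives pruning iff its dual edge has an interior endpoint or both adjacent
apexes are interior (`pair_mem_coreEdges`). Distinct surviving edges are concatenated iff they are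
dual to radial edges at a common point (`concatenated_iff`). A relation between the `3g - 3`
skeleton lengths is thus a stress that is constant on classes and zero off the core. Off the core it
vanishes by itself, and a radial edge `PQ` has stress `⟨u P, Q - P⟩`, so the condition is that `u P`
be orthogonal to all differences of outer ends of radial edges at `P`. It leaves dimension 2 if
there is at most one radial edge, 1 if there are several with collinear ends, and 0 otherwise.
Interior points of the interior polygon have no radial edge, its boundary points have at least one;
this makes `2g⁽¹⁾ + 2b₁ + b₂` relations (`sum_finrank_orthoDiff`).

Moduli space. The image of the cone contains a simplex of dimension the rank. Conversely the gluing
of `𝕄_g` only permutes edge lengths, so `𝕄_T` lies in the closed set obtained from finitely many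
permutations of one subspace, and a simplex covered by finitely many subspaces lies in one of them.

Regularity also organizes the combinatorics: by convexity, the interpolations evaluated at a fixed
point increase as one walks towards it through adjacent triangles (`exists_stuck`). This gives
connectedness and a well-founded order for the pruning.

In a honeycomb an interior point has all six neighbours, and its radial edges lead to those that are
not interior. Each supporting edge direction at a boundary point of the interior polygon contributes
two of them, with ends on a parallel line. At a nonvertex there is only one such direction; at a
vertex the ends are not collinear. -/

namespace TropPlane

/-! ## Oriented lattice triangles -/

/-- Twice the signed area of the lattice triangle `P Q R`. -/
def idet (P Q R : ℤ × ℤ) : ℤ :=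
  (Q.1 - P.1) * (R.2 - P.2) - (Q.2 - P.2) * (R.1 - P.1)

/-- Twice the signed area of the triangle `P Q x`: it is positive if `x` lies to the left of the
line from `P` to `Q`. -/
def side (P Q : ℤ × ℤ) (x : ℝ × ℝ) : ℝ :=
  ((Q.1 : ℝ) - P.1) * (x.2 - P.2) - ((Q.2 : ℝ) - P.2) * (x.1 - P.1)

/-- `P`, `Q`, `R` are the vertices, in counterclockwise order, of a triangle of `T`. -/
def Tri (T : Finset (Finset (ℤ × ℤ))) (P Q R : ℤ × ℤ) : Prop :=
  idet P Q R = 1 ∧ ({P, Q, R} : Finset (ℤ × ℤ)) ∈ T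

theorem side_toPlane (P Q R : ℤ × ℤ) : side P Q (toPlane R) = (idet P Q R : ℝ) := by
  simp only [side, toPlane, idet]; push_cast; ring

theorem idet_rot (P Q R : ℤ × ℤ) : idet Q R P = idet P Q R := by
  simp only [idet]; ring

theorem idet_swap (P Q R : ℤ × ℤ) : idet Q P R = - idet P Q R := by
  simp only [idet]; ring

theorem side_swap (P Q : ℤ × ℤ) (x : ℝ × ℝ) : side Q P x = - side P Q x := by
  simp only [side]; ring

theorem side_combo (P Q : ℤ × ℤ) (x y : ℝ × ℝ) (a b : ℝ) (h : a + b = 1) :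
    side P Q (a • x + b • y) = a * side P Q x + b * side P Q y := by
  obtain rfl : b = 1 - a := by linarith
  simp only [side, Prod.fst_add, Prod.snd_add, Prod.smul_fst, Prod.smul_snd, smul_eq_mul]; ring

theorem side_add_smul_sub (P Q : ℤ × ℤ) (x y : ℝ × ℝ) (s : ℝ) :
    side P Q (x + s • (y - x)) = (1 - s) * side P Q x + s * side P Q y := by
  rw [← side_combo P Q x y _ _ (by ring)]
  congr 1
  module

theorem continuous_side (P Q : ℤ × ℤ) : Continuous (side P Q) := by
  unfold side; fun_prop

theorem side_left_self (P Q : ℤ × ℤ) : side P Q (toPlane P) = 0 := by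
  simp [side, toPlane]

theorem side_right_self (P Q : ℤ × ℤ) : side P Q (toPlane Q) = 0 := by
  simp only [side, toPlane]; ring

/-- Since the doubled area is 1, the three values of `side` are the barycentric coordinates of `x`.
At lattice points they are integers, which drives most arguments about unimodular triangles below.
-/
theorem side_sum {P Q R : ℤ × ℤ} (h : idet P Q R = 1) (x : ℝ × ℝ) :
    side Q R x + side R P x + side P Q x = 1 := by
  have h' : ((idet P Q R : ℤ) : ℝ) = 1 := by rw [h]; simp
  simp only [idet] at h'; push_cast at h'
  simp only [side]; linear_combination h'

theorem eq_side_combo {P Q R : ℤ × ℤ} (h : idet P Q R = 1) (x : ℝ × ℝ) :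
    x = side Q R x • toPlane P + side R P x • toPlane Q + side P Q x • toPlane R := by
  have h' : ((idet P Q R : ℤ) : ℝ) = 1 := by rw [h]; simp
  simp only [idet] at h'; push_cast at h'
  ext
  · simp only [side, toPlane, Prod.fst_add, Prod.smul_fst, smul_eq_mul]
    linear_combination (-x.1) * h'
  · simp only [side, toPlane, Prod.snd_add, Prod.smul_snd, smul_eq_mul]
    linear_combination (-x.2) * h'

theorem toPlane_injective : Function.Injective toPlane := by
  intro P Q h
  simp only [toPlane, Prod.mk.injEq, Int.cast_inj] at h
  exact Prod.ext h.1 h.2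

theorem convex_side (P Q : ℤ × ℤ) : Convex ℝ {x | 0 ≤ side P Q x} := by
  intro x hx y hy a b ha hb hab
  simp only [Set.mem_ofPred_eq] at *
  rw [side_combo _ _ _ _ _ _ hab]; positivity

theorem convex_side_zero (P Q : ℤ × ℤ) : Convex ℝ {x | side P Q x = 0} := by
  intro x hx y hy a b ha hb hab
  simp only [Set.mem_ofPred_eq] at *
  rw [side_combo _ _ _ _ _ _ hab, hx, hy]; ring

theorem convex_combo₃ {s : Set (ℝ × ℝ)} (hs : Convex ℝ s) {x y z : ℝ × ℝ} (hx : x ∈ s)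
    (hy : y ∈ s) (hz : z ∈ s) {a b c : ℝ} (ha : 0 ≤ a) (hb : 0 ≤ b) (hc : 0 ≤ c)
    (h : a + b + c = 1) : a • x + b • y + c • z ∈ s := by
  have := hs.sum_mem (t := Finset.univ) (w := ![a, b, c]) (z := ![x, y, z])
    (by intro i _; fin_cases i <;> simpa) (by simp [Fin.sum_univ_three, h])
    (by intro i _; fin_cases i <;> simpa)
  simpa [Fin.sum_univ_three] using this

theorem subset_hull {S : Set (ℤ × ℤ)} {P : ℤ × ℤ} (h : P ∈ S) : toPlane P ∈ hull S :=
  subset_convexHull ℝ _ ⟨P, h, rfl⟩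

theorem convex_hull (S : Set (ℤ × ℤ)) : Convex ℝ (hull S) := convex_convexHull ℝ _

theorem hull_subset {S : Set (ℤ × ℤ)} {C : Set (ℝ × ℝ)} (hC : Convex ℝ C)
    (h : ∀ P ∈ S, toPlane P ∈ C) : hull S ⊆ C :=
  convexHull_min (by rintro _ ⟨P, hP, rfl⟩; exact h P hP) hC

theorem isCompact_hull {S : Set (ℤ × ℤ)} (h : S.Finite) : IsCompact (hull S) :=
  (h.image _).isCompact_convexHull ℝ

theorem mem_hull_triangle {P Q R : ℤ × ℤ} (h : idet P Q R = 1) {x : ℝ × ℝ} :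
    x ∈ hull (({P, Q, R} : Finset (ℤ × ℤ)) : Set (ℤ × ℤ)) ↔
      0 ≤ side Q R x ∧ 0 ≤ side R P x ∧ 0 ≤ side P Q x := by
  constructor
  · intro hx
    have key : ∀ A B C : ℤ × ℤ, idet A B C = 1 →
        hull (({A, B, C} : Finset (ℤ × ℤ)) : Set (ℤ × ℤ)) ⊆ {x | 0 ≤ side A B x} := by
      intro A B C hd
      apply hull_subset (convex_side A B)
      intro X hX
      simp only [Finset.coe_insert, Finset.coe_singleton, Set.mem_insert_iff,
        Set.mem_singleton_iff] at hX
      rcases hX with rfl | rfl | rfl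
      · simp [side_left_self]
      · simp [side_right_self]
      · simp [side_toPlane, hd]
    refine ⟨key Q R P (by rw [idet_rot, h]) ?_, key R P Q (by rw [← idet_rot, h]) ?_, key P Q R h hx⟩
    · convert hx using 3; ext; simp; tauto
    · convert hx using 3; ext; simp; tauto
  · rintro ⟨h1, h2, h3⟩
    rw [eq_side_combo h x]
    exact convex_combo₃ (convex_hull _) (subset_hull (by simp)) (subset_hull (by simp))
      (subset_hull (by simp)) h1 h2 h3 (side_sum h x)

/-- A lattice point of a unimodular triangle is a vertex of it. -/
theorem mem_of_toPlane_mem_hull {P Q R X : ℤ × ℤ} (h : idet P Q R = 1)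
    (hX : toPlane X ∈ hull (({P, Q, R} : Finset (ℤ × ℤ)) : Set (ℤ × ℤ))) :
    X ∈ ({P, Q, R} : Finset (ℤ × ℤ)) := by
  rw [mem_hull_triangle h] at hX
  have hs := side_sum h (toPlane X)
  have he := eq_side_combo h (toPlane X)
  simp only [side_toPlane] at *
  norm_cast at *
  obtain ⟨h1, h2, h3⟩ := hX
  -- Three nonnegative integers with sum 1.
  have : (idet Q R X = 1 ∧ idet R P X = 0 ∧ idet P Q X = 0) ∨
    (idet Q R X = 0 ∧ idet R P X = 1 ∧ idet P Q X = 0) ∨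
    (idet Q R X = 0 ∧ idet R P X = 0 ∧ idet P Q X = 1) := by omega
  rcases this with ⟨a, b, c⟩ | ⟨a, b, c⟩ | ⟨a, b, c⟩ <;>
    · rw [a, b, c] at he
      simp at he
      simp [toPlane_injective he]

theorem Tri.rot {T : Finset (Finset (ℤ × ℤ))} {P Q R : ℤ × ℤ} (h : Tri T P Q R) : Tri T Q R P := by
  refine ⟨by rw [idet_rot, h.1], ?_⟩
  convert h.2 using 1
  ext; simp; tauto

theorem Tri.ne {T : Finset (Finset (ℤ × ℤ))} {P Q R : ℤ × ℤ} (h : Tri T P Q R) : P ≠ Q := by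
  rintro rfl
  have := h.1
  simp [idet] at this

theorem Tri.card {T : Finset (Finset (ℤ × ℤ))} {P Q R : ℤ × ℤ} (h : Tri T P Q R) :
    ({P, Q, R} : Finset (ℤ × ℤ)).card = 3 :=
  Finset.card_eq_three.2 ⟨P, Q, R, h.ne, h.rot.rot.ne.symm, h.rot.ne, rfl⟩

/-! ### Germs of segments and adjacency of triangles. -/

section

variable {Δ : Set (ℝ × ℝ)} {T : Finset (Finset (ℤ × ℤ))}

theorem exists_tri (hT : IsUnimodularTriangulation Δ T) {t : Finset (ℤ × ℤ)} (ht : t ∈ T) :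
    ∃ P Q R, Tri T P Q R ∧ t = {P, Q, R} := by
  obtain ⟨P, Q, R, rfl, h⟩ := hT.unimodular t ht
  unfold triangleArea at h
  have h1 : |((idet P Q R : ℤ) : ℝ)| = 1 := by
    unfold idet; linarith
  have h2 : |idet P Q R| = 1 := by exact_mod_cast h1
  rcases (abs_eq (by norm_num)).1 h2 with h3 | h3
  · exact ⟨P, Q, R, ⟨h3, ht⟩, rfl⟩
  · have : ({P, Q, R} : Finset (ℤ × ℤ)) = {Q, P, R} := by ext; simp; tauto
    exact ⟨Q, P, R, ⟨by rw [idet_swap, h3]; norm_num, this ▸ ht⟩, this⟩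

theorem exists_tri_of_mem (hT : IsUnimodularTriangulation Δ T) {t : Finset (ℤ × ℤ)} (ht : t ∈ T)
    {P : ℤ × ℤ} (hP : P ∈ t) : ∃ Q R, Tri T P Q R ∧ t = {P, Q, R} := by
  obtain ⟨A, B, C, h, rfl⟩ := exists_tri hT ht
  simp only [Finset.mem_insert, Finset.mem_singleton] at hP
  rcases hP with rfl | rfl | rfl
  · exact ⟨B, C, h, rfl⟩
  · exact ⟨C, A, h.rot, by ext; simp; tauto⟩
  · exact ⟨A, B, h.rot.rot, by ext; simp; tauto⟩

theorem exists_tri_of_mem₂ (hT : IsUnimodularTriangulation Δ T) {t : Finset (ℤ × ℤ)} (ht : t ∈ T)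
    {P Q : ℤ × ℤ} (hP : P ∈ t) (hQ : Q ∈ t) (hPQ : P ≠ Q) :
    ∃ R, t = {P, Q, R} ∧ (Tri T P Q R ∨ Tri T Q P R) := by
  obtain ⟨A, B, h, rfl⟩ := exists_tri_of_mem hT ht hP
  simp only [Finset.mem_insert, Finset.mem_singleton] at hQ
  rcases hQ with rfl | rfl | rfl
  · exact absurd rfl hPQ
  · exact ⟨B, rfl, Or.inl h⟩
  · exact ⟨A, by ext; simp; tauto, Or.inr h.rot.rot⟩

theorem hull_subset_polygon (hT : IsUnimodularTriangulation Δ T) {t : Finset (ℤ × ℤ)}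
    (ht : t ∈ T) : hull (t : Set (ℤ × ℤ)) ⊆ Δ := by
  rw [← hT.covers]
  exact Set.subset_biUnion_of_mem (u := fun t : Finset (ℤ × ℤ) => hull (t : Set (ℤ × ℤ))) ht

theorem toPlane_mem_of_mem (hT : IsUnimodularTriangulation Δ T) {t : Finset (ℤ × ℤ)}
    (ht : t ∈ T) {P : ℤ × ℤ} (hP : P ∈ t) : toPlane P ∈ Δ :=
  hull_subset_polygon hT ht (subset_hull hP)

/-- A point common to two triangles lies in the span of their common vertices. -/
theorem mem_of_side_pos (hT : IsUnimodularTriangulation Δ T) {P Q R : ℤ × ℤ} (h : Tri T P Q R)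
    {t : Finset (ℤ × ℤ)} (ht : t ∈ T) {x : ℝ × ℝ}
    (hx : x ∈ hull (({P, Q, R} : Finset (ℤ × ℤ)) : Set (ℤ × ℤ))) (hxt : x ∈ hull (t : Set (ℤ × ℤ)))
    (hpos : 0 < side Q R x) : P ∈ t := by
  by_contra hP
  have hx' : x ∈ hull ((({P, Q, R} ∩ t : Finset (ℤ × ℤ))) : Set (ℤ × ℤ)) := by
    rw [← hT.face_to_face _ h.2 _ ht]; exact ⟨hx, hxt⟩
  have : hull ((({P, Q, R} ∩ t : Finset (ℤ × ℤ))) : Set (ℤ × ℤ)) ⊆ {x | side Q R x = 0} := by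
    apply hull_subset (convex_side_zero Q R)
    intro X hX
    simp only [Finset.coe_inter, Set.mem_inter_iff, Finset.mem_coe, Finset.mem_insert,
      Finset.mem_singleton] at hX
    rcases hX with ⟨rfl | rfl | rfl, hX⟩
    · exact absurd hX hP
    · exact side_left_self _ _
    · exact side_right_self _ _
  have := this hx'
  simp only [Set.mem_ofPred_eq] at this
  linarith

/-- Germs of segments in `Δ` lie in triangles. -/
theorem exists_germ (hT : IsUnimodularTriangulation Δ T) (hΔ : Convex ℝ Δ) {x y : ℝ × ℝ}
    (hx : x ∈ Δ) (hy : y ∈ Δ) : ∃ t ∈ T, x ∈ hull (t : Set (ℤ × ℤ)) ∧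
      ∃ ε : ℝ, 0 < ε ∧ ε ≤ 1 ∧ x + ε • (y - x) ∈ hull (t : Set (ℤ × ℤ)) := by
  classical
  -- The union of the triangles that miss `x` is closed, so a short initial piece of the segment
  -- avoids it; a triangle met by that piece contains `x`.
  set C : Set (ℝ × ℝ) :=
    ⋃ t ∈ T.filter (fun t : Finset (ℤ × ℤ) => x ∉ hull (t : Set (ℤ × ℤ))), hull (t : Set (ℤ × ℤ))
    with hC
  have hCc : IsClosed C := by
    refine Set.Finite.isClosed_biUnion (Finset.finite_toSet _) ?_
    intro t _
    exact (isCompact_hull (Finset.finite_toSet t)).isClosed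
  have hxC : x ∉ C := by
    simp [hC]
  have hcont : Continuous fun ε : ℝ => x + ε • (y - x) := by fun_prop
  have hnhds : ∀ᶠ ε : ℝ in nhds 0, x + ε • (y - x) ∉ C := by
    have : (fun ε : ℝ => x + ε • (y - x)) ⁻¹' Cᶜ ∈ nhds (0 : ℝ) :=
      (hCc.isOpen_compl.preimage hcont).mem_nhds (by simpa using hxC)
    exact this
  obtain ⟨r, hr, hball⟩ := Metric.eventually_nhds_iff.1 hnhds
  set ε := min (r / 2) 1 with hε
  have hε0 : 0 < ε := by positivity
  have hε1 : ε ≤ 1 := min_le_right _ _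
  have hmem : x + ε • (y - x) ∈ Δ := hΔ.add_smul_sub_mem hx hy ⟨hε0.le, hε1⟩
  have hn := hball (y := ε) (by
    rw [Real.dist_eq, sub_zero, abs_of_pos hε0]
    exact lt_of_le_of_lt (min_le_left _ _) (by linarith))
  rw [← hT.covers] at hmem
  simp only [Set.mem_iUnion, exists_prop] at hmem
  obtain ⟨t, ht, hmt⟩ := hmem
  refine ⟨t, ht, ?_, ε, hε0, hε1, hmt⟩
  by_contra hxt
  apply hn
  simp only [hC, Set.mem_iUnion, exists_prop, Finset.mem_filter]
  exact ⟨t, ⟨ht, hxt⟩, hmt⟩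

/-- Germs of segments at lattice points, in coordinates. -/
theorem exists_germ_tri (hT : IsUnimodularTriangulation Δ T) (hΔ : Convex ℝ Δ) {P : ℤ × ℤ}
    {y : ℝ × ℝ} (hP : toPlane P ∈ Δ) (hy : y ∈ Δ) :
    ∃ Q R, Tri T P Q R ∧ 0 ≤ side R P y ∧ 0 ≤ side P Q y := by
  obtain ⟨t, ht, hPt, ε, hε, hε1, hm⟩ := exists_germ hT hΔ hP hy
  have hPt' : P ∈ t := by
    obtain ⟨A, B, C, h, rfl⟩ := exists_tri hT ht
    exact mem_of_toPlane_mem_hull h.1 hPt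
  obtain ⟨Q, R, h, rfl⟩ := exists_tri_of_mem hT ht hPt'
  rw [mem_hull_triangle h.1] at hm
  simp only [side_add_smul_sub, side_left_self, side_right_self, mul_zero, zero_add] at hm
  exact ⟨Q, R, h, by nlinarith [hm.2.1], by nlinarith [hm.2.2]⟩

theorem toPlane_mem_iff (hT : IsUnimodularTriangulation Δ T) {P : ℤ × ℤ} :
    toPlane P ∈ Δ ↔ ∃ t ∈ T, P ∈ t := by
  constructor
  · intro hP
    rw [← hT.covers] at hP
    simp only [Set.mem_iUnion, exists_prop] at hP
    obtain ⟨t, ht, hPt⟩ := hP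
    obtain ⟨A, B, C, h, rfl⟩ := exists_tri hT ht
    exact ⟨_, ht, mem_of_toPlane_mem_hull h.1 hPt⟩
  · rintro ⟨t, ht, hPt⟩
    exact toPlane_mem_of_mem hT ht hPt

/-- Two triangles whose germs at a common vertex overlap coincide. -/
theorem tri_eq_of_germ (hT : IsUnimodularTriangulation Δ T) {P Q R Q' R' : ℤ × ℤ}
    (h : Tri T P Q R) (h' : Tri T P Q' R') {y : ℝ × ℝ} (h1 : 0 < side R P y) (h2 : 0 < side P Q y)
    (h1' : 0 ≤ side R' P y) (h2' : 0 ≤ side P Q' y) : Q = Q' ∧ R = R' := by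
  -- A point close to `P` in the direction of `y` lies in both triangles, with positive coordinates
  -- at `Q` and `R` in the first. The face-to-face condition then makes `Q` and `R` vertices of the
  -- second triangle, and the orientation excludes a swap.
  have hev : ∃ ε : ℝ, 0 < ε ∧ 0 < side Q R (toPlane P + ε • (y - toPlane P)) ∧
      0 < side Q' R' (toPlane P + ε • (y - toPlane P)) := by
    have e1 : ∀ A B : ℤ × ℤ, Tri T P A B → ∀ᶠ ε : ℝ in nhdsWithin 0 (Set.Ioi 0),
        0 < side A B (toPlane P + ε • (y - toPlane P)) := by
      intro A B hAB
      have hc : Continuous fun ε : ℝ => side A B (toPlane P + ε • (y - toPlane P)) :=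
        (continuous_side A B).comp (by fun_prop)
      apply Filter.Eventually.filter_mono nhdsWithin_le_nhds
      apply (hc.isOpen_preimage _ isOpen_Ioi).mem_nhds
      simp [side_toPlane, idet_rot, hAB.1]
    have := ((e1 _ _ h).and ((e1 _ _ h').and self_mem_nhdsWithin)).exists
    obtain ⟨ε, a, b, c⟩ := this
    exact ⟨ε, c, a, b⟩
  obtain ⟨ε, hε, ha, hb⟩ := hev
  have s1 : 0 < side R P (toPlane P + ε • (y - toPlane P)) := by
    rw [side_add_smul_sub, side_right_self]; nlinarith
  have s2 : 0 < side P Q (toPlane P + ε • (y - toPlane P)) := by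
    rw [side_add_smul_sub, side_left_self]; nlinarith
  have s1' : 0 ≤ side R' P (toPlane P + ε • (y - toPlane P)) := by
    rw [side_add_smul_sub, side_right_self]; nlinarith
  have s2' : 0 ≤ side P Q' (toPlane P + ε • (y - toPlane P)) := by
    rw [side_add_smul_sub, side_left_self]; nlinarith
  have m := (mem_hull_triangle h.1).2 ⟨ha.le, s1.le, s2.le⟩
  have m' := (mem_hull_triangle h'.1).2 ⟨hb.le, s1', s2'⟩
  have hQ := mem_of_side_pos hT h.rot h'.2 (by convert m using 3; ext; simp; tauto) m' s1
  have hR := mem_of_side_pos hT h.rot.rot h'.2 (by convert m using 3; ext; simp; tauto) m' s2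
  simp only [Finset.mem_insert, Finset.mem_singleton] at hQ hR
  rcases hQ with hQ | hQ | hQ
  · exact absurd hQ h.ne.symm
  · rcases hR with hR | hR | hR
    · exact absurd hR h.rot.rot.ne
    · exact absurd (hQ.trans hR.symm) h.rot.ne
    · exact ⟨hQ, hR⟩
  · rcases hR with hR | hR | hR
    · exact absurd hR h.rot.rot.ne
    · have a1 := h.1
      have a2 := h'.1
      rw [hQ, hR] at a1
      simp only [idet] at a1 a2
      exfalso; linarith
    · exact absurd (hQ.trans hR.symm) h.rot.ne

/-- A point just left of the edge and close to `Q` lies, seen from `P`, in the angles of both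
triangles, so their germs at `P` overlap. Hence an oriented edge determines the triangle on its
left, which is what makes counting by oriented edges possible. -/
theorem Tri.unique (hT : IsUnimodularTriangulation Δ T) {P Q R R' : ℤ × ℤ}
    (h : Tri T P Q R) (h' : Tri T P Q R') : R = R' := by
  have key : ∃ y : ℝ × ℝ, 0 < side R P y ∧ 0 < side P Q y ∧ 0 ≤ side R' P y ∧ 0 ≤ side P Q y := by
    have e1 : ∀ B : ℤ × ℤ, Tri T P Q B → ∀ᶠ ε : ℝ in nhdsWithin 0 (Set.Ioi 0),
        0 < side B P (toPlane Q + ε • (toPlane R - toPlane Q)) := by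
      intro B hB
      have hc : Continuous fun ε : ℝ => side B P (toPlane Q + ε • (toPlane R - toPlane Q)) :=
        (continuous_side B P).comp (by fun_prop)
      apply Filter.Eventually.filter_mono nhdsWithin_le_nhds
      apply (hc.isOpen_preimage _ isOpen_Ioi).mem_nhds
      simp [side_toPlane, ← idet_rot B P Q, hB.1]
    obtain ⟨ε, a, b, c⟩ := ((e1 _ h).and ((e1 _ h').and self_mem_nhdsWithin)).exists
    have c' : (0 : ℝ) < ε := c
    have hs : 0 < side P Q (toPlane Q + ε • (toPlane R - toPlane Q)) := by
      rw [side_add_smul_sub, side_right_self, side_toPlane, h.1]; simpa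
    exact ⟨_, a, hs, b.le, hs.le⟩
  obtain ⟨y, a, b, c, d⟩ := key
  exact (tri_eq_of_germ hT h h' a b c d).2

/-- Across an edge of a triangle beyond which `Δ` continues lies another triangle. -/
theorem exists_neighbour (hT : IsUnimodularTriangulation Δ T) (hΔ : Convex ℝ Δ) {P Q R : ℤ × ℤ}
    (h : Tri T P Q R) {x : ℝ × ℝ} (hx : x ∈ Δ) (hs : side P Q x < 0) : ∃ S, Tri T Q P S := by
  -- The midpoint of the edge has positive coordinates at `P` and `Q`, so every triangle through it
  -- contains both. The one holding the germ towards `x` cannot lie to the left.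
  set m : ℝ × ℝ := (1 / 2 : ℝ) • toPlane P + (1 / 2 : ℝ) • toPlane Q with hm
  have hmt : m ∈ hull (({P, Q, R} : Finset (ℤ × ℤ)) : Set (ℤ × ℤ)) :=
    convex_hull _ (subset_hull (by simp)) (subset_hull (by simp)) (by norm_num) (by norm_num)
      (by norm_num)
  obtain ⟨t, ht, hmt', ε, hε, -, hm'⟩ := exists_germ hT hΔ (hull_subset_polygon hT h.2 hmt) hx
  have c1 : side Q R m = 1 / 2 := by
    rw [hm, side_combo _ _ _ _ _ _ (by norm_num), side_left_self, side_toPlane, idet_rot, h.1]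
    norm_num
  have c2 : side R P m = 1 / 2 := by
    rw [hm, side_combo _ _ _ _ _ _ (by norm_num), side_right_self, side_toPlane, ← idet_rot, h.1]
    norm_num
  have c3 : side P Q m = 0 := by
    rw [hm, side_combo _ _ _ _ _ _ (by norm_num), side_right_self, side_left_self]
    norm_num
  have hP : P ∈ t := mem_of_side_pos hT h ht hmt hmt' (by rw [c1]; norm_num)
  have hQ : Q ∈ t := mem_of_side_pos hT h.rot ht
    (by convert hmt using 3; ext; simp; tauto) hmt' (by rw [c2]; norm_num)
  obtain ⟨S, rfl, hS | hS⟩ := exists_tri_of_mem₂ hT ht hP hQ h.ne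
  · exfalso
    have := ((mem_hull_triangle hS.1).1 hm').2.2
    rw [side_add_smul_sub, c3] at this
    nlinarith
  · exact ⟨S, hS⟩

end

end TropPlane

namespace TropPlane

/-! ## Boundary lattice points -/

/-- Convex closed regions with a unimodular triangulation and a two-dimensional interior
polygon. -/
structure IsAdmissible (Δ : Set (ℝ × ℝ)) (T : Finset (Finset (ℤ × ℤ))) : Prop where
  convex : Convex ℝ Δ
  closed : IsClosed Δ
  nonhyp : IsNonhyperelliptic Δ
  tri : IsUnimodularTriangulation Δ T

theorem isAdmissible_of {Δ : Set (ℝ × ℝ)} {T : Finset (Finset (ℤ × ℤ))} (hΔ : IsLatticePolygon Δ)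
    (hΔ' : IsNonhyperelliptic Δ) (hT : IsUnimodularTriangulation Δ T) : IsAdmissible Δ T := by
  obtain ⟨⟨V, rfl⟩, -⟩ := hΔ
  exact ⟨convex_hull _, (isCompact_hull V.finite_toSet).isClosed, hΔ', hT⟩

theorem exists_add_smul_mem_interior {C : Set (ℝ × ℝ)} {x : ℝ × ℝ} (hx : x ∈ interior C)
    (v : ℝ × ℝ) : ∃ ε : ℝ, 0 < ε ∧ x + ε • v ∈ interior C := by
  have hc : Continuous fun ε : ℝ => x + ε • v := by fun_prop
  have : ∀ᶠ ε : ℝ in nhdsWithin 0 (Set.Ioi 0), x + ε • v ∈ interior C := by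
    apply Filter.Eventually.filter_mono nhdsWithin_le_nhds
    exact (hc.isOpen_preimage _ isOpen_interior).mem_nhds (by simpa using hx)
  obtain ⟨ε, h1, h2⟩ := (this.and self_mem_nhdsWithin).exists
  exact ⟨ε, h2, h1⟩

/-- The weights are not normalized, so that integral identities between lattice points apply as they
stand; only the weight of the interior point has to be positive. -/
theorem mem_interior_of_combo {C : Set (ℝ × ℝ)} (hC : Convex ℝ C) {a b c x : ℝ × ℝ}
    (ha : a ∈ interior C) (hb : b ∈ C) (hc : c ∈ C) {u v w : ℝ} (hu : 0 < u) (hv : 0 ≤ v)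
    (hw : 0 ≤ w) (h : u • a + v • b + w • c = (u + v + w) • x) : x ∈ interior C := by
  have hs : 0 < u + v + w := by positivity
  have hx : x = (u / (u + v + w)) • a + ((v + w) / (u + v + w)) •
      ((v / (v + w)) • b + (w / (v + w)) • c) := by
    rcases eq_or_lt_of_le (add_nonneg hv hw) with h0 | h0
    · have hv0 : v = 0 := by linarith
      have hw0 : w = 0 := by linarith
      subst hv0 hw0
      simp only [zero_smul, add_zero] at h
      have := smul_right_injective _ hu.ne' h
      simp [hu.ne', this]
    · have : x = (u + v + w)⁻¹ • (u • a + v • b + w • c) := by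
        rw [h, smul_smul, inv_mul_cancel₀ hs.ne', one_smul]
      rw [this]
      ext <;> simp <;> field_simp <;> ring
  rcases eq_or_lt_of_le (add_nonneg hv hw) with h0 | h0
  · rw [hx, ← h0, zero_div, zero_smul, add_zero, add_assoc, ← h0, add_zero, div_self hu.ne', one_smul]
    exact ha
  · rw [hx]
    apply hC.combo_interior_self_mem_interior ha
    · exact hC hb hc (by positivity) (by positivity) (by field_simp)
    · positivity
    · positivity
    · field_simp; ring

theorem mem_interiorPts_of_combo {Δ : Set (ℝ × ℝ)} (hΔ : Convex ℝ Δ) {A B C X : ℤ × ℤ}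
    (hA : A ∈ interiorPts Δ) (hB : toPlane B ∈ Δ) (hC : toPlane C ∈ Δ) {u v w : ℤ} (hu : 0 < u)
    (hv : 0 ≤ v) (hw : 0 ≤ w) (h1 : u * A.1 + v * B.1 + w * C.1 = (u + v + w) * X.1)
    (h2 : u * A.2 + v * B.2 + w * C.2 = (u + v + w) * X.2) : X ∈ interiorPts Δ := by
  apply mem_interior_of_combo hΔ hA hB hC (u := u) (v := v) (w := w)
  · exact_mod_cast hu
  · exact_mod_cast hv
  · exact_mod_cast hw
  · ext
    · simp only [toPlane, Prod.fst_add, Prod.smul_fst, smul_eq_mul]; exact_mod_cast h1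
    · simp only [toPlane, Prod.snd_add, Prod.smul_snd, smul_eq_mul]; exact_mod_cast h2

theorem idet_sum {P Q R : ℤ × ℤ} (h : idet P Q R = 1) (A : ℤ × ℤ) :
    idet Q R A + idet R P A + idet P Q A = 1 := by
  simp only [idet] at *; linear_combination h

theorem fst_eq_idet_combo {P Q R : ℤ × ℤ} (h : idet P Q R = 1) (A : ℤ × ℤ) :
    A.1 = idet Q R A * P.1 + idet R P A * Q.1 + idet P Q A * R.1 := by
  simp only [idet] at *; linear_combination (-A.1) * h

theorem snd_eq_idet_combo {P Q R : ℤ × ℤ} (h : idet P Q R = 1) (A : ℤ × ℤ) :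
    A.2 = idet Q R A * P.2 + idet R P A * Q.2 + idet P Q A * R.2 := by
  simp only [idet] at *; linear_combination (-A.2) * h

/-- An interior point is not in the cone opposite to a triangle at a boundary vertex. -/
theorem not_opposite {Δ : Set (ℝ × ℝ)} (hΔ : Convex ℝ Δ) {P Q R A : ℤ × ℤ} (h : idet P Q R = 1)
    (hP : P ∉ interiorPts Δ) (hQ : toPlane Q ∈ Δ) (hR : toPlane R ∈ Δ) (hA : A ∈ interiorPts Δ) :
    0 < idet R P A ∨ 0 < idet P Q A := by
  by_contra! hc
  apply hP
  have hs := idet_sum h A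
  -- Solving the barycentric expansion of `A` for `P` gives nonnegative weights at `Q` and `R`,
  -- which would make `P` interior.
  apply mem_interiorPts_of_combo hΔ hA hQ hR (u := 1) (v := - idet R P A) (w := - idet P Q A)
    (by norm_num) (by linarith) (by linarith)
  · linear_combination fst_eq_idet_combo h A + P.1 * hs
  · linear_combination snd_eq_idet_combo h A + P.2 * hs

/-- The interior lattice points do not lie beyond two edges of a triangle with boundary
vertices. -/
theorem not_beyond_two_edges {Δ : Set (ℝ × ℝ)} (hΔ : Convex ℝ Δ) {P Q R A B : ℤ × ℤ}
    (h : idet P Q R = 1) (hP : P ∉ interiorPts Δ) (hQ : Q ∉ interiorPts Δ)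
    (hR : R ∉ interiorPts Δ) (hP' : toPlane P ∈ Δ) (hQ' : toPlane Q ∈ Δ) (hR' : toPlane R ∈ Δ)
    (hA : A ∈ interiorPts Δ) (hB : B ∈ interiorPts Δ)
    (h1 : idet P Q A < 0) (h2 : idet Q R B < 0) : False := by
  have hrot : idet Q R P = 1 := by rw [idet_rot, h]
  have hrot' : idet R P Q = 1 := by rw [idet_rot, hrot]
  have a1 : 0 < idet R P A := by
    have := not_opposite hΔ h hP hQ' hR' hA; omega
  have a2 : 0 < idet Q R A := by
    have := not_opposite hΔ hrot hQ hR' hP' hA; omega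
  have b1 : 0 < idet R P B := by
    have := not_opposite hΔ hrot' hR hP' hQ' hB; omega
  have b2 : 0 < idet P Q B := by
    have := not_opposite hΔ hrot hQ hR' hP' hB; omega
  have sA := idet_sum h A
  have sB := idet_sum h B
  apply hQ
  -- The weights of `A` and `B` cancel the coordinates at `P`, and the weight of `R` cancels what
  -- remains there, so that `Q` becomes a weighted mean. That the last weight is nonnegative uses
  -- integrality: the coordinates of `A` and `B` at `Q` are at least 1.
  apply mem_interiorPts_of_combo hΔ hA (interior_subset hB) hR' (u := - idet Q R B)
    (v := idet Q R A) (w := idet Q R B * idet P Q A - idet Q R A * idet P Q B)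
    (by linarith) a2.le
  · have c1 : idet Q R A ≤ - idet P Q A := by linarith
    have c2 : idet P Q B ≤ - idet Q R B := by linarith
    nlinarith [mul_le_mul c1 c2 b2.le (by linarith)]
  · linear_combination (-idet Q R B) * fst_eq_idet_combo h A + idet Q R A * fst_eq_idet_combo h B
      - idet Q R B * Q.1 * sA + idet Q R A * Q.1 * sB
  · linear_combination (-idet Q R B) * snd_eq_idet_combo h A + idet Q R A * snd_eq_idet_combo h B
      - idet Q R B * Q.2 * sA + idet Q R A * Q.2 * sB

section

variable {Δ : Set (ℝ × ℝ)} {T : Finset (Finset (ℤ × ℤ))}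

theorem Tri.mem₁ (h : IsAdmissible Δ T) {P Q R : ℤ × ℤ} (ht : Tri T P Q R) : toPlane P ∈ Δ :=
  toPlane_mem_of_mem h.tri ht.2 (by simp)

theorem Tri.mem₂ (h : IsAdmissible Δ T) {P Q R : ℤ × ℤ} (ht : Tri T P Q R) : toPlane Q ∈ Δ :=
  toPlane_mem_of_mem h.tri ht.2 (by simp)

theorem Tri.mem₃ (h : IsAdmissible Δ T) {P Q R : ℤ × ℤ} (ht : Tri T P Q R) : toPlane R ∈ Δ :=
  toPlane_mem_of_mem h.tri ht.2 (by simp)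

/-- Interior points do not lie on the line of an edge with boundary endpoints. -/
theorem idet_ne_zero {P Q R A : ℤ × ℤ} (h : IsAdmissible Δ T) (ht : Tri T P Q R)
    (hP : P ∉ interiorPts Δ) (hQ : Q ∉ interiorPts Δ) (hA : A ∈ interiorPts Δ) :
    idet P Q A ≠ 0 := by
  intro h0
  have h1 := not_opposite h.convex ht.1 hP (ht.mem₂ h) (ht.mem₃ h) hA
  have h2 := not_opposite h.convex ht.rot.1 hQ (ht.mem₃ h) (ht.mem₁ h) hA
  have hs := idet_sum ht.1 A
  omega

theorem exists_idet_neg {P Q R A : ℤ × ℤ} (ht : Tri T P Q R)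
    (hA : A ∉ ({P, Q, R} : Finset (ℤ × ℤ))) :
    idet P Q A < 0 ∨ idet Q R A < 0 ∨ idet R P A < 0 := by
  by_contra! hc
  apply hA
  apply mem_of_toPlane_mem_hull ht.1
  rw [mem_hull_triangle ht.1]
  simp only [side_toPlane]
  norm_cast
  exact ⟨hc.2.1, hc.2.2, hc.1⟩

/-- An edge with boundary endpoints that separates interior points is flanked by two triangles
with an interior vertex. -/
theorem exists_interior_opposite (h : IsAdmissible Δ T) {P Q R A : ℤ × ℤ} (ht : Tri T P Q R)
    (hP : P ∈ interiorPts Δ) (hQ : Q ∉ interiorPts Δ) (hR : R ∉ interiorPts Δ)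
    (hA : A ∈ interiorPts Δ) (hAs : idet Q R A < 0) : ∃ S ∈ interiorPts Δ, Tri T R Q S := by
  obtain ⟨S, hS⟩ := exists_neighbour h.tri h.convex ht.rot (interior_subset hA)
    (by rw [side_toPlane]; exact_mod_cast hAs)
  refine ⟨S, ?_, hS⟩
  -- Otherwise all vertices of `R Q S` lie on the boundary, while `P` lies beyond the edge `RQ` and
  -- `A` beyond another edge.
  by_contra hSi
  have hA' : A ∉ ({R, Q, S} : Finset (ℤ × ℤ)) := by
    simp only [Finset.mem_insert, Finset.mem_singleton]
    rintro (rfl | rfl | rfl) <;> contradiction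
  have hP' : idet R Q P < 0 := by
    rw [idet_swap, idet_rot, ht.1]; norm_num
  rcases exists_idet_neg hS hA' with h1 | h1 | h1
  · rw [idet_swap] at h1; omega
  · exact not_beyond_two_edges h.convex hS.1 hR hQ hSi (hS.mem₁ h) (hS.mem₂ h) (hS.mem₃ h)
      hP hA hP' h1
  · exact not_beyond_two_edges h.convex hS.rot.rot.1 hSi hR hQ (hS.mem₃ h) (hS.mem₁ h) (hS.mem₂ h)
      hA hP h1 hP'

theorem side_eq_combo {P A B : ℤ × ℤ} (h : idet P A B = 1) (Q : ℤ × ℤ) (x : ℝ × ℝ) :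
    side P Q x = side B P x * idet P Q A + side P A x * idet P Q B := by
  have h' : ((idet P A B : ℤ) : ℝ) = 1 := by rw [h]; simp
  simp only [idet] at h' ⊢; push_cast at h' ⊢
  simp only [side]; linear_combination (-(((Q.1 : ℝ) - P.1) * (x.2 - P.2) - ((Q.2 : ℝ) - P.2) * (x.1 - P.1))) * h'

theorem isEdge_iff (hT : IsUnimodularTriangulation Δ T) {P Q : ℤ × ℤ} :
    IsEdge T P Q ↔ ∃ R, Tri T P Q R ∨ Tri T Q P R := by
  constructor
  · rintro ⟨hne, t, ht, hP, hQ⟩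
    obtain ⟨R, -, hR⟩ := exists_tri_of_mem₂ hT ht hP hQ hne
    exact ⟨R, hR⟩
  · rintro ⟨R, h | h⟩
    · exact ⟨h.ne, _, h.2, by simp, by simp⟩
    · exact ⟨h.ne.symm, _, h.2, by simp, by simp⟩

/-- At every boundary lattice point starts a boundary edge with `Δ` to its left. -/
theorem exists_boundary_edge (h : IsAdmissible Δ T) {P : ℤ × ℤ} (hP : toPlane P ∈ Δ)
    (hPi : P ∉ interiorPts Δ) : ∃ Q R, Tri T P Q R ∧ ∀ x ∈ Δ, 0 ≤ side P Q x := by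
  classical
  -- The germ of the segment from `P` to any point of `Δ` lies in a triangle at `P`, so it suffices
  -- to test the edges at `P`.
  suffices hsuff : ∃ Q, IsEdge T P Q ∧ ∀ A, IsEdge T P A → 0 ≤ idet P Q A by
    obtain ⟨Q, hQ, hQA⟩ := hsuff
    have hleft : ∀ x ∈ Δ, 0 ≤ side P Q x := by
      intro x hx
      obtain ⟨A, B, hAB, h1, h2⟩ := exists_germ_tri h.tri h.convex hP hx
      rw [side_eq_combo hAB.1]
      have e1 : (0 : ℝ) ≤ idet P Q A := by
        exact_mod_cast hQA A ((isEdge_iff h.tri).2 ⟨B, Or.inl hAB⟩)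
      have e2 : (0 : ℝ) ≤ idet P Q B := by
        exact_mod_cast hQA B ((isEdge_iff h.tri).2 ⟨A, Or.inr hAB.rot.rot⟩)
      positivity
    obtain ⟨R, hR | hR⟩ := (isEdge_iff h.tri).1 hQ
    · exact ⟨Q, R, hR, hleft⟩
    · exfalso
      have := hleft _ (hR.mem₃ h)
      rw [side_toPlane, idet_swap, hR.1] at this
      norm_num at this
  have hne : (interior Δ).Nonempty := by
    obtain ⟨x, hx⟩ := h.nonhyp
    refine ⟨x, hull_subset h.convex.interior (fun P hP => hP) (interior_subset hx)⟩
  -- A supporting functional at the boundary point `P`.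
  obtain ⟨f, hf⟩ := geometric_hahn_banach_open_point h.convex.interior isOpen_interior hPi
  have hf' : ∀ x ∈ Δ, f x ≤ f (toPlane P) := by
    intro x hx
    have hx' : x ∈ closure (interior Δ) := by
      rw [h.convex.closure_interior_eq_closure_of_nonempty_interior hne]
      exact subset_closure hx
    exact closure_minimal (t := {x | f x ≤ f (toPlane P)}) (fun y hy => (hf y hy).le)
      (isClosed_le f.continuous continuous_const) hx'
  set a := f (1, 0) with ha
  set b := f (0, 1) with hb
  have hfab : ∀ x : ℝ × ℝ, f x = a * x.1 + b * x.2 := by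
    intro x
    have : x = x.1 • ((1, 0) : ℝ × ℝ) + x.2 • ((0, 1) : ℝ × ℝ) := by ext <;> simp
    conv_lhs => rw [this]
    rw [map_add, map_smul, map_smul, smul_eq_mul, smul_eq_mul]; ring
  have hab : 0 < a ^ 2 + b ^ 2 := by
    by_contra hcon
    have ha0 : a = 0 := by nlinarith [sq_nonneg a, sq_nonneg b]
    have hb0 : b = 0 := by nlinarith [sq_nonneg a, sq_nonneg b]
    obtain ⟨x, hx⟩ := hne
    have := hf x hx
    simp [hfab, ha0, hb0] at this
  -- Up to scale, `φ` is the distance from the supporting line, nonnegative on `Δ`, and `ψ` the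
  -- coordinate along it.
  set φ : ℤ × ℤ → ℝ := fun Q => -a * (Q.1 - P.1) - b * (Q.2 - P.2) with hφ
  set ψ : ℤ × ℤ → ℝ := fun Q => -b * (Q.1 - P.1) + a * (Q.2 - P.2) with hψ
  have hdet : ∀ Q A : ℤ × ℤ, (a ^ 2 + b ^ 2) * idet P Q A = ψ Q * φ A - φ Q * ψ A := by
    intro Q A; simp only [hφ, hψ, idet]; push_cast; ring
  have hφ0 : ∀ Q, IsEdge T P Q → 0 ≤ φ Q := by
    rintro Q ⟨-, t, ht, -, hQ⟩
    have := hf' _ (toPlane_mem_of_mem h.tri ht hQ)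
    rw [hfab, hfab] at this
    simp only [toPlane] at this
    simp only [hφ]; linarith
  by_cases hc : ∃ Q, IsEdge T P Q ∧ φ Q = 0 ∧ 0 < ψ Q
  · obtain ⟨Q, hQ, h1, h2⟩ := hc
    refine ⟨Q, hQ, fun A hA => ?_⟩
    have e := hdet Q A
    rw [h1, zero_mul, sub_zero] at e
    have : 0 ≤ (a ^ 2 + b ^ 2) * (idet P Q A : ℝ) := by rw [e]; exact mul_nonneg h2.le (hφ0 A hA)
    have := nonneg_of_mul_nonneg_right this hab
    exact_mod_cast this
  · push Not at hc
    have hfin : ((T.biUnion id).filter fun A => IsEdge T P A ∧ 0 < φ A).Nonempty := by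
      obtain ⟨t, ht, hPt⟩ := (toPlane_mem_iff h.tri).1 hP
      obtain ⟨A, B, hAB, rfl⟩ := exists_tri_of_mem h.tri ht hPt
      have eA : IsEdge T P A := (isEdge_iff h.tri).2 ⟨B, Or.inl hAB⟩
      have eB : IsEdge T P B := (isEdge_iff h.tri).2 ⟨A, Or.inr hAB.rot.rot⟩
      have e := hdet A B
      rw [hAB.1] at e
      by_cases hA0 : 0 < φ A
      · exact ⟨A, by simp only [Finset.mem_filter, Finset.mem_biUnion, id]
                     exact ⟨⟨_, ht, by simp⟩, eA, hA0⟩⟩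
      · by_cases hB0 : 0 < φ B
        · exact ⟨B, by simp only [Finset.mem_filter, Finset.mem_biUnion, id]
                       exact ⟨⟨_, ht, by simp⟩, eB, hB0⟩⟩
        · exfalso
          have hA1 : φ A = 0 := le_antisymm (not_lt.1 hA0) (hφ0 A eA)
          have hB1 : φ B = 0 := le_antisymm (not_lt.1 hB0) (hφ0 B eB)
          rw [hA1, hB1] at e
          simp at e
          linarith
    -- With no edge running along the positive half of the supporting line, the edge of largest
    -- slope `ψ / φ` is the first one counterclockwise from it.
    obtain ⟨Q, hQ, hmax⟩ := Finset.exists_max_image _ (fun A => ψ A / φ A) hfin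
    simp only [Finset.mem_filter] at hQ hmax
    refine ⟨Q, hQ.2.1, fun A hA => ?_⟩
    suffices 0 ≤ (a ^ 2 + b ^ 2) * (idet P Q A : ℝ) by
      have := nonneg_of_mul_nonneg_right this hab
      exact_mod_cast this
    rw [hdet]
    rcases eq_or_lt_of_le (hφ0 A hA) with h0 | h0
    · have := hc A hA h0.symm
      rw [← h0]
      nlinarith [hQ.2.2]
    · have hAm : A ∈ T.biUnion id := by
        obtain ⟨-, t, ht, -, hAt⟩ := hA
        exact Finset.mem_biUnion.2 ⟨t, ht, hAt⟩
      have := hmax A ⟨hAm, hA, h0⟩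
      rw [div_le_div_iff₀ h0 hQ.2.2] at this
      linarith

end

end TropPlane

namespace TropPlane

/-! ## Counting vertices, edges and triangles -/

/-- The vertices of `T`. -/
def verts (T : Finset (Finset (ℤ × ℤ))) : Finset (ℤ × ℤ) := T.biUnion id

open Classical in
/-- The vertices of `T` in the interior of `Δ`. -/
noncomputable def inner (Δ : Set (ℝ × ℝ)) (T : Finset (Finset (ℤ × ℤ))) : Finset (ℤ × ℤ) :=
  (verts T).filter (· ∈ interiorPts Δ)

open Classical in
/-- The vertices of `T` on the boundary of `Δ`. -/
noncomputable def outer (Δ : Set (ℝ × ℝ)) (T : Finset (Finset (ℤ × ℤ))) : Finset (ℤ × ℤ) :=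
  (verts T).filter (· ∉ interiorPts Δ)

open Classical in
/-- The oriented edges of `T` with a triangle to their left. -/
noncomputable def darts (T : Finset (Finset (ℤ × ℤ))) : Finset ((ℤ × ℤ) × (ℤ × ℤ)) :=
  (verts T ×ˢ verts T).filter fun d => ∃ R, Tri T d.1 d.2 R

open Classical in
/-- The oriented triangles of `T`. -/
noncomputable def triples (T : Finset (Finset (ℤ × ℤ))) :
    Finset ((ℤ × ℤ) × (ℤ × ℤ) × (ℤ × ℤ)) :=
  (verts T ×ˢ verts T ×ˢ verts T).filter fun d => Tri T d.1 d.2.1 d.2.2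

section

variable {Δ : Set (ℝ × ℝ)} {T : Finset (Finset (ℤ × ℤ))}

theorem Tri.mem_verts {P Q R : ℤ × ℤ} (h : Tri T P Q R) : P ∈ verts T :=
  Finset.mem_biUnion.2 ⟨_, h.2, by simp⟩

theorem mem_triples {P Q R : ℤ × ℤ} : (P, Q, R) ∈ triples T ↔ Tri T P Q R := by
  simp only [triples, Finset.mem_filter, Finset.mem_product, and_iff_right_iff_imp]
  exact fun h => ⟨h.mem_verts, h.rot.mem_verts, h.rot.rot.mem_verts⟩

theorem mem_darts {P Q : ℤ × ℤ} : (P, Q) ∈ darts T ↔ ∃ R, Tri T P Q R := by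
  simp only [darts, Finset.mem_filter, Finset.mem_product, and_iff_right_iff_imp]
  exact fun ⟨R, h⟩ => ⟨h.mem_verts, h.rot.mem_verts⟩

theorem mem_verts_iff (h : IsAdmissible Δ T) {P : ℤ × ℤ} : P ∈ verts T ↔ toPlane P ∈ Δ := by
  rw [toPlane_mem_iff h.tri]; simp [verts]

theorem mem_inner (h : IsAdmissible Δ T) {P : ℤ × ℤ} : P ∈ inner Δ T ↔ P ∈ interiorPts Δ := by
  simp only [inner, Finset.mem_filter, and_iff_right_iff_imp]
  exact fun hP => (mem_verts_iff h).2 (interior_subset hP)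

theorem mem_outer (h : IsAdmissible Δ T) {P : ℤ × ℤ} :
    P ∈ outer Δ T ↔ toPlane P ∈ Δ ∧ P ∉ interiorPts Δ := by
  simp only [outer, Finset.mem_filter, mem_verts_iff h]

theorem genus_eq_card (h : IsAdmissible Δ T) : genus Δ = (inner Δ T).card := by
  rw [genus, ← Set.ncard_coe_finset]
  congr 1
  ext P
  simp [mem_inner h]

theorem card_verts : (verts T).card = (inner Δ T).card + (outer Δ T).card := by
  classical
  rw [inner, outer, Finset.card_filter_add_card_filter_not]

theorem interiorPts_nonempty (h : IsAdmissible Δ T) : ∃ P, P ∈ interiorPts Δ := by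
  by_contra! hc
  obtain ⟨x, hx⟩ := h.nonhyp
  have : interiorPts Δ = ∅ := Set.eq_empty_iff_forall_notMem.2 hc
  simp [interiorPolygon, hull, this] at hx

theorem card_triples (hT : IsUnimodularTriangulation Δ T) : (triples T).card = 3 * T.card := by
  classical
  have hmap : ∀ d ∈ triples T, ({d.1, d.2.1, d.2.2} : Finset (ℤ × ℤ)) ∈ T := by
    rintro ⟨P, Q, R⟩ hd; exact (mem_triples.1 hd).2
  rw [Finset.card_eq_sum_card_fiberwise hmap, Finset.sum_const_nat (m := 3), mul_comm]
  intro t ht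
  obtain ⟨P, Q, R, h, rfl⟩ := exists_tri hT ht
  rw [Finset.card_eq_three]
  refine ⟨(P, Q, R), (Q, R, P), (R, P, Q), ?_, ?_, ?_, ?_⟩
  · intro he; exact h.ne (by simpa using congrArg Prod.fst he)
  · intro he; exact h.rot.rot.ne.symm (by simpa using congrArg Prod.fst he)
  · intro he; exact h.rot.ne (by simpa using congrArg Prod.fst he)
  · ext ⟨A, B, C⟩
    simp only [Finset.mem_filter, mem_triples, Finset.mem_insert, Finset.mem_singleton,
      Prod.mk.injEq]
    constructor
    · rintro ⟨hA, he⟩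
      have hA1 : A ∈ ({P, Q, R} : Finset (ℤ × ℤ)) := by rw [← he]; simp
      have hB1 : B ∈ ({P, Q, R} : Finset (ℤ × ℤ)) := by rw [← he]; simp
      simp only [Finset.mem_insert, Finset.mem_singleton] at hA1 hB1
      have hne := hA.ne
      have flip : ∀ {X Y Z W : ℤ × ℤ}, Tri T X Y Z → Tri T Y X W →
          ({X, Y, Z} : Finset (ℤ × ℤ)) = {Y, X, W} → False := by
        intro X Y Z W h1 h2 e
        have hZ : Z ∈ ({Y, X, W} : Finset (ℤ × ℤ)) := by rw [← e]; simp
        simp only [Finset.mem_insert, Finset.mem_singleton] at hZ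
        rcases hZ with rfl | rfl | rfl
        · exact h1.rot.ne rfl
        · exact h1.rot.rot.ne rfl
        · have a := h1.1; have b := h2.1; rw [idet_swap] at b; omega
      have e1 : ({Q, R, P} : Finset (ℤ × ℤ)) = {P, Q, R} := by ext; simp; tauto
      have e2 : ({R, P, Q} : Finset (ℤ × ℤ)) = {P, Q, R} := by ext; simp; tauto
      rcases hA1 with rfl | rfl | rfl <;> rcases hB1 with rfl | rfl | rfl
      · exact absurd rfl hne
      · exact Or.inl ⟨rfl, rfl, Tri.unique hT hA h⟩
      · exact (flip h.rot.rot hA (by rw [e2, he])).elim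
      · exact (flip h hA he.symm).elim
      · exact absurd rfl hne
      · exact Or.inr (Or.inl ⟨rfl, rfl, Tri.unique hT hA h.rot⟩)
      · exact Or.inr (Or.inr ⟨rfl, rfl, Tri.unique hT hA h.rot.rot⟩)
      · exact (flip h.rot hA (by rw [e1, he])).elim
      · exact absurd rfl hne
    · rintro (⟨rfl, rfl, rfl⟩ | ⟨rfl, rfl, rfl⟩ | ⟨rfl, rfl, rfl⟩)
      · exact ⟨h, rfl⟩
      · exact ⟨h.rot, by ext; simp; tauto⟩
      · exact ⟨h.rot.rot, by ext; simp; tauto⟩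

theorem card_darts (hT : IsUnimodularTriangulation Δ T) : (darts T).card = 3 * T.card := by
  rw [← card_triples hT]
  symm
  apply Finset.card_bij (fun d _ => (d.1, d.2.1))
  · rintro ⟨P, Q, R⟩ h; exact mem_darts.2 ⟨R, mem_triples.1 h⟩
  · rintro ⟨P, Q, R⟩ h ⟨P', Q', R'⟩ h' he
    simp only [Prod.mk.injEq] at he
    obtain ⟨rfl, rfl⟩ := he
    rw [Tri.unique hT (mem_triples.1 h) (mem_triples.1 h')]
  · rintro ⟨P, Q⟩ h
    obtain ⟨R, hR⟩ := mem_darts.1 h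
    exact ⟨(P, Q, R), mem_triples.2 hR, rfl⟩

/-- The value of the linear functional with coefficients `c`. -/
def lin (c P : ℤ × ℤ) : ℤ := c.1 * P.1 + c.2 * P.2

theorem exists_generic (V : Finset (ℤ × ℤ)) : ∃ c : ℤ × ℤ, c ≠ 0 ∧ Set.InjOn (lin c) V := by
  set M : ℤ := ∑ P ∈ V, |P.2| with hM
  have hM0 : 0 ≤ M := Finset.sum_nonneg fun _ _ => abs_nonneg _
  -- Second coordinates differ by at most `2M`, so they cannot compensate a nonzero multiple of `2M
  -- + 1`.
  refine ⟨(2 * M + 1, 1), by simp, ?_⟩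
  intro P hP Q hQ h
  have h1 : |P.2| ≤ M := Finset.single_le_sum (f := fun P : ℤ × ℤ => |P.2|)
    (fun _ _ => abs_nonneg _) hP
  have h2 : |Q.2| ≤ M := Finset.single_le_sum (f := fun P : ℤ × ℤ => |P.2|)
    (fun _ _ => abs_nonneg _) hQ
  rw [abs_le] at h1 h2
  simp only [lin, one_mul] at h
  have h3 : P.1 = Q.1 := by
    rcases lt_trichotomy P.1 Q.1 with h4 | h4 | h4
    · nlinarith
    · exact h4
    · nlinarith
  refine Prod.ext h3 ?_
  rw [h3] at h; linarith

/-- The point `P + s k`, where `k` is the vector `(c.2, -c.1)` in the kernel of `lin c`. -/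
def slide (c P : ℤ × ℤ) (s : ℝ) : ℝ × ℝ := (P.1 + s * c.2, P.2 - s * c.1)

theorem side_slide_left (c P Q : ℤ × ℤ) (s : ℝ) :
    side P Q (slide c P s) = s * (lin c P - lin c Q : ℤ) := by
  simp only [side, slide, lin]; push_cast; ring

theorem side_slide_right (c P R : ℤ × ℤ) (s : ℝ) :
    side R P (slide c P s) = s * (lin c R - lin c P : ℤ) := by
  simp only [side, slide, lin]; push_cast; ring

-- A triangle in which `P` has the middle value contains the germ at `P` of the level line of `lin
-- c`, here in the direction of `slide`. Conversely such a germ lies in a unique triangle, and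
-- genericity makes the inequalities strict.
open Classical in
theorem card_middle (h : IsAdmissible Δ T) {c : ℤ × ℤ} (hc : Set.InjOn (lin c) (verts T)) :
    ((triples T).filter fun d => lin c d.2.1 < lin c d.1 ∧ lin c d.1 < lin c d.2.2).card =
      ((verts T).filter fun P => ∃ s : ℝ, 0 < s ∧ slide c P s ∈ Δ).card := by
  apply Finset.card_bij (fun d _ => d.1)
  · rintro ⟨P, Q, R⟩ hd
    simp only [Finset.mem_filter, mem_triples] at hd ⊢
    obtain ⟨ht, h1, h2⟩ := hd
    refine ⟨ht.mem_verts, ?_⟩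
    have hev : ∀ᶠ s : ℝ in nhdsWithin 0 (Set.Ioi 0), 0 < side Q R (slide c P s) := by
      have hcont : Continuous fun s : ℝ => side Q R (slide c P s) :=
        (continuous_side Q R).comp (by unfold slide; fun_prop)
      apply Filter.Eventually.filter_mono nhdsWithin_le_nhds
      apply (hcont.isOpen_preimage _ isOpen_Ioi).mem_nhds
      have : slide c P 0 = toPlane P := by simp [slide, toPlane]
      simp [this, side_toPlane, idet_rot, ht.1]
    obtain ⟨s, hs1, hs2⟩ := (hev.and self_mem_nhdsWithin).exists
    have hs2' : (0 : ℝ) < s := hs2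
    refine ⟨s, hs2, hull_subset_polygon h.tri ht.2 ((mem_hull_triangle ht.1).2 ⟨hs1.le, ?_, ?_⟩)⟩
    · rw [side_slide_right]
      have : (0 : ℝ) < (lin c R - lin c P : ℤ) := by exact_mod_cast sub_pos.2 h2
      positivity
    · rw [side_slide_left]
      have : (0 : ℝ) < (lin c P - lin c Q : ℤ) := by exact_mod_cast sub_pos.2 h1
      positivity
  · rintro ⟨P, Q, R⟩ hd ⟨P', Q', R'⟩ hd' he
    simp only [Finset.mem_filter, mem_triples] at hd hd' he
    subst he
    have pos : ∀ {a b : ℤ}, a < b → (0 : ℝ) < 1 * (b - a : ℤ) := by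
      intro a b hab; rw [one_mul]; exact_mod_cast sub_pos.2 hab
    obtain ⟨rfl, rfl⟩ := tri_eq_of_germ h.tri hd.1 hd'.1 (y := slide c P 1)
      (by rw [side_slide_right]; exact pos hd.2.2) (by rw [side_slide_left]; exact pos hd.2.1)
      (by rw [side_slide_right]; exact (pos hd'.2.2).le)
      (by rw [side_slide_left]; exact (pos hd'.2.1).le)
    rfl
  · intro P hP
    simp only [Finset.mem_filter] at hP
    obtain ⟨hPv, s, hs, hsΔ⟩ := hP
    obtain ⟨Q, R, ht, h1, h2⟩ := exists_germ_tri h.tri h.convex ((mem_verts_iff h).1 hPv) hsΔ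
    rw [side_slide_right] at h1
    rw [side_slide_left] at h2
    have h1' := nonneg_of_mul_nonneg_right h1 hs
    have h2' := nonneg_of_mul_nonneg_right h2 hs
    norm_cast at h1' h2'
    have n1 : lin c Q ≠ lin c P := fun e => ht.ne (hc ht.rot.mem_verts ht.mem_verts e).symm
    have n2 : lin c R ≠ lin c P := fun e => ht.rot.rot.ne (hc ht.rot.rot.mem_verts ht.mem_verts e)
    refine ⟨(P, Q, R), ?_, rfl⟩
    simp only [Finset.mem_filter, mem_triples]
    refine ⟨ht, ?_, ?_⟩ <;> omega

-- Each triangle has one vertex with the middle value, so exactly one of its three cyclic labellings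
-- starts there. The two summands tell in which of the two directions the level line enters the
-- triangle at that vertex.
open Classical in
theorem card_eq_middle (h : IsAdmissible Δ T) {c : ℤ × ℤ} (hc : Set.InjOn (lin c) (verts T)) :
    T.card = ((triples T).filter fun d => lin c d.2.1 < lin c d.1 ∧ lin c d.1 < lin c d.2.2).card +
      ((triples T).filter fun d =>
        lin c d.1 < lin c d.2.1 ∧ lin c d.2.2 < lin c d.1).card := by
  rw [← Finset.card_union_of_disjoint]
  swap
  · rw [Finset.disjoint_filter]; intros; omega
  rw [← Finset.filter_or]
  have h3 : ((triples T).filter fun d => ¬ ((lin c d.2.1 < lin c d.1 ∧ lin c d.1 < lin c d.2.2) ∨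
      (lin c d.1 < lin c d.2.1 ∧ lin c d.2.2 < lin c d.1))).card =
      2 * ((triples T).filter fun d => ((lin c d.2.1 < lin c d.1 ∧ lin c d.1 < lin c d.2.2) ∨
      (lin c d.1 < lin c d.2.1 ∧ lin c d.2.2 < lin c d.1))).card := by
    have hrot : ∀ (p : (ℤ × ℤ) × (ℤ × ℤ) × (ℤ × ℤ) → Prop) [DecidablePred p],
        ((triples T).filter fun d => p (d.2.1, d.2.2, d.1)).card = ((triples T).filter p).card := by
      intro p _
      apply Finset.card_bij (fun d _ => (d.2.1, d.2.2, d.1))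
      · rintro ⟨P, Q, R⟩ hd
        simp only [Finset.mem_filter, mem_triples] at hd ⊢
        exact ⟨hd.1.rot, hd.2⟩
      · rintro ⟨P, Q, R⟩ _ ⟨P', Q', R'⟩ _ he
        simp only [Prod.mk.injEq] at he ⊢
        tauto
      · rintro ⟨P, Q, R⟩ hd
        simp only [Finset.mem_filter, mem_triples] at hd
        exact ⟨(R, P, Q), by simpa [mem_triples] using ⟨hd.1.rot.rot, hd.2⟩, rfl⟩
    have r1 := hrot (fun d => (lin c d.2.1 < lin c d.1 ∧ lin c d.1 < lin c d.2.2) ∨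
      (lin c d.1 < lin c d.2.1 ∧ lin c d.2.2 < lin c d.1))
    have r2 := hrot (fun d => (lin c d.2.2 < lin c d.2.1 ∧ lin c d.2.1 < lin c d.1) ∨
      (lin c d.2.1 < lin c d.2.2 ∧ lin c d.1 < lin c d.2.1))
    simp only at r1 r2
    have hu : (triples T).filter (fun d => ¬ ((lin c d.2.1 < lin c d.1 ∧ lin c d.1 < lin c d.2.2) ∨
      (lin c d.1 < lin c d.2.1 ∧ lin c d.2.2 < lin c d.1))) =
      (triples T).filter (fun d => (lin c d.2.2 < lin c d.2.1 ∧ lin c d.2.1 < lin c d.1) ∨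
        (lin c d.2.1 < lin c d.2.2 ∧ lin c d.1 < lin c d.2.1)) ∪
      (triples T).filter (fun d => (lin c d.1 < lin c d.2.2 ∧ lin c d.2.2 < lin c d.2.1) ∨
        (lin c d.2.2 < lin c d.1 ∧ lin c d.2.1 < lin c d.2.2)) := by
      rw [← Finset.filter_or]
      apply Finset.filter_congr
      rintro ⟨P, Q, R⟩ hd
      have ht := mem_triples.1 hd
      have n1 : lin c P ≠ lin c Q := fun e => ht.ne (hc ht.mem_verts ht.rot.mem_verts e)
      have n2 : lin c R ≠ lin c P := fun e => ht.rot.rot.ne (hc ht.rot.rot.mem_verts ht.mem_verts e)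
      have n3 : lin c Q ≠ lin c R := fun e => ht.rot.ne (hc ht.rot.mem_verts ht.rot.rot.mem_verts e)
      simp only
      omega
    rw [hu, Finset.card_union_of_disjoint]
    · rw [← r1, r2, r1]; ring
    · rw [Finset.disjoint_filter]; intros; omega
  have := card_triples h.tri
  have h4 := Finset.card_filter_add_card_filter_not (s := triples T)
    (fun d => (lin c d.2.1 < lin c d.1 ∧ lin c d.1 < lin c d.2.2) ∨
      (lin c d.1 < lin c d.2.1 ∧ lin c d.2.2 < lin c d.1))
  omega

end

end TropPlane

/-! ### The count of triangles, boundary edges and bounded edges. -/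

namespace TropPlane

section

variable {Δ : Set (ℝ × ℝ)} {T : Finset (Finset (ℤ × ℤ))}

theorem lin_neg (c P : ℤ × ℤ) : lin (-c) P = - lin c P := by
  simp only [lin, Prod.fst_neg, Prod.snd_neg]; ring

theorem slide_neg (c P : ℤ × ℤ) (s : ℝ) : slide (-c) P s = slide c P (-s) := by
  simp only [slide, Prod.fst_neg, Prod.snd_neg]; push_cast; ext <;> simp

theorem slide_mem_of_inner {P : ℤ × ℤ} (hP : P ∈ interiorPts Δ)
    (c : ℤ × ℤ) : ∃ s : ℝ, 0 < s ∧ slide c P s ∈ Δ := by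
  obtain ⟨s, hs, h1⟩ := exists_add_smul_mem_interior hP ((c.2 : ℝ), -(c.1 : ℝ))
  refine ⟨s, hs, ?_⟩
  convert interior_subset h1 using 1
  ext <;> simp [slide, toPlane]; ring

theorem slide_notMem_of_max (h : IsAdmissible Δ T) {c P : ℤ × ℤ}
    (hc : Set.InjOn (lin c) (verts T)) (hP : P ∈ verts T)
    (hmax : ∀ Q ∈ verts T, lin c Q ≤ lin c P) : ¬ ∃ s : ℝ, 0 < s ∧ slide c P s ∈ Δ := by
  rintro ⟨s, hs, hsΔ⟩
  obtain ⟨Q, R, ht, h1, -⟩ := exists_germ_tri h.tri h.convex ((mem_verts_iff h).1 hP) hsΔ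
  rw [side_slide_right] at h1
  have h1' := nonneg_of_mul_nonneg_right h1 hs
  norm_cast at h1'
  have := hmax R ht.rot.rot.mem_verts
  exact ht.rot.rot.ne (hc ht.rot.rot.mem_verts hP (by omega))

theorem slide_notMem_of_min (h : IsAdmissible Δ T) {c P : ℤ × ℤ}
    (hc : Set.InjOn (lin c) (verts T)) (hP : P ∈ verts T)
    (hmin : ∀ Q ∈ verts T, lin c P ≤ lin c Q) : ¬ ∃ s : ℝ, 0 < s ∧ slide c P s ∈ Δ := by
  rintro ⟨s, hs, hsΔ⟩
  obtain ⟨Q, R, ht, -, h1⟩ := exists_germ_tri h.tri h.convex ((mem_verts_iff h).1 hP) hsΔ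
  rw [side_slide_left] at h1
  have h1' := nonneg_of_mul_nonneg_right h1 hs
  norm_cast at h1'
  have := hmin Q ht.rot.mem_verts
  exact ht.ne (hc hP ht.rot.mem_verts (by omega))

/-- On the boundary, the line `lin c = const` enters `Δ` on exactly one side. -/
theorem slide_mem_iff_of_outer (h : IsAdmissible Δ T) {c P Y A : ℤ × ℤ} (hc : c ≠ 0)
    (hP : P ∉ interiorPts Δ) (hA : A ∈ interiorPts Δ) (hY : toPlane Y ∈ Δ)
    (hlin : (lin c Y < lin c P ∧ lin c P < lin c A) ∨ (lin c A < lin c P ∧ lin c P < lin c Y)) :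
    (∃ s : ℝ, 0 < s ∧ slide c P s ∈ Δ) ↔ ¬ ∃ s : ℝ, 0 < s ∧ slide (-c) P s ∈ Δ := by
  have hcc : (0 : ℝ) < c.1 ^ 2 + c.2 ^ 2 := by
    have : c.1 ≠ 0 ∨ c.2 ≠ 0 := by
      by_contra! hcon; exact hc (Prod.ext hcon.1 hcon.2)
    rcases this with h1 | h1
    · have : (0 : ℝ) < c.1 ^ 2 := by positivity
      positivity
    · have : (0 : ℝ) < c.2 ^ 2 := by positivity
      positivity
  -- The level of `P` lies strictly between those of `Y` and `A`, so the segment from `Y` to the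
  -- interior point `A` crosses the level line in an interior point of `Δ`. The line can then not
  -- also enter `Δ` on the other side of `P`, as `P` would be interior.
  obtain ⟨z, hz, s, rfl⟩ : ∃ z ∈ interior Δ, ∃ s : ℝ, z = slide c P s := by
    set u : ℝ := (lin c P - lin c Y : ℤ) / (lin c A - lin c Y : ℤ) with hu
    have hd : ((lin c A - lin c Y : ℤ) : ℝ) ≠ 0 := by
      have : lin c A - lin c Y ≠ 0 := by omega
      exact_mod_cast this
    have hu0 : 0 < u := by
      rcases hlin with ⟨a, b⟩ | ⟨a, b⟩
      · apply div_pos <;> exact_mod_cast (by omega)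
      · apply div_pos_of_neg_of_neg <;> exact_mod_cast (by omega)
    have hu1 : u ≤ 1 := by
      rcases hlin with ⟨a, b⟩ | ⟨a, b⟩
      · rw [hu, div_le_one (by exact_mod_cast (by omega))]
        exact_mod_cast (by omega)
      · rw [hu, div_le_one_of_neg (by exact_mod_cast (by omega))]
        exact_mod_cast (by omega)
    refine ⟨u • toPlane A + (1 - u) • toPlane Y, h.convex.combo_interior_self_mem_interior hA hY hu0
      (by linarith) (by ring), ?_⟩
    have hul : u * (lin c A - lin c Y : ℤ) = (lin c P - lin c Y : ℤ) := by
      rw [hu]; field_simp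
    simp only [lin] at hul
    push_cast at hul
    refine ⟨((c.2 : ℝ) * (u * A.1 + (1 - u) * Y.1 - P.1) - c.1 * (u * A.2 + (1 - u) * Y.2 - P.2)) /
      (c.1 ^ 2 + c.2 ^ 2), ?_⟩
    ext
    · simp only [toPlane, slide, Prod.fst_add, Prod.smul_fst, smul_eq_mul]
      field_simp
      linear_combination (c.1 : ℝ) * hul
    · simp only [toPlane, slide, Prod.snd_add, Prod.smul_snd, smul_eq_mul]
      field_simp
      linear_combination (c.2 : ℝ) * hul
  have hs0 : s ≠ 0 := by
    rintro rfl
    apply hP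
    simpa [slide, interiorPts, toPlane] using hz
  have excl : ∀ r : ℝ, 0 < r → 0 < r / s → slide c P (-r) ∉ Δ := by
    intro r hr hrs hmem
    have hs' : 0 < s := by
      by_contra hcon
      have := div_nonpos_of_nonneg_of_nonpos hr.le (not_lt.1 hcon)
      linarith
    apply hP
    apply mem_interior_of_combo h.convex hz hmem hmem hr hs'.le le_rfl
    ext <;> simp [slide, toPlane] <;> ring
  rcases lt_or_gt_of_ne hs0 with hs | hs
  · constructor
    · rintro ⟨r, hr, hmem⟩
      exfalso; apply hP
      apply mem_interior_of_combo h.convex hz hmem hmem hr (neg_pos.2 hs).le le_rfl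
      ext <;> simp [slide, toPlane] <;> ring
    · intro hcon
      exact (hcon ⟨-s, by linarith, by rw [slide_neg, neg_neg]; exact interior_subset hz⟩).elim
  · constructor
    · rintro - ⟨r, hr, hmem⟩
      rw [slide_neg] at hmem
      exact excl r hr (by positivity) hmem
    · intro _
      exact ⟨s, hs, interior_subset hz⟩

theorem two_le_card_verts (h : IsAdmissible Δ T) : ∃ P ∈ verts T, ∃ Q ∈ verts T, P ≠ Q := by
  obtain ⟨P, hP⟩ := interiorPts_nonempty h
  obtain ⟨t, ht, hPt⟩ := (toPlane_mem_iff h.tri).1 (interior_subset hP)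
  obtain ⟨Q, R, hQ, -⟩ := exists_tri_of_mem h.tri ht hPt
  exact ⟨P, hQ.mem_verts, Q, hQ.rot.mem_verts, hQ.ne⟩

/-- Euler's formula and Pick's formula, in the form of a count of triangles. -/
theorem card_triangles (h : IsAdmissible Δ T) :
    T.card + 2 = 2 * (inner Δ T).card + (outer Δ T).card ∧ 2 ≤ (outer Δ T).card := by
  classical
  obtain ⟨c, hc0, hc⟩ := exists_generic (verts T)
  have hc' : Set.InjOn (lin (-c)) (verts T) := by
    intro P hP Q hQ he
    simp only [lin_neg, neg_inj] at he
    exact hc hP hQ he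
  have e1 := card_eq_middle h hc
  rw [card_middle h hc] at e1
  have e2 := card_middle h hc'
  simp only [lin_neg, neg_lt_neg_iff] at e2
  rw [e2] at e1
  rw [Finset.card_filter, Finset.card_filter, ← Finset.sum_add_distrib] at e1
  -- The number of directions in which the level line through `P` enters `Δ`: 2 at interior
  -- vertices, 0 at the two extreme vertices, 1 at all other boundary vertices.
  set F : ℤ × ℤ → ℕ := fun P => (if ∃ s : ℝ, 0 < s ∧ slide c P s ∈ Δ then 1 else 0) +
    (if ∃ s : ℝ, 0 < s ∧ slide (-c) P s ∈ Δ then 1 else 0) with hF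
  have e3 : T.card = ∑ P ∈ inner Δ T, F P + ∑ P ∈ outer Δ T, F P := by
    rw [e1, inner, outer, Finset.sum_filter_add_sum_filter_not]
  have e4 : ∑ P ∈ inner Δ T, F P = 2 * (inner Δ T).card := by
    rw [Finset.sum_const_nat (m := 2), mul_comm]
    intro P hP
    rw [mem_inner h] at hP
    simp [hF, slide_mem_of_inner hP]
  obtain ⟨P₁, hP₁, P₂, hP₂, hne⟩ := two_le_card_verts h
  obtain ⟨X, hX, hXm⟩ := Finset.exists_max_image (verts T) (lin c) ⟨P₁, hP₁⟩
  obtain ⟨Y, hY, hYm⟩ := Finset.exists_min_image (verts T) (lin c) ⟨P₁, hP₁⟩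
  have hFX : F X = 0 := by
    simp only [hF]
    rw [if_neg (slide_notMem_of_max h hc hX hXm), if_neg (slide_notMem_of_min h hc' hX
      (by intro Q hQ; rw [lin_neg, lin_neg]; linarith [hXm Q hQ]))]
  have hFY : F Y = 0 := by
    simp only [hF]
    rw [if_neg (slide_notMem_of_min h hc hY hYm), if_neg (slide_notMem_of_max h hc' hY
      (by intro Q hQ; rw [lin_neg, lin_neg]; linarith [hYm Q hQ]))]
  have out : ∀ Z ∈ verts T, F Z = 0 → Z ∈ outer Δ T := by
    intro Z hZ hFZ
    rw [mem_outer h]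
    refine ⟨(mem_verts_iff h).1 hZ, fun hcon => ?_⟩
    simp [hF, slide_mem_of_inner hcon] at hFZ
  have hXY : X ≠ Y := by
    rintro rfl
    apply hne
    have a1 := hXm P₁ hP₁
    have a2 := hYm P₁ hP₁
    have a3 := hXm P₂ hP₂
    have a4 := hYm P₂ hP₂
    exact hc hP₁ hP₂ (by omega)
  have hsub : ({X, Y} : Finset (ℤ × ℤ)) ⊆ outer Δ T := by
    intro Z hZ
    simp only [Finset.mem_insert, Finset.mem_singleton] at hZ
    rcases hZ with rfl | rfl
    · exact out _ hX hFX
    · exact out _ hY hFY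
  have hcard2 : ({X, Y} : Finset (ℤ × ℤ)).card = 2 := Finset.card_pair hXY
  have e5 : ∑ P ∈ outer Δ T, F P = (outer Δ T \ {X, Y}).card := by
    rw [← Finset.sum_sdiff hsub, Finset.sum_pair hXY, hFX, hFY, Finset.card_eq_sum_ones]
    simp only [add_zero]
    apply Finset.sum_congr rfl
    intro P hP
    simp only [Finset.mem_sdiff, Finset.mem_insert, Finset.mem_singleton, not_or] at hP
    obtain ⟨hPo, hPX, hPY⟩ := hP
    rw [mem_outer h] at hPo
    have hPv : P ∈ verts T := (mem_verts_iff h).2 hPo.1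
    obtain ⟨A, hA⟩ := interiorPts_nonempty h
    have hAv : A ∈ verts T := (mem_verts_iff h).2 (interior_subset hA)
    have n1 : lin c P ≠ lin c A := fun e => hPo.2 (hc hPv hAv e ▸ hA)
    have n2 : lin c P < lin c X :=
      lt_of_le_of_ne (hXm P hPv) (fun e => hPX (hc hPv hX e))
    have n3 : lin c Y < lin c P :=
      lt_of_le_of_ne (hYm P hPv) (fun e => hPY (hc hPv hY e.symm))
    have key : (∃ s : ℝ, 0 < s ∧ slide c P s ∈ Δ) ↔ ¬ ∃ s : ℝ, 0 < s ∧ slide (-c) P s ∈ Δ := by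
      rcases lt_or_gt_of_ne n1 with h1 | h1
      · exact slide_mem_iff_of_outer h hc0 hPo.2 hA ((mem_verts_iff h).1 hY) (Or.inl ⟨n3, h1⟩)
      · exact slide_mem_iff_of_outer h hc0 hPo.2 hA ((mem_verts_iff h).1 hX) (Or.inr ⟨h1, n2⟩)
    simp only [hF]
    by_cases hk : ∃ s : ℝ, 0 < s ∧ slide (-c) P s ∈ Δ
    · rw [if_pos hk, if_neg (fun h' => key.1 h' hk)]
    · rw [if_neg hk, if_pos (key.2 hk)]
  have e6 := Finset.card_sdiff_add_card_eq_card hsub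
  omega

/-- From an interior endpoint one can move a little away from the apex `R` without leaving `Δ`, and
thereby reaches the other side of the edge. -/
theorem exists_neighbour_of_inner (h : IsAdmissible Δ T) {P Q R : ℤ × ℤ} (ht : Tri T P Q R)
    (hP : P ∈ interiorPts Δ ∨ Q ∈ interiorPts Δ) : ∃ S, Tri T Q P S := by
  rcases hP with hP | hP
  · obtain ⟨ε, hε, hm⟩ := exists_add_smul_mem_interior hP (-(toPlane R - toPlane P))
    apply exists_neighbour h.tri h.convex ht (interior_subset hm)
    have : toPlane P + ε • -(toPlane R - toPlane P) = toPlane P + (-ε) • (toPlane R - toPlane P) := by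
      module
    rw [this, side_add_smul_sub, side_left_self, side_toPlane, ht.1]
    simpa
  · obtain ⟨ε, hε, hm⟩ := exists_add_smul_mem_interior hP (-(toPlane R - toPlane Q))
    apply exists_neighbour h.tri h.convex ht (interior_subset hm)
    have : toPlane Q + ε • -(toPlane R - toPlane Q) = toPlane Q + (-ε) • (toPlane R - toPlane Q) := by
      module
    rw [this, side_add_smul_sub, side_right_self, side_toPlane, ht.1]
    simpa

-- Every boundary vertex is the tail of exactly one boundary dart. Two such darts from `P` would
-- each have the end of the other on the left, hence be parallel, and by unimodularity they are
-- primitive and of the same sign.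
open Classical in
theorem card_boundary_darts (h : IsAdmissible Δ T) :
    ((darts T).filter fun d => (d.2, d.1) ∉ darts T).card = (outer Δ T).card := by
  have left : ∀ {P Q R : ℤ × ℤ}, Tri T P Q R → (Q, P) ∉ darts T → ∀ x ∈ Δ, 0 ≤ side P Q x := by
    intro P Q R ht hn x hx
    by_contra hcon
    exact hn (mem_darts.2 (exists_neighbour h.tri h.convex ht hx (not_le.1 hcon)))
  have left' : ∀ {P Q R A : ℤ × ℤ}, Tri T P Q R → (Q, P) ∉ darts T → toPlane A ∈ Δ →
      0 ≤ idet P Q A := by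
    intro P Q R A ht hn hA
    have := left ht hn _ hA
    rw [side_toPlane] at this
    exact_mod_cast this
  apply Finset.card_bij (fun d _ => d.1)
  · rintro ⟨P, Q⟩ hd
    simp only [Finset.mem_filter, mem_darts (P := P)] at hd
    obtain ⟨⟨R, ht⟩, hn⟩ := hd
    rw [mem_outer h]
    refine ⟨ht.mem₁ h, fun hP => hn ?_⟩
    rw [mem_darts]
    exact exists_neighbour_of_inner h ht (Or.inl hP)
  · rintro ⟨P, Q⟩ hd ⟨P', Q'⟩ hd' he
    simp only at he
    subst he
    simp only [Finset.mem_filter, mem_darts (P := P)] at hd hd'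
    obtain ⟨⟨R, ht⟩, hn⟩ := hd
    obtain ⟨⟨R', ht'⟩, hn'⟩ := hd'
    have a1 := left' ht hn (ht'.mem₂ h)
    have a2 := left' ht' hn' (ht.mem₂ h)
    have a3 := left' ht' hn' (ht.mem₃ h)
    have a4 := left' ht hn (ht'.mem₃ h)
    have hflip : idet P Q' Q = - idet P Q Q' := by simp only [idet]; ring
    have h0 : idet P Q Q' = 0 := by omega
    have f1 := fst_eq_idet_combo ht.1 Q'
    have f2 := snd_eq_idet_combo ht.1 Q'
    have f3 := idet_sum ht.1 Q'
    rw [h0] at f1 f2 f3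
    set β := idet R P Q' with hβ
    have hα : idet Q R Q' = 1 - β := by linarith
    rw [hα] at f1 f2
    have b1 : idet P Q' R' = β * idet P Q R' := by
      simp only [idet]; rw [f1, f2]; ring
    have b2 : idet P Q' R = β * idet P Q R := by
      simp only [idet]; rw [f1, f2]; ring
    rw [ht'.1] at b1
    rw [ht.1] at b2
    -- `β` is a unit by unimodularity, and `-1` would put the apex `R` to the right of the boundary
    -- edge `P Q'`.
    have : β = 1 := by
      rcases Int.isUnit_iff.1 (IsUnit.of_mul_eq_one _ b1.symm) with h1 | h1
      · exact h1
      · omega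
    rw [this] at f1 f2
    simp only [Prod.mk.injEq, true_and]
    exact Prod.ext (by rw [f1]; ring) (by rw [f2]; ring)
  · intro P hP
    rw [mem_outer h] at hP
    obtain ⟨Q, R, ht, hleft⟩ := exists_boundary_edge h hP.1 hP.2
    refine ⟨(P, Q), ?_, rfl⟩
    simp only [Finset.mem_filter, mem_darts]
    refine ⟨⟨R, ht⟩, ?_⟩
    rintro ⟨S, hS⟩
    have := hleft _ (hS.mem₃ h)
    rw [side_toPlane, idet_swap, hS.1] at this
    norm_num at this

theorem mem_boundedEdges (hT : IsUnimodularTriangulation Δ T) {e : Finset (ℤ × ℤ)} :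
    e ∈ boundedEdges T ↔ ∃ P Q R S, e = {P, Q} ∧ Tri T P Q R ∧ Tri T Q P S := by
  simp only [boundedEdges, Finset.mem_filter, Finset.mem_image, Finset.mem_product]
  constructor
  · rintro ⟨⟨⟨s, t⟩, ⟨hs, ht⟩, rfl⟩, hcard⟩
    simp only at hs ht hcard ⊢
    obtain ⟨P, Q, hne, he⟩ := Finset.card_eq_two.1 hcard
    have hP : P ∈ s ∩ t := by rw [he]; simp
    have hQ : Q ∈ s ∩ t := by rw [he]; simp
    rw [Finset.mem_inter] at hP hQ
    obtain ⟨R, hsR, hR⟩ := exists_tri_of_mem₂ hT hs hP.1 hQ.1 hne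
    obtain ⟨S, htS, hS⟩ := exists_tri_of_mem₂ hT ht hP.2 hQ.2 hne
    -- The condition on the cardinality also discards the pairs `s = t`, which have three common
    -- vertices.
    have hst : s ≠ t := by
      rintro rfl
      rw [Finset.inter_self, hsR] at hcard
      rcases hR with hR | hR
      · have := hR.card; omega
      · have := hR.card
        rw [Finset.insert_comm] at this; omega
    rcases hR with hR | hR <;> rcases hS with hS | hS
    · exact absurd (by rw [hsR, htS, Tri.unique hT hR hS]) hst
    · exact ⟨P, Q, R, S, he, hR, hS⟩
    · exact ⟨Q, P, R, S, by rw [he, Finset.pair_comm], hR, hS⟩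
    · exact absurd (by rw [hsR, htS, Tri.unique hT hR hS]) hst
  · rintro ⟨P, Q, R, S, rfl, hR, hS⟩
    refine ⟨⟨(_, _), ⟨hR.2, hS.2⟩, ?_⟩, Finset.card_pair hR.ne⟩
    have hRS : R ≠ S := by
      rintro rfl
      have a := hR.1; have b := hS.1; rw [idet_swap] at b; omega
    ext X
    simp only [Finset.mem_inter, Finset.mem_insert, Finset.mem_singleton]
    constructor
    · rintro ⟨rfl | rfl | rfl, h2⟩
      · simp
      · simp
      · rcases h2 with rfl | rfl | rfl
        · exact absurd rfl hR.rot.ne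
        · exact absurd rfl hR.rot.rot.ne
        · exact absurd rfl hRS
    · rintro (rfl | rfl) <;> simp

open Classical in
theorem card_interior_darts (hT : IsUnimodularTriangulation Δ T) :
    ((darts T).filter fun d => (d.2, d.1) ∈ darts T).card = 2 * (boundedEdges T).card := by
  have hmap : ∀ d ∈ (darts T).filter (fun d => (d.2, d.1) ∈ darts T),
      ({d.1, d.2} : Finset (ℤ × ℤ)) ∈ boundedEdges T := by
    rintro ⟨P, Q⟩ hd
    simp only [Finset.mem_filter, mem_darts] at hd
    obtain ⟨⟨R, hR⟩, S, hS⟩ := hd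
    exact (mem_boundedEdges hT).2 ⟨P, Q, R, S, rfl, hR, hS⟩
  rw [Finset.card_eq_sum_card_fiberwise hmap, Finset.sum_const_nat (m := 2), mul_comm]
  intro e he
  obtain ⟨P, Q, R, S, rfl, hR, hS⟩ := (mem_boundedEdges hT).1 he
  rw [Finset.card_eq_two]
  refine ⟨(P, Q), (Q, P), fun he => hR.ne (congrArg Prod.fst he), ?_⟩
  ext ⟨A, B⟩
  simp only [Finset.mem_filter, mem_darts, Finset.mem_insert, Finset.mem_singleton, Prod.mk.injEq]
  constructor
  · rintro ⟨⟨⟨R', hR'⟩, -⟩, he⟩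
    have hA : A ∈ ({P, Q} : Finset (ℤ × ℤ)) := by rw [← he]; simp
    have hB : B ∈ ({P, Q} : Finset (ℤ × ℤ)) := by rw [← he]; simp
    have := hR'.ne
    simp only [Finset.mem_insert, Finset.mem_singleton] at hA hB
    rcases hA with rfl | rfl <;> rcases hB with rfl | rfl <;> simp_all
  · rintro (⟨rfl, rfl⟩ | ⟨rfl, rfl⟩)
    · exact ⟨⟨⟨R, hR⟩, S, hS⟩, rfl⟩
    · exact ⟨⟨⟨S, hS⟩, R, hR⟩, Finset.pair_comm _ _⟩

/-- The darts, three for each triangle, consist of two for each bounded edge and one for each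
boundary vertex; `card_triangles` supplies the number of triangles. -/
theorem card_boundedEdges (h : IsAdmissible Δ T) :
    (boundedEdges T).card + 3 = 3 * (inner Δ T).card + (outer Δ T).card ∧
      (boundedEdges T).card + 1 = T.card + (inner Δ T).card := by
  classical
  have e1 := card_triangles h
  have e2 := card_boundary_darts h
  have e3 := card_interior_darts h.tri
  have e4 := card_darts h.tri
  have e5 := Finset.card_filter_add_card_filter_not (s := darts T)
    (fun d => (d.2, d.1) ∈ darts T)
  omega

end

end TropPlane

namespace TropPlane

/-! ## Height functions -/

/-- The affine interpolation of `ω` at the vertices of a unimodular triangle. -/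
def interp (ω : ℤ × ℤ → ℝ) (P Q R : ℤ × ℤ) (x : ℝ × ℝ) : ℝ :=
  side Q R x * ω P + side R P x * ω Q + side P Q x * ω R

/-- The lifted vertices of `T` outside a triangle lie strictly above its affine span. -/
def Supports (T : Finset (Finset (ℤ × ℤ))) (ω : ℤ × ℤ → ℝ) : Prop :=
  ∀ P Q R, Tri T P Q R → ∀ S ∈ verts T, S ∉ ({P, Q, R} : Finset (ℤ × ℤ)) →
    interp ω P Q R (toPlane S) < ω S

theorem side_bary {P Q R : ℤ × ℤ} (h : idet P Q R = 1) (A B : ℤ × ℤ) (x : ℝ × ℝ) :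
    side A B x = side Q R x * side A B (toPlane P) + side R P x * side A B (toPlane Q)
      + side P Q x * side A B (toPlane R) := by
  have h' : ((idet P Q R : ℤ) : ℝ) = 1 := by rw [h]; simp
  simp only [idet] at h'; push_cast at h'
  simp only [side, toPlane]
  linear_combination (-(((B.1 : ℝ) - A.1) * (x.2 - A.2) - ((B.2 : ℝ) - A.2) * (x.1 - A.1))) * h'

theorem interp_bary {P Q R : ℤ × ℤ} (h : idet P Q R = 1) (ω : ℤ × ℤ → ℝ) (A B C : ℤ × ℤ)
    (x : ℝ × ℝ) : interp ω A B C x = side Q R x * interp ω A B C (toPlane P)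
      + side R P x * interp ω A B C (toPlane Q) + side P Q x * interp ω A B C (toPlane R) := by
  simp only [interp]
  rw [side_bary h B C x, side_bary h C A x, side_bary h A B x]; ring

theorem interp_vertex {P Q R : ℤ × ℤ} (h : idet P Q R = 1) (ω : ℤ × ℤ → ℝ) {X : ℤ × ℤ}
    (hX : X ∈ ({P, Q, R} : Finset (ℤ × ℤ))) : interp ω P Q R (toPlane X) = ω X := by
  have h1 : idet Q R P = 1 := by rw [idet_rot, h]
  have h2 : idet R P Q = 1 := by rw [idet_rot, h1]
  simp only [Finset.mem_insert, Finset.mem_singleton] at hX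
  rcases hX with rfl | rfl | rfl
  · simp [interp, side_left_self, side_right_self, side_toPlane, h1]
  · simp [interp, side_left_self, side_right_self, side_toPlane, h2]
  · simp [interp, side_left_self, side_right_self, side_toPlane, h]

theorem interp_eq_of_set {P Q R A B C : ℤ × ℤ} (h : idet P Q R = 1) (h' : idet A B C = 1)
    (he : ({P, Q, R} : Finset (ℤ × ℤ)) = {A, B, C}) (ω : ℤ × ℤ → ℝ) (x : ℝ × ℝ) :
    interp ω P Q R x = interp ω A B C x := by
  rw [interp_bary h' ω P Q R x, interp_vertex h ω (by rw [he]; simp),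
    interp_vertex h ω (by rw [he]; simp), interp_vertex h ω (by rw [he]; simp), interp]

/-- Crossing an edge changes the interpolation by a multiple of the height over the edge. -/
theorem interp_cross {P Q R S : ℤ × ℤ} (h : idet P Q R = 1) (h' : idet Q P S = 1)
    (ω : ℤ × ℤ → ℝ) (x : ℝ × ℝ) : interp ω Q P S x =
      interp ω P Q R x + side Q P x * (ω S - interp ω P Q R (toPlane S)) := by
  rw [interp_bary h' ω P Q R x, interp_vertex h ω (X := Q) (by simp),
    interp_vertex h ω (X := P) (by simp), interp]
  ring

section

variable {Δ : Set (ℝ × ℝ)} {T : Finset (Finset (ℤ × ℤ))}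

theorem notMem_of_cross {P Q R S : ℤ × ℤ} (h : Tri T P Q R) (h' : Tri T Q P S) :
    S ∉ ({P, Q, R} : Finset (ℤ × ℤ)) := by
  simp only [Finset.mem_insert, Finset.mem_singleton]
  rintro (rfl | rfl | rfl)
  · exact h'.rot.ne rfl
  · exact h'.rot.rot.ne rfl
  · have a := h.1; have b := h'.1; rw [idet_swap] at b; omega

/-- Walking towards `y` through triangles with the property `p`, one gets stuck. -/
theorem exists_stuck (hT : IsUnimodularTriangulation Δ T) {ω : ℤ × ℤ → ℝ} (hω : Supports T ω)
    (y : ℝ × ℝ) (p : Finset (ℤ × ℤ) → Prop) (hp : ∃ t ∈ T, p t) :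
    ∃ t ∈ T, p t ∧ ∀ P Q R S, t = {P, Q, R} → Tri T P Q R → Tri T Q P S → side P Q y < 0 →
      ¬ p {Q, P, S} := by
  classical
  obtain ⟨t₀, ht₀, hpt₀⟩ := hp
  obtain ⟨P₀, Q₀, R₀, h₀, rfl⟩ := exists_tri hT ht₀
  -- Crossing an edge towards `y` raises the interpolation at `y`, so a triangle with property `p`
  -- and maximal interpolation there is stuck.
  obtain ⟨⟨A, B, C⟩, hA, hmax⟩ := Finset.exists_max_image
    ((triples T).filter fun d => p {d.1, d.2.1, d.2.2}) (fun d => interp ω d.1 d.2.1 d.2.2 y)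
    ⟨(P₀, Q₀, R₀), by simpa [mem_triples] using ⟨h₀, hpt₀⟩⟩
  simp only [Finset.mem_filter, mem_triples] at hA
  refine ⟨_, hA.1.2, hA.2, ?_⟩
  intro P Q R S he h1 h2 hs hcon
  have := hmax (Q, P, S) (by simpa [mem_triples] using ⟨h2, hcon⟩)
  simp only at this
  rw [interp_eq_of_set hA.1.1 h1.1 he, interp_cross h1.1 h2.1 ω y, side_swap] at this
  have := hω P Q R h1 S h2.rot.rot.mem_verts (notMem_of_cross h1 h2)
  nlinarith

/-- The dual graph of `T` is connected, in the form: a property that is preserved when one walks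
towards the vertex `B` holds for a triangle at `B`. -/
theorem exists_mem_of_walk (h : IsAdmissible Δ T) {ω : ℤ × ℤ → ℝ} (hω : Supports T ω)
    {B : ℤ × ℤ} (hB : B ∈ verts T) (p : Finset (ℤ × ℤ) → Prop) (hp : ∃ t ∈ T, p t)
    (hstep : ∀ P Q R S, Tri T P Q R → Tri T Q P S → idet P Q B < 0 → p {P, Q, R} → p {Q, P, S}) :
    ∃ t ∈ T, B ∈ t ∧ p t := by
  obtain ⟨t, ht, hpt, hstuck⟩ := exists_stuck h.tri hω (toPlane B) p hp
  refine ⟨t, ht, ?_, hpt⟩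
  obtain ⟨P, Q, R, h1, rfl⟩ := exists_tri h.tri ht
  by_contra hBt
  have key : ∀ P' Q' R', ({P, Q, R} : Finset (ℤ × ℤ)) = {P', Q', R'} → Tri T P' Q' R' →
      ¬ idet P' Q' B < 0 := by
    intro P' Q' R' he h' hneg
    have hs : side P' Q' (toPlane B) < 0 := by rw [side_toPlane]; exact_mod_cast hneg
    obtain ⟨S, hS⟩ := exists_neighbour h.tri h.convex h' ((mem_verts_iff h).1 hB) hs
    exact hstuck P' Q' R' S he h' hS hs (hstep _ _ _ _ h' hS hneg (he ▸ hpt))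
  rcases exists_idet_neg h1 hBt with h2 | h2 | h2
  · exact key P Q R rfl h1 h2
  · exact key Q R P (by ext; simp; tauto) h1.rot h2
  · exact key R P Q (by ext; simp; tauto) h1.rot.rot h2

/-- The star of an interior vertex is connected. -/
theorem forall_star (h : IsAdmissible Δ T) {ω : ℤ × ℤ → ℝ} (hω : Supports T ω)
    {B : ℤ × ℤ} (hB : B ∈ interiorPts Δ) (p : Finset (ℤ × ℤ) → Prop)
    (hp : ∃ t ∈ T, B ∈ t ∧ p t)
    (hstep : ∀ Q R S, Tri T B Q R → Tri T B R S → (p {B, Q, R} ↔ p {B, R, S}))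
    {t : Finset (ℤ × ℤ)} (ht : t ∈ T) (hBt : B ∈ t) : p t := by
  obtain ⟨C, D, hCD, rfl⟩ := exists_tri_of_mem h.tri ht hBt
  -- The fourth vertex of the parallelogram lies strictly inside the angle at `B` of the target
  -- triangle; the walk towards it, confined to triangles at `B`, can get stuck only there.
  set y : ℝ × ℝ := toPlane C + toPlane D - toPlane B with hy
  have hyC : side B C y = 1 := by
    have := side_toPlane B C D
    rw [hCD.1] at this
    simp only [side, toPlane, hy, Prod.fst_add, Prod.snd_add, Prod.fst_sub, Prod.snd_sub] at this ⊢
    push_cast at this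
    linear_combination this
  have hyD : side D B y = 1 := by
    have := side_toPlane D B C
    rw [hCD.rot.rot.1] at this
    simp only [side, toPlane, hy, Prod.fst_add, Prod.snd_add, Prod.fst_sub, Prod.snd_sub] at this ⊢
    push_cast at this
    linear_combination this
  obtain ⟨t₀, ht₀, hBt₀, hpt₀⟩ := hp
  obtain ⟨t, ht', ⟨hBt', hpt⟩, hstuck⟩ := exists_stuck h.tri hω y (fun t => B ∈ t ∧ p t)
    ⟨t₀, ht₀, hBt₀, hpt₀⟩
  obtain ⟨Q, R, hQR, rfl⟩ := exists_tri_of_mem h.tri ht' hBt'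
  have n1 : 0 ≤ side B Q y := by
    by_contra hneg
    obtain ⟨S, hS⟩ := exists_neighbour_of_inner h hQR (Or.inl hB)
    refine hstuck B Q R S rfl hQR hS (not_le.1 hneg) ⟨by simp, ?_⟩
    have := (hstep S Q R hS.rot hQR).2 hpt
    convert this using 1; ext; simp; tauto
  have n2 : 0 ≤ side R B y := by
    by_contra hneg
    obtain ⟨S, hS⟩ := exists_neighbour_of_inner h hQR.rot.rot (Or.inr hB)
    refine hstuck R B Q S (by ext; simp; tauto) hQR.rot.rot hS (not_le.1 hneg) ⟨by simp, ?_⟩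
    exact (hstep Q R S hQR hS).1 hpt
  obtain ⟨rfl, rfl⟩ := tri_eq_of_germ h.tri hCD hQR (y := y) (by rw [hyD]; norm_num)
    (by rw [hyC]; norm_num) n2 n1
  exact hpt

/-- The gradient, up to sign, of the interpolation of `ω` on a triangle: the vertex of the tropical
curve dual to that triangle. -/
def dualVertex (ω : ℤ × ℤ → ℝ) (P Q R : ℤ × ℤ) : ℝ × ℝ :=
  (ω P * (R.2 - Q.2) + ω Q * (P.2 - R.2) + ω R * (Q.2 - P.2),
    -(ω P * (R.1 - Q.1) + ω Q * (P.1 - R.1) + ω R * (Q.1 - P.1)))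

theorem monomialValue_dualVertex (ω : ℤ × ℤ → ℝ) (P Q R X : ℤ × ℤ) :
    monomialValue ω X (dualVertex ω P Q R) =
      interp ω P Q R 0 + (ω X - interp ω P Q R (toPlane X)) := by
  simp only [monomialValue, dualVertex, interp, side, toPlane, Prod.fst_zero, Prod.snd_zero]; ring

theorem interp_monomial {P Q R : ℤ × ℤ} (h : idet P Q R = 1) {ω : ℤ × ℤ → ℝ} {p : ℝ × ℝ} {c : ℝ}
    (hP : monomialValue ω P p = c) (hQ : monomialValue ω Q p = c) (hR : monomialValue ω R p = c)
    (x : ℝ × ℝ) : interp ω P Q R x = c - (x.1 * p.1 + x.2 * p.2) := by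
  simp only [monomialValue] at hP hQ hR
  have e := eq_side_combo h x
  have e1 := congrArg Prod.fst e
  have e2 := congrArg Prod.snd e
  simp only [toPlane, Prod.fst_add, Prod.smul_fst, smul_eq_mul, Prod.snd_add, Prod.smul_snd] at e1 e2
  have hs := side_sum h x
  rw [interp]
  linear_combination side Q R x * hP + side R P x * hQ + side P Q x * hR + c * hs + p.1 * e1
    + p.2 * e2

/-- The triangle is a lower cell, so the lattice points on its supporting affine function are
vertices of the triangle. None of the three is missing, and the affine function is therefore the
interpolation. -/
theorem supports_of_induces (h : IsAdmissible Δ T) {ω : ℤ × ℤ → ℝ} (hω : Induces Δ T ω) :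
    Supports T ω := by
  intro P Q R ht S hS hSt
  have hmem : hull (({P, Q, R} : Finset (ℤ × ℤ)) : Set (ℤ × ℤ)) ∈ lowerCells Δ ω := by
    rw [hω]; exact ⟨_, ht.2, rfl⟩
  obtain ⟨p, c, hle, hhull, -⟩ := hmem
  have hsub : ∀ X, X ∈ latticePts Δ → monomialValue ω X p = c → X ∈ ({P, Q, R} : Finset (ℤ × ℤ)) := by
    intro X hX he
    apply mem_of_toPlane_mem_hull ht.1
    rw [hhull]
    exact subset_hull ⟨hX, he⟩
  -- Without the vertex `A` the cell would be contained in the line through the other two.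
  have hvert : ∀ A B C, Tri T A B C → ({A, B, C} : Finset (ℤ × ℤ)) = {P, Q, R} →
      monomialValue ω A p = c := by
    intro A B C hABC he
    by_contra hne
    have h0 : hull {X | X ∈ latticePts Δ ∧ monomialValue ω X p = c} ⊆ {x | side B C x = 0} := by
      apply hull_subset (convex_side_zero B C)
      rintro X ⟨hX, hXc⟩
      have := hsub X hX hXc
      rw [← he] at this
      simp only [Finset.mem_insert, Finset.mem_singleton] at this
      rcases this with rfl | rfl | rfl
      · exact absurd hXc hne
      · exact side_left_self _ _
      · exact side_right_self _ _
    rw [← hhull, ← he] at h0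
    have := h0 (subset_hull (P := A) (by simp))
    simp [side_toPlane, hABC.rot.1] at this
  have hP := hvert P Q R ht rfl
  have hQ := hvert Q R P ht.rot (by ext; simp; tauto)
  have hR := hvert R P Q ht.rot.rot (by ext; simp; tauto)
  rw [interp_monomial ht.1 hP hQ hR]
  have hS' : S ∈ latticePts Δ := (mem_verts_iff h).1 hS
  have h1 := lt_of_le_of_ne (hle S hS') (fun e => hSt (hsub S hS' e.symm))
  simp only [monomialValue] at h1
  simp only [toPlane]; linarith

theorem Supports.interp_le {ω : ℤ × ℤ → ℝ} (hω : Supports T ω)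
    {P Q R S : ℤ × ℤ} (ht : Tri T P Q R) (hS : S ∈ verts T) :
    interp ω P Q R (toPlane S) ≤ ω S := by
  by_cases hSt : S ∈ ({P, Q, R} : Finset (ℤ × ℤ))
  · rw [interp_vertex ht.1 ω hSt]
  · exact (hω P Q R ht S hS hSt).le

theorem equality_set (h : IsAdmissible Δ T) {ω : ℤ × ℤ → ℝ} (hω : Supports T ω) {P Q R : ℤ × ℤ}
    (ht : Tri T P Q R) : {X | X ∈ latticePts Δ ∧
      monomialValue ω X (dualVertex ω P Q R) = interp ω P Q R 0} =
      (({P, Q, R} : Finset (ℤ × ℤ)) : Set (ℤ × ℤ)) := by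
  ext X
  simp only [Set.mem_ofPred_eq, Finset.mem_coe, monomialValue_dualVertex]
  constructor
  · rintro ⟨hX, he⟩
    by_contra hXt
    have := hω P Q R ht X ((mem_verts_iff h).2 hX) hXt
    linarith
  · intro hX
    exact ⟨toPlane_mem_of_mem h.tri ht.2 hX, by rw [interp_vertex ht.1 ω hX]; ring⟩

theorem isOpen_side_pos (P Q : ℤ × ℤ) : IsOpen {x | 0 < side P Q x} :=
  isOpen_lt continuous_const (continuous_side P Q)

/-- A lower cell overlaps some triangle in an open set. There its supporting function and the
interpolation on the triangle bound each other, so the two affine functions coincide, and with them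
the sets of lattice points that they touch. -/
theorem induces_of_supports (h : IsAdmissible Δ T) {ω : ℤ × ℤ → ℝ} (hω : Supports T ω) :
    Induces Δ T ω := by
  have cent : ∀ {P Q R : ℤ × ℤ}, Tri T P Q R → ∃ m : ℝ × ℝ, 0 < side Q R m ∧ 0 < side R P m ∧
      0 < side P Q m := by
    intro P Q R ht
    refine ⟨(1 / 3 : ℝ) • toPlane P + (1 / 3 : ℝ) • toPlane Q + (1 / 3 : ℝ) • toPlane R, ?_⟩
    have key : ∀ A B : ℤ × ℤ, side A B ((1 / 3 : ℝ) • toPlane P + (1 / 3 : ℝ) • toPlane Q +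
        (1 / 3 : ℝ) • toPlane R) = (1 / 3 : ℝ) * side A B (toPlane P) +
        (1 / 3 : ℝ) * side A B (toPlane Q) + (1 / 3 : ℝ) * side A B (toPlane R) := by
      intro A B
      simp only [side, Prod.fst_add, Prod.snd_add, Prod.smul_fst, Prod.smul_snd, smul_eq_mul]; ring
    simp only [key, side_left_self, side_right_self, side_toPlane, ht.1, ht.rot.1, ht.rot.rot.1]
    norm_num
  have hint : ∀ {P Q R : ℤ × ℤ}, Tri T P Q R →
      {x | 0 < side Q R x} ∩ {x | 0 < side R P x} ∩ {x | 0 < side P Q x} ⊆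
        hull (({P, Q, R} : Finset (ℤ × ℤ)) : Set (ℤ × ℤ)) := by
    rintro P Q R ht x ⟨⟨h1, h2⟩, h3⟩
    exact (mem_hull_triangle ht.1).2 ⟨le_of_lt h1, le_of_lt h2, le_of_lt h3⟩
  have hopen : ∀ P Q R : ℤ × ℤ,
      IsOpen ({x | 0 < side Q R x} ∩ {x | 0 < side R P x} ∩ {x | 0 < side P Q x}) := fun P Q R =>
    ((isOpen_side_pos Q R).inter (isOpen_side_pos R P)).inter (isOpen_side_pos P Q)
  apply Set.eq_of_subset_of_subset
  · rintro C ⟨p, c, hle, rfl, x, hx⟩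
    set E := {P | P ∈ latticePts Δ ∧ monomialValue ω P p = c} with hE
    have hEΔ : hull E ⊆ Δ := hull_subset h.convex fun P hP => hP.1
    have hxΔ := hEΔ (interior_subset hx)
    rw [← h.tri.covers] at hxΔ
    simp only [Set.mem_iUnion, exists_prop] at hxΔ
    obtain ⟨t, ht, hxt⟩ := hxΔ
    obtain ⟨P, Q, R, hPQR, rfl⟩ := exists_tri h.tri ht
    obtain ⟨m, m1, m2, m3⟩ := cent hPQR
    -- A slight move towards the centroid stays in the interior of the cell and makes all
    -- barycentric coordinates positive.
    obtain ⟨ε, hε, hy⟩ : ∃ ε : ℝ, (0 < ε ∧ ε < 1) ∧ x + ε • (m - x) ∈ interior (hull E) := by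
      have hc : Continuous fun ε : ℝ => x + ε • (m - x) := by fun_prop
      have h1 : ∀ᶠ ε : ℝ in nhdsWithin 0 (Set.Ioi 0), x + ε • (m - x) ∈ interior (hull E) := by
        apply Filter.Eventually.filter_mono nhdsWithin_le_nhds
        exact (hc.isOpen_preimage _ isOpen_interior).mem_nhds (by simpa using hx)
      have h2 : ∀ᶠ ε : ℝ in nhdsWithin 0 (Set.Ioi 0), ε < 1 :=
        Filter.Eventually.filter_mono nhdsWithin_le_nhds (Iio_mem_nhds one_pos)
      obtain ⟨ε, a, b, c⟩ := (h1.and (h2.and self_mem_nhdsWithin)).exists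
      exact ⟨ε, ⟨c, b⟩, a⟩
    have hxt' := (mem_hull_triangle hPQR.1).1 hxt
    set W := interior (hull E) ∩
      ({x | 0 < side Q R x} ∩ {x | 0 < side R P x} ∩ {x | 0 < side P Q x}) with hW
    have hWo : IsOpen W := isOpen_interior.inter (hopen P Q R)
    set y := x + ε • (m - x) with hyd
    have hyW : y ∈ interior W := by
      rw [hWo.interior_eq]
      refine ⟨hy, ⟨?_, ?_⟩, ?_⟩ <;>
      · simp only [Set.mem_ofPred_eq, hyd, side_add_smul_sub]
        have : 0 < 1 - ε := by linarith [hε.2]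
        have := hε.1
        have := hxt'.1
        have := hxt'.2.1
        have := hxt'.2.2
        positivity
    -- the two supporting affine functions agree on `W`
    have agree : ∀ z ∈ W, c - (z.1 * p.1 + z.2 * p.2) = interp ω P Q R z := by
      rintro z ⟨hz1, hz2⟩
      have hzE : z ∈ hull E := interior_subset hz1
      have hzt := hint hPQR hz2
      apply le_antisymm
      · have hz := (mem_hull_triangle hPQR.1).1 hzt
        have e := eq_side_combo hPQR.1 z
        have e1 := congrArg Prod.fst e
        have e2 := congrArg Prod.snd e
        simp only [toPlane, Prod.fst_add, Prod.smul_fst, smul_eq_mul, Prod.snd_add,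
          Prod.smul_snd] at e1 e2
        have a1 := hle P (hPQR.mem₁ h)
        have a2 := hle Q (hPQR.mem₂ h)
        have a3 := hle R (hPQR.mem₃ h)
        simp only [monomialValue] at a1 a2 a3
        have hs := side_sum hPQR.1 z
        have b1 := mul_le_mul_of_nonneg_left a1 hz.1
        have b2 := mul_le_mul_of_nonneg_left a2 hz.2.1
        have b3 := mul_le_mul_of_nonneg_left a3 hz.2.2
        rw [interp]
        have key : c - (z.1 * p.1 + z.2 * p.2) = side Q R z * (c - (P.1 * p.1 + P.2 * p.2)) +
          side R P z * (c - (Q.1 * p.1 + Q.2 * p.2)) + side P Q z * (c - (R.1 * p.1 + R.2 * p.2)) := by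
          linear_combination (-c) * hs - p.1 * e1 - p.2 * e2
        rw [key]
        nlinarith
      -- The reverse bound holds at the lattice points spanning the cell, where the supporting
      -- function equals `ω`, and extends to their hull since both sides are affine.
      · have hconv : Convex ℝ {z : ℝ × ℝ | interp ω P Q R z ≤ c - (z.1 * p.1 + z.2 * p.2)} := by
          intro u hu v hv a b ha hb hab
          simp only [Set.mem_ofPred_eq] at *
          have e1 : interp ω P Q R (a • u + b • v) = a * interp ω P Q R u + b * interp ω P Q R v := by
            simp only [interp, side_combo _ _ _ _ _ _ hab]; ring
          rw [e1]
          simp only [Prod.fst_add, Prod.snd_add, Prod.smul_fst, Prod.smul_snd, smul_eq_mul]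
          have e2 : c = a * c + b * c := by rw [← add_mul, hab, one_mul]
          nlinarith [mul_le_mul_of_nonneg_left hu ha, mul_le_mul_of_nonneg_left hv hb]
        refine hull_subset hconv ?_ hzE
        rintro X ⟨hX, hXc⟩
        have := hω.interp_le hPQR ((mem_verts_iff h).2 hX)
        simp only [Set.mem_ofPred_eq, toPlane, monomialValue] at this hXc ⊢
        linarith
    have hgen : ∀ z : ℝ × ℝ, interp ω P Q R z =
        interp ω P Q R 0 - (z.1 * (dualVertex ω P Q R).1 + z.2 * (dualVertex ω P Q R).2) := by
      intro z
      simp only [interp, dualVertex, side, Prod.fst_zero, Prod.snd_zero]; ring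
    have hyW' := agree y (interior_subset hyW)
    obtain ⟨ε₁, hε₁, hm₁⟩ := exists_add_smul_mem_interior hyW (1, 0)
    obtain ⟨ε₂, hε₂, hm₂⟩ := exists_add_smul_mem_interior hyW (0, 1)
    have g1 := agree _ (interior_subset hm₁)
    have g2 := agree _ (interior_subset hm₂)
    rw [hgen] at hyW' g1 g2
    simp only [Prod.fst_add, Prod.snd_add, Prod.smul_fst, Prod.smul_snd, smul_eq_mul, mul_one,
      mul_zero, add_zero] at g1 g2
    have p1 : p.1 = (dualVertex ω P Q R).1 := by
      have : ε₁ * (p.1 - (dualVertex ω P Q R).1) = 0 := by linarith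
      rcases mul_eq_zero.1 this with h0 | h0
      · exact absurd h0 hε₁.ne'
      · linarith
    have p2 : p.2 = (dualVertex ω P Q R).2 := by
      have : ε₂ * (p.2 - (dualVertex ω P Q R).2) = 0 := by linarith
      rcases mul_eq_zero.1 this with h0 | h0
      · exact absurd h0 hε₂.ne'
      · linarith
    have hp : p = dualVertex ω P Q R := Prod.ext p1 p2
    have hc : c = interp ω P Q R 0 := by rw [hp] at hyW'; linarith
    refine ⟨_, ht, ?_⟩
    simp only [hE, hp, hc]
    rw [equality_set h hω hPQR]
  · rintro _ ⟨t, ht, rfl⟩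
    obtain ⟨P, Q, R, hPQR, rfl⟩ := exists_tri h.tri ht
    refine ⟨dualVertex ω P Q R, interp ω P Q R 0, ?_, ?_, ?_⟩
    · intro X hX
      rw [monomialValue_dualVertex]
      linarith [hω.interp_le hPQR ((mem_verts_iff h).2 hX)]
    · rw [equality_set h hω hPQR]
    · obtain ⟨m, m1, m2, m3⟩ := cent hPQR
      exact ⟨m, interior_maximal (hint hPQR) (hopen P Q R) ⟨⟨m1, m2⟩, m3⟩⟩

end

end TropPlane

namespace TropPlane

/-! ## The pruned curve -/

/-- The edge from `P` to `Q` has an interior endpoint, or it is flanked by two triangles with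
interior apex. -/
def CoreDart (Δ : Set (ℝ × ℝ)) (T : Finset (Finset (ℤ × ℤ))) (P Q : ℤ × ℤ) : Prop :=
  ∃ R S, Tri T P Q R ∧ Tri T Q P S ∧
    (P ∈ interiorPts Δ ∨ Q ∈ interiorPts Δ ∨ (R ∈ interiorPts Δ ∧ S ∈ interiorPts Δ))

section

variable {Δ : Set (ℝ × ℝ)} {T : Finset (Finset (ℤ × ℤ))}

theorem CoreDart.symm {P Q : ℤ × ℤ} (h : CoreDart Δ T P Q) : CoreDart Δ T Q P := by
  obtain ⟨R, S, h1, h2, h3⟩ := h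
  exact ⟨S, R, h2, h1, by tauto⟩

theorem Tri.coreDart (h : IsAdmissible Δ T) {P Q R : ℤ × ℤ} (ht : Tri T P Q R)
    (hP : P ∈ interiorPts Δ ∨ Q ∈ interiorPts Δ) : CoreDart Δ T P Q := by
  obtain ⟨S, hS⟩ := exists_neighbour_of_inner h ht hP
  exact ⟨R, S, ht, hS, by tauto⟩

theorem CoreDart.mem_boundedEdges (hT : IsUnimodularTriangulation Δ T) {P Q : ℤ × ℤ}
    (h : CoreDart Δ T P Q) : {P, Q} ∈ boundedEdges T := by
  obtain ⟨R, S, h1, h2, -⟩ := h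
  exact (TropPlane.mem_boundedEdges hT).2 ⟨P, Q, R, S, rfl, h1, h2⟩

theorem pair_eq {P Q A B : ℤ × ℤ} (h : ({P, Q} : Finset (ℤ × ℤ)) = {A, B}) (hPQ : P ≠ Q) :
    (P = A ∧ Q = B) ∨ (P = B ∧ Q = A) := by
  have hP : P ∈ ({A, B} : Finset (ℤ × ℤ)) := by rw [← h]; simp
  have hQ : Q ∈ ({A, B} : Finset (ℤ × ℤ)) := by rw [← h]; simp
  simp only [Finset.mem_insert, Finset.mem_singleton] at hP hQ
  rcases hP with rfl | rfl <;> rcases hQ with rfl | rfl <;> simp_all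

theorem CoreDart.of_pair_eq {P Q A B : ℤ × ℤ} (h : CoreDart Δ T A B)
    (he : ({A, B} : Finset (ℤ × ℤ)) = {P, Q}) : CoreDart Δ T P Q := by
  have hne : A ≠ B := by obtain ⟨R, S, h1, -⟩ := h; exact h1.ne
  rcases pair_eq he hne with ⟨rfl, rfl⟩ | ⟨rfl, rfl⟩
  · exact h
  · exact h.symm

/-- Every triangle along a core edge has an interior vertex. -/
theorem CoreDart.exists_inner (hT : IsUnimodularTriangulation Δ T) {P Q : ℤ × ℤ}
    (h : CoreDart Δ T P Q) {t : Finset (ℤ × ℤ)} (ht : t ∈ T) (hP : P ∈ t) (hQ : Q ∈ t) :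
    ∃ A ∈ t, A ∈ interiorPts Δ := by
  obtain ⟨R, S, h1, h2, h3⟩ := h
  rcases h3 with h3 | h3 | ⟨h3, h4⟩
  · exact ⟨P, hP, h3⟩
  · exact ⟨Q, hQ, h3⟩
  · obtain ⟨X, rfl, hX | hX⟩ := exists_tri_of_mem₂ hT ht hP hQ h1.ne
    · exact ⟨X, by simp, by rwa [← Tri.unique hT h1 hX]⟩
    · exact ⟨X, by simp, by rwa [← Tri.unique hT h2 hX]⟩

/-- Each triangle along a core edge has an interior vertex, and both of its edges at that vertex are
core. So a core edge has a second core edge at either end, and no first core edge can be removed. -/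
theorem not_pruned_of_coreDart (h : IsAdmissible Δ T) {e : Finset (ℤ × ℤ)} (he : Pruned T e) :
    ∀ P Q, e = {P, Q} → ¬ CoreDart Δ T P Q := by
  induction he with
  | leaf e t he ht het _ ih =>
    rintro P Q rfl hc
    obtain ⟨A, hA, hAi⟩ := hc.exists_inner h.tri ht (het (by simp)) (het (by simp))
    obtain ⟨B, C, hABC, rfl⟩ := exists_tri_of_mem h.tri ht hA
    have c1 : CoreDart Δ T A B := hABC.coreDart h (Or.inl hAi)
    have c2 : CoreDart Δ T A C := (hABC.rot.rot.coreDart h (Or.inr hAi)).symm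
    by_cases heq : ({A, B} : Finset (ℤ × ℤ)) = {P, Q}
    · refine ih {A, C} (c2.mem_boundedEdges h.tri) ?_ ?_ A C rfl c2
      · intro X; simp; tauto
      · rw [← heq]
        intro hcon
        rcases pair_eq hcon hABC.rot.rot.ne.symm with ⟨-, h2⟩ | ⟨h1, -⟩
        · exact hABC.rot.ne h2.symm
        · exact hABC.ne h1
    · refine ih {A, B} (c1.mem_boundedEdges h.tri) ?_ heq A B rfl c1
      intro X; simp; tauto

/-- All interior points lie beyond the same edge of a triangle with boundary vertices. -/
theorem beyond_all (h : IsAdmissible Δ T) {P Q R A B : ℤ × ℤ} (ht : Tri T P Q R)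
    (hP : P ∉ interiorPts Δ) (hQ : Q ∉ interiorPts Δ) (hR : R ∉ interiorPts Δ)
    (hA : A ∈ interiorPts Δ) (hB : B ∈ interiorPts Δ) (h1 : idet P Q A < 0) : idet P Q B < 0 := by
  have hB' : B ∉ ({P, Q, R} : Finset (ℤ × ℤ)) := by
    simp only [Finset.mem_insert, Finset.mem_singleton]
    rintro (rfl | rfl | rfl) <;> contradiction
  rcases exists_idet_neg ht hB' with h2 | h2 | h2
  · exact h2
  · exact (not_beyond_two_edges h.convex ht.1 hP hQ hR (ht.mem₁ h) (ht.mem₂ h) (ht.mem₃ h)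
      hA hB h1 h2).elim
  · exact (not_beyond_two_edges h.convex ht.rot.rot.1 hR hP hQ (ht.mem₃ h) (ht.mem₁ h) (ht.mem₂ h)
      hB hA h2 h1).elim

theorem pair_subset_cases {P Q R : ℤ × ℤ} {X Y : ℤ × ℤ} (hXY : X ≠ Y)
    (h : ({X, Y} : Finset (ℤ × ℤ)) ⊆ {P, Q, R}) :
    ({X, Y} : Finset (ℤ × ℤ)) = {P, Q} ∨ ({X, Y} : Finset (ℤ × ℤ)) = {Q, R} ∨
      ({X, Y} : Finset (ℤ × ℤ)) = {R, P} := by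
  have hX : X ∈ ({P, Q, R} : Finset (ℤ × ℤ)) := h (by simp)
  have hY : Y ∈ ({P, Q, R} : Finset (ℤ × ℤ)) := h (by simp)
  simp only [Finset.mem_insert, Finset.mem_singleton] at hX hY
  rcases hX with rfl | rfl | rfl <;> rcases hY with rfl | rfl | rfl <;>
    simp_all [Finset.pair_comm]

theorem exists_tri_of_pair_mem (hT : IsUnimodularTriangulation Δ T) {P Q : ℤ × ℤ}
    (h : {P, Q} ∈ boundedEdges T) : P ≠ Q ∧ ∃ R S, Tri T P Q R ∧ Tri T Q P S := by
  obtain ⟨A, B, R, S, he, h1, h2⟩ := (mem_boundedEdges hT).1 h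
  rcases pair_eq he.symm h1.ne with ⟨rfl, rfl⟩ | ⟨rfl, rfl⟩
  · exact ⟨h1.ne, R, S, h1, h2⟩
  · exact ⟨h2.ne, S, R, h2, h1⟩

/-- The triangle to the left of `PQ` lies on the side without interior points, and its other two
edges again have all interior points on the side of that triangle. So everything beyond `PQ` is
removed before `PQ`. Walking away from `A₀` lowers the interpolation at `A₀`; the induction counts
the triangles with a smaller value. -/
theorem pruned_of_beyond (h : IsAdmissible Δ T) {ω : ℤ × ℤ → ℝ} (hω : Supports T ω)
    {A₀ : ℤ × ℤ} (hA₀ : A₀ ∈ interiorPts Δ) (n : ℕ) : ∀ {P Q R : ℤ × ℤ}, Tri T P Q R →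
    P ∉ interiorPts Δ → Q ∉ interiorPts Δ → (∀ A ∈ interiorPts Δ, idet P Q A < 0) →
    {P, Q} ∈ boundedEdges T →
    ((triples T).filter fun d => interp ω d.1 d.2.1 d.2.2 (toPlane A₀) <
      interp ω P Q R (toPlane A₀)).card ≤ n → Pruned T {P, Q} := by
  classical
  induction n using Nat.strong_induction_on with
  | _ n ih =>
  intro P Q R ht hP hQ hA he hcard
  have hR : R ∉ interiorPts Δ := fun hR => by
    have := hA R hR; rw [ht.1] at this; omega
  refine Pruned.leaf _ {P, Q, R} he ht.2 (by intro X; simp; tauto) ?_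
  have step : ∀ X Y Z W : ℤ × ℤ, Tri T X Y Z → Tri T Y X W → X ∉ interiorPts Δ → Y ∉ interiorPts Δ →
      ({X, Y, Z} : Finset (ℤ × ℤ)) = {P, Q, R} → (∀ A ∈ interiorPts Δ, 0 < idet X Y A) →
      ({Y, X} : Finset (ℤ × ℤ)) ∈ boundedEdges T → Pruned T {Y, X} := by
    intro X Y Z W h1 h2 hX hY hs hpos hb
    have hlt : interp ω Y X W (toPlane A₀) < interp ω P Q R (toPlane A₀) := by
      rw [← interp_eq_of_set h1.1 ht.1 hs, interp_cross h1.1 h2.1, side_toPlane, idet_swap]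
      have a1 := hω X Y Z h1 W h2.rot.rot.mem_verts (notMem_of_cross h1 h2)
      have a2 : (0 : ℝ) < idet X Y A₀ := by exact_mod_cast hpos A₀ hA₀
      push_cast
      nlinarith
    refine ih _ (lt_of_lt_of_le ?_ hcard) h2 hY hX (fun A hA' => ?_) hb le_rfl
    · apply Finset.card_lt_card
      rw [Finset.ssubset_iff_of_subset]
      · exact ⟨(Y, X, W), by simpa [mem_triples] using ⟨h2, hlt⟩, by simp⟩
      · intro d hd
        simp only [Finset.mem_filter] at hd ⊢
        exact ⟨hd.1, hd.2.trans hlt⟩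
    · rw [idet_swap]; have := hpos A hA'; omega
  intro e' he' hsub hne
  obtain ⟨X, Y, Z, W, rfl, hXY, hYX⟩ := (mem_boundedEdges h.tri).1 he'
  rcases pair_subset_cases hXY.ne hsub with hc | hc | hc
  · exact absurd hc hne
  · rw [hc] at he' ⊢
    obtain ⟨-, Z', W', h1, h2⟩ := exists_tri_of_pair_mem h.tri he'
    rw [Finset.pair_comm] at he' ⊢
    refine step Q R P W' ht.rot h2 hQ hR (by ext; simp; tauto) (fun A hA' => ?_) he'
    have := not_opposite h.convex ht.rot.1 hQ (ht.mem₃ h) (ht.mem₁ h) hA'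
    have := hA A hA'
    omega
  · rw [hc] at he' ⊢
    obtain ⟨-, Z', W', h1, h2⟩ := exists_tri_of_pair_mem h.tri he'
    rw [Finset.pair_comm] at he' ⊢
    refine step R P Q W' ht.rot.rot h2 hR hP (by ext; simp; tauto) (fun A hA' => ?_) he'
    have := not_opposite h.convex ht.1 hP (ht.mem₂ h) (ht.mem₃ h) hA'
    have := hA A hA'
    omega

/-- If an edge is not in the core, all interior points lie on one side of it. -/
theorem one_side (h : IsAdmissible Δ T) {P Q R S : ℤ × ℤ} (h1 : Tri T P Q R) (h2 : Tri T Q P S)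
    (hc : ¬ CoreDart Δ T P Q) : P ∉ interiorPts Δ ∧ Q ∉ interiorPts Δ ∧
      ((∀ A ∈ interiorPts Δ, idet P Q A < 0) ∨ (∀ A ∈ interiorPts Δ, idet Q P A < 0)) := by
  have hP : P ∉ interiorPts Δ := fun hP => hc ⟨R, S, h1, h2, Or.inl hP⟩
  have hQ : Q ∉ interiorPts Δ := fun hQ => hc ⟨R, S, h1, h2, Or.inr (Or.inl hQ)⟩
  refine ⟨hP, hQ, ?_⟩
  have hRS : R ∉ interiorPts Δ ∨ S ∉ interiorPts Δ := by
    by_contra! hcon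
    exact hc ⟨R, S, h1, h2, Or.inr (Or.inr hcon)⟩
  rcases hRS with hR | hS
  · by_cases hex : ∃ A ∈ interiorPts Δ, idet P Q A < 0
    · obtain ⟨A, hA, hA'⟩ := hex
      exact Or.inl fun B hB => beyond_all h h1 hP hQ hR hA hB hA'
    · push Not at hex
      refine Or.inr fun A hA => ?_
      have := hex A hA
      have := idet_ne_zero h h1 hP hQ hA
      rw [idet_swap]; omega
  · by_cases hex : ∃ A ∈ interiorPts Δ, idet Q P A < 0
    · obtain ⟨A, hA, hA'⟩ := hex
      exact Or.inr fun B hB => beyond_all h h2 hQ hP hS hA hB hA'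
    · push Not at hex
      refine Or.inl fun A hA => ?_
      have := hex A hA
      have := idet_ne_zero h h2 hQ hP hA
      rw [idet_swap]; omega

theorem pair_mem_coreEdges (h : IsAdmissible Δ T) {ω : ℤ × ℤ → ℝ} (hω : Supports T ω)
    {P Q : ℤ × ℤ} : {P, Q} ∈ coreEdges T ↔ CoreDart Δ T P Q := by
  classical
  simp only [coreEdges, Finset.mem_filter]
  constructor
  · rintro ⟨hb, hp⟩
    by_contra hc
    apply hp
    obtain ⟨A₀, hA₀⟩ := interiorPts_nonempty h
    obtain ⟨-, R, S, h1, h2⟩ := exists_tri_of_pair_mem h.tri hb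
    obtain ⟨hP, hQ, hs | hs⟩ := one_side h h1 h2 hc
    · exact pruned_of_beyond h hω hA₀ _ h1 hP hQ hs hb le_rfl
    · rw [Finset.pair_comm] at hb ⊢
      exact pruned_of_beyond h hω hA₀ _ h2 hQ hP hs hb le_rfl
  · intro hc
    exact ⟨hc.mem_boundedEdges h.tri, fun hp => not_pruned_of_coreDart h hp P Q rfl hc⟩

theorem mem_coreEdges (h : IsAdmissible Δ T) {ω : ℤ × ℤ → ℝ} (hω : Supports T ω)
    {e : Finset (ℤ × ℤ)} : e ∈ coreEdges T ↔ ∃ P Q, e = {P, Q} ∧ CoreDart Δ T P Q := by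
  constructor
  · intro he
    have hb : e ∈ boundedEdges T := by
      classical
      exact (Finset.mem_filter.1 he).1
    obtain ⟨P, Q, R, S, rfl, -, -⟩ := (mem_boundedEdges h.tri).1 hb
    exact ⟨P, Q, rfl, (pair_mem_coreEdges h hω).1 he⟩
  · rintro ⟨P, Q, rfl, hc⟩
    exact (pair_mem_coreEdges h hω).2 hc

theorem coreEdges_subset : coreEdges T ⊆ boundedEdges T := by
  classical
  exact Finset.filter_subset _ _

/-- A bounded edge lies in two triangles. -/
theorem card_triangles_of_edge (hT : IsUnimodularTriangulation Δ T) {e : Finset (ℤ × ℤ)}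
    (he : e ∈ boundedEdges T) : (T.filter fun t => e ⊆ t).card = 2 := by
  obtain ⟨P, Q, R, S, rfl, h1, h2⟩ := (mem_boundedEdges hT).1 he
  rw [Finset.card_eq_two]
  refine ⟨{P, Q, R}, {Q, P, S}, ?_, ?_⟩
  · intro hcon
    exact notMem_of_cross h1 h2 (by rw [hcon]; simp)
  · ext t
    simp only [Finset.mem_filter, Finset.mem_insert, Finset.mem_singleton]
    constructor
    · rintro ⟨ht, hsub⟩
      obtain ⟨X, rfl, hX | hX⟩ := exists_tri_of_mem₂ hT ht (hsub (by simp : P ∈ _))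
        (hsub (by simp : Q ∈ _)) h1.ne
      · exact Or.inl (by rw [Tri.unique hT h1 hX])
      · exact Or.inr (by rw [Tri.unique hT h2 hX, Finset.insert_comm])
    · rintro (rfl | rfl)
      · exact ⟨h1.2, by intro X; simp; tauto⟩
      · exact ⟨h2.2, by intro X; simp; tauto⟩

theorem sum_coreDegree (hT : IsUnimodularTriangulation Δ T) :
    ∑ t ∈ T, coreDegree T t = 2 * (coreEdges T).card := by
  have := Finset.sum_card_bipartiteAbove_eq_sum_card_bipartiteBelow
    (s := T) (t := coreEdges T) (fun t e => e ⊆ t)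
  simp only [Finset.bipartiteAbove, Finset.bipartiteBelow] at this
  simp only [coreDegree]
  rw [this, Finset.sum_const_nat (m := 2), mul_comm]
  intro e he
  exact card_triangles_of_edge hT (coreEdges_subset he)

open Classical in
theorem coreDegree_eq (h : IsAdmissible Δ T) {ω : ℤ × ℤ → ℝ} (hω : Supports T ω)
    {P Q R : ℤ × ℤ} (ht : Tri T P Q R) : coreDegree T {P, Q, R} =
      (if CoreDart Δ T P Q then 1 else 0) + (if CoreDart Δ T Q R then 1 else 0)
        + (if CoreDart Δ T R P then 1 else 0) := by
  have n1 : ({P, Q} : Finset (ℤ × ℤ)) ≠ {Q, R} := fun hcon => by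
    rcases pair_eq hcon ht.ne with ⟨h1, -⟩ | ⟨h1, -⟩
    · exact ht.ne h1
    · exact ht.rot.rot.ne h1.symm
  have n2 : ({Q, R} : Finset (ℤ × ℤ)) ≠ {R, P} := fun hcon => by
    rcases pair_eq hcon ht.rot.ne with ⟨h1, -⟩ | ⟨h1, -⟩
    · exact ht.rot.ne h1
    · exact ht.ne h1.symm
  have n3 : ({P, Q} : Finset (ℤ × ℤ)) ≠ {R, P} := fun hcon => by
    rcases pair_eq hcon ht.ne with ⟨h1, -⟩ | ⟨-, h1⟩
    · exact ht.rot.rot.ne h1.symm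
    · exact ht.rot.ne h1
  have : (coreEdges T).filter (fun e => e ⊆ {P, Q, R}) =
      ({{P, Q}, {Q, R}, {R, P}} : Finset (Finset (ℤ × ℤ))).filter (· ∈ coreEdges T) := by
    ext e
    simp only [Finset.mem_filter, Finset.mem_insert, Finset.mem_singleton]
    constructor
    · rintro ⟨he, hsub⟩
      refine ⟨?_, he⟩
      obtain ⟨X, Y, rfl, R', S', h1, -⟩ := (mem_coreEdges h hω).1 he
      exact pair_subset_cases h1.ne hsub
    · rintro ⟨hc, he⟩
      refine ⟨he, ?_⟩
      rcases hc with rfl | rfl | rfl <;> (intro X; simp; tauto)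
  rw [coreDegree, this, Finset.card_filter, Finset.sum_insert (by simp [n1, n3]),
    Finset.sum_insert (by simpa using n2), Finset.sum_singleton]
  simp only [pair_mem_coreEdges h hω, add_assoc]

/-- The two edges at an interior vertex always survive, so only the opposite edge decides the
valence. -/
theorem coreDegree_of_inner (h : IsAdmissible Δ T) {ω : ℤ × ℤ → ℝ} (hω : Supports T ω)
    {P Q R : ℤ × ℤ} (ht : Tri T P Q R) (hP : P ∈ interiorPts Δ) :
    (CoreDart Δ T Q R ∧ coreDegree T {P, Q, R} = 3) ∨
      (¬ CoreDart Δ T Q R ∧ coreDegree T {P, Q, R} = 2) := by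
  rw [coreDegree_eq h hω ht, if_pos (ht.coreDart h (Or.inl hP)),
    if_pos (ht.rot.rot.coreDart h (Or.inr hP))]
  by_cases hc : CoreDart Δ T Q R <;> simp [hc]

theorem coreDegree_eq_zero (h : IsAdmissible Δ T) {ω : ℤ × ℤ → ℝ} (hω : Supports T ω)
    {t : Finset (ℤ × ℤ)} (ht : t ∈ T) (hi : ∀ P ∈ t, P ∉ interiorPts Δ) : coreDegree T t = 0 := by
  rw [coreDegree, Finset.card_eq_zero, Finset.filter_eq_empty_iff]
  intro e he hsub
  obtain ⟨P, Q, rfl, hc⟩ := (mem_coreEdges h hω).1 he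
  obtain ⟨A, hA, hAi⟩ := hc.exists_inner h.tri ht (hsub (by simp)) (hsub (by simp))
  exact hi A hA hAi

theorem tri_rotation {P Q R A B C : ℤ × ℤ} (h : Tri T P Q R)
    (h' : Tri T A B C) (he : ({A, B, C} : Finset (ℤ × ℤ)) = {P, Q, R}) :
    (A = P ∧ B = Q ∧ C = R) ∨ (A = Q ∧ B = R ∧ C = P) ∨ (A = R ∧ B = P ∧ C = Q) := by
  have hA : A ∈ ({P, Q, R} : Finset (ℤ × ℤ)) := by rw [← he]; simp
  have hB : B ∈ ({P, Q, R} : Finset (ℤ × ℤ)) := by rw [← he]; simp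
  have hC : C ∈ ({P, Q, R} : Finset (ℤ × ℤ)) := by rw [← he]; simp
  have hne := h'.ne
  have hne2 := h'.rot.ne
  have hne3 := h'.rot.rot.ne
  have d1 := h.1
  have d2 := h'.1
  simp only [idet] at d1 d2
  simp only [Finset.mem_insert, Finset.mem_singleton] at hA hB hC
  rcases hA with rfl | rfl | rfl <;> rcases hB with rfl | rfl | rfl <;>
    rcases hC with rfl | rfl | rfl <;> first | (exfalso; tauto) | (exfalso; linarith) | simp

-- Both sides count darts with boundary ends, a triangle to the left and all interior points to the
-- right. A triangle without interior vertices has exactly one such edge, and a bounded edge off the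
-- core exactly one such orientation.
open Classical in
theorem card_outer_triangles (h : IsAdmissible Δ T) {ω : ℤ × ℤ → ℝ} (hω : Supports T ω) :
    (T.filter fun t => ¬ ∃ P ∈ t, P ∈ interiorPts Δ).card =
      ((boundedEdges T).filter fun e => e ∉ coreEdges T).card := by
  set D := (triples T).filter fun d => (d.1 ∉ interiorPts Δ ∧ d.2.1 ∉ interiorPts Δ) ∧
    ∀ A ∈ interiorPts Δ, idet d.1 d.2.1 A < 0 with hD
  obtain ⟨A₀, hA₀⟩ := interiorPts_nonempty h
  have hDR : ∀ {P Q R : ℤ × ℤ}, Tri T P Q R → (∀ A ∈ interiorPts Δ, idet P Q A < 0) →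
      R ∉ interiorPts Δ := fun ht hA hR => by
    have := hA _ hR; rw [ht.1] at this; omega
  have c1 : D.card = (T.filter fun t => ¬ ∃ P ∈ t, P ∈ interiorPts Δ).card := by
    apply Finset.card_bij (fun d _ => {d.1, d.2.1, d.2.2})
    · rintro ⟨P, Q, R⟩ hd
      simp only [hD, Finset.mem_filter, mem_triples] at hd ⊢
      refine ⟨hd.1.2, ?_⟩
      rintro ⟨X, hX, hXi⟩
      have := hDR hd.1 hd.2.2
      simp only [Finset.mem_insert, Finset.mem_singleton] at hX
      rcases hX with rfl | rfl | rfl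
      · exact hd.2.1.1 hXi
      · exact hd.2.1.2 hXi
      · exact this hXi
    · rintro ⟨P, Q, R⟩ hd ⟨P', Q', R'⟩ hd' he
      simp only [hD, Finset.mem_filter, mem_triples] at hd hd' he
      have s1 := hd.2.2 A₀ hA₀
      have s2 := hd'.2.2 A₀ hA₀
      have hR := hDR hd.1 hd.2.2
      rcases tri_rotation hd'.1 hd.1 he with ⟨rfl, rfl, rfl⟩ | ⟨rfl, rfl, rfl⟩ | ⟨rfl, rfl, rfl⟩
      · rfl
      · have := not_opposite h.convex hd.1.1 hd.2.1.1 (hd.1.mem₂ h) (hd.1.mem₃ h) hA₀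
        omega
      · have := not_opposite h.convex hd'.1.1 hd'.2.1.1 (hd'.1.mem₂ h) (hd'.1.mem₃ h) hA₀
        omega
    · intro t ht
      simp only [Finset.mem_filter, not_exists, not_and] at ht
      obtain ⟨ht, hi⟩ := ht
      obtain ⟨P, Q, R, hPQR, rfl⟩ := exists_tri h.tri ht
      have key : ∀ X Y Z, Tri T X Y Z → ({X, Y, Z} : Finset (ℤ × ℤ)) = {P, Q, R} →
          idet X Y A₀ < 0 → (X, Y, Z) ∈ D := by
        intro X Y Z hXYZ he hneg
        have hX := hi X (by rw [← he]; simp)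
        have hY := hi Y (by rw [← he]; simp)
        have hZ := hi Z (by rw [← he]; simp)
        simp only [hD, Finset.mem_filter, mem_triples]
        exact ⟨hXYZ, ⟨hX, hY⟩, fun A hA => beyond_all h hXYZ hX hY hZ hA₀ hA hneg⟩
      rcases exists_idet_neg hPQR (fun hA => hi A₀ hA hA₀) with h1 | h1 | h1
      · exact ⟨(P, Q, R), key _ _ _ hPQR rfl h1, rfl⟩
      · exact ⟨(Q, R, P), key _ _ _ hPQR.rot (by ext; simp; tauto) h1, by ext; simp; tauto⟩
      · exact ⟨(R, P, Q), key _ _ _ hPQR.rot.rot (by ext; simp; tauto) h1, by ext; simp; tauto⟩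
  rw [← c1]
  apply Finset.card_bij (fun d _ => {d.1, d.2.1})
  · rintro ⟨P, Q, R⟩ hd
    simp only [hD, Finset.mem_filter, mem_triples] at hd ⊢
    have hR := hDR hd.1 hd.2.2
    obtain ⟨S, hS⟩ := exists_neighbour h.tri h.convex hd.1 (interior_subset hA₀)
      (by rw [side_toPlane]; exact_mod_cast hd.2.2 A₀ hA₀)
    refine ⟨(mem_boundedEdges h.tri).2 ⟨P, Q, R, S, rfl, hd.1, hS⟩, ?_⟩
    rw [pair_mem_coreEdges h hω]
    rintro ⟨R', S', h1, h2, h3 | h3 | ⟨h3, -⟩⟩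
    · exact hd.2.1.1 h3
    · exact hd.2.1.2 h3
    · rw [Tri.unique h.tri h1 hd.1] at h3
      exact hR h3
  · rintro ⟨P, Q, R⟩ hd ⟨P', Q', R'⟩ hd' he
    simp only [hD, Finset.mem_filter, mem_triples] at hd hd' he
    rcases pair_eq he hd.1.ne with ⟨rfl, rfl⟩ | ⟨rfl, rfl⟩
    · rw [Tri.unique h.tri hd.1 hd'.1]
    · have s1 := hd.2.2 A₀ hA₀
      have s2 := hd'.2.2 A₀ hA₀
      rw [idet_swap] at s2
      omega
  · intro e he
    simp only [Finset.mem_filter] at he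
    obtain ⟨P, Q, R, S, rfl, h1, h2⟩ := (mem_boundedEdges h.tri).1 he.1
    rw [pair_mem_coreEdges h hω] at he
    obtain ⟨hP, hQ, hs | hs⟩ := one_side h h1 h2 he.2
    · exact ⟨(P, Q, R), by simpa [hD, mem_triples] using ⟨h1, ⟨hP, hQ⟩, by simpa using hs⟩, rfl⟩
    · exact ⟨(Q, P, S), by simpa [hD, mem_triples] using ⟨h2, ⟨hQ, hP⟩, by simpa using hs⟩,
        Finset.pair_comm _ _⟩

/-- The number of trivalent vertices of the pruned curve. -/
theorem card_trivalent (h : IsAdmissible Δ T) {ω : ℤ × ℤ → ℝ} (hω : Supports T ω) :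
    (T.filter fun t => coreDegree T t = 3).card + 2 = 2 * (inner Δ T).card := by
  classical
  have e1 := card_outer_triangles h hω
  have e2 := Finset.card_filter_add_card_filter_not (s := T) (fun t => ∃ P ∈ t, P ∈ interiorPts Δ)
  have e3 := Finset.card_filter_add_card_filter_not (s := boundedEdges T) (fun e => e ∈ coreEdges T)
  have e4 : (boundedEdges T).filter (fun e => e ∈ coreEdges T) = coreEdges T := by
    ext e
    simp only [Finset.mem_filter, and_iff_right_iff_imp]
    exact fun he => coreEdges_subset he
  rw [e4] at e3
  have e5 := (card_boundedEdges h).2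
  have e6 := sum_coreDegree h.tri
  -- Summed over `T`, this gives twice the number of core edges. As equally many triangles and edges
  -- lie off the core, core edges minus triangles with an interior vertex equals bounded edges minus
  -- all triangles, which is `g - 1`.
  have hdeg : ∀ t ∈ T, coreDegree T t = 2 * (if ∃ P ∈ t, P ∈ interiorPts Δ then 1 else 0) +
      (if coreDegree T t = 3 then 1 else 0) := by
    intro t ht
    by_cases hi : ∃ P ∈ t, P ∈ interiorPts Δ
    · obtain ⟨P, hP, hPi⟩ := hi
      rw [if_pos ⟨P, hP, hPi⟩]
      obtain ⟨Q, R, hQR, rfl⟩ := exists_tri_of_mem h.tri ht hP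
      rcases coreDegree_of_inner h hω hQR hPi with ⟨-, hd⟩ | ⟨-, hd⟩ <;> simp [hd]
    · rw [if_neg hi]
      push Not at hi
      simp [coreDegree_eq_zero h hω ht hi]
  rw [Finset.sum_congr rfl hdeg, Finset.sum_add_distrib, ← Finset.mul_sum, ← Finset.card_filter,
    ← Finset.card_filter] at e6
  omega

end

end TropPlane

namespace TropPlane

/-! ## Radial edges and concatenation -/

/-- `v` is a tangent direction of the interior polygon at `P`. -/
def InCone (Δ : Set (ℝ × ℝ)) (P : ℤ × ℤ) (v : ℝ × ℝ) : Prop :=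
  ∃ ε : ℝ, 0 < ε ∧ toPlane P + ε • v ∈ interiorPolygon Δ

section

variable {Δ : Set (ℝ × ℝ)} {T : Finset (Finset (ℤ × ℤ))}

theorem convex_interiorPolygon (Δ : Set (ℝ × ℝ)) : Convex ℝ (interiorPolygon Δ) := convex_hull _

theorem toPlane_mem_interiorPolygon {P : ℤ × ℤ} (hP : P ∈ interiorPts Δ) :
    toPlane P ∈ interiorPolygon Δ := subset_hull hP

theorem interiorPolygon_subset_interior (h : IsAdmissible Δ T) :
    interiorPolygon Δ ⊆ interior Δ :=
  hull_subset h.convex.interior fun _ hP => hP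

theorem mem_interiorPolygon_iff (h : IsAdmissible Δ T) {P : ℤ × ℤ} :
    toPlane P ∈ interiorPolygon Δ ↔ P ∈ interiorPts Δ :=
  ⟨fun hP => interiorPolygon_subset_interior h hP, toPlane_mem_interiorPolygon⟩

theorem InCone.mem_of_le {P : ℤ × ℤ} (hP : P ∈ interiorPts Δ) {v : ℝ × ℝ} {ε δ : ℝ} (hδ : 0 < δ)
    (hle : δ ≤ ε) (h : toPlane P + ε • v ∈ interiorPolygon Δ) :
    toPlane P + δ • v ∈ interiorPolygon Δ := by
  have hε : 0 < ε := lt_of_lt_of_le hδ hle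
  have := convex_interiorPolygon Δ (toPlane_mem_interiorPolygon hP) h (a := 1 - δ / ε) (b := δ / ε)
    (by rw [sub_nonneg, div_le_one hε]; exact hle) (by positivity) (by ring)
  convert this using 1
  ext <;> simp <;> field_simp <;> ring

theorem InCone.combo {P : ℤ × ℤ} (hP : P ∈ interiorPts Δ) {v w : ℝ × ℝ} (hv : InCone Δ P v)
    (hw : InCone Δ P w) {a b : ℝ} (ha : 0 ≤ a) (hb : 0 ≤ b) : InCone Δ P (a • v + b • w) := by
  rcases eq_or_lt_of_le (add_nonneg ha hb) with h0 | h0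
  · have ha0 : a = 0 := by linarith
    have hb0 : b = 0 := by linarith
    refine ⟨1, one_pos, ?_⟩
    simpa [ha0, hb0] using toPlane_mem_interiorPolygon hP
  · obtain ⟨ε₁, h1, hm1⟩ := hv
    obtain ⟨ε₂, h2, hm2⟩ := hw
    have hε : 0 < min ε₁ ε₂ := lt_min h1 h2
    have m1 := InCone.mem_of_le hP hε (min_le_left _ _) hm1
    have m2 := InCone.mem_of_le hP hε (min_le_right _ _) hm2
    refine ⟨min ε₁ ε₂ / (a + b), by positivity, ?_⟩
    have := convex_interiorPolygon Δ m1 m2 (a := a / (a + b)) (b := b / (a + b))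
      (by positivity) (by positivity) (by field_simp)
    convert this using 1
    ext <;> simp <;> field_simp <;> ring

theorem InCone.of_smul {P : ℤ × ℤ} {v : ℝ × ℝ} {c : ℝ} (hc : 0 < c)
    (h : InCone Δ P (c • v)) : InCone Δ P v := by
  obtain ⟨ε, hε, hm⟩ := h
  exact ⟨ε * c, by positivity, by rwa [mul_smul]⟩

theorem inCone_of_interior {P : ℤ × ℤ} {x : ℝ × ℝ} (hx : x ∈ interior (interiorPolygon Δ))
    (v : ℝ × ℝ) : ∃ δ : ℝ, 0 < δ ∧ InCone Δ P ((x - toPlane P) + δ • v) := by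
  obtain ⟨δ, hδ, hm⟩ := exists_add_smul_mem_interior hx v
  refine ⟨δ, hδ, 1, one_pos, ?_⟩
  convert interior_subset hm using 1
  module

theorem inCone_sub {P : ℤ × ℤ} {x : ℝ × ℝ} (hx : x ∈ interiorPolygon Δ) :
    InCone Δ P (x - toPlane P) := ⟨1, one_pos, by simpa using hx⟩

theorem not_inCone_opposite {P : ℤ × ℤ} {x : ℝ × ℝ}
    (hP' : toPlane P ∉ interior (interiorPolygon Δ)) (hx : x ∈ interior (interiorPolygon Δ)) :
    ¬ InCone Δ P (toPlane P - x) := by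
  rintro ⟨ε, hε, hm⟩
  apply hP'
  apply mem_interior_of_combo (convex_interiorPolygon Δ) hx hm hm (u := ε) (v := 1) (w := 0) hε
    (by norm_num) le_rfl
  module

/-- This makes radiality a local condition on the direction of the edge. That `Q` lies on the
boundary follows, since an interior lattice point would belong to the interior polygon. -/
theorem isRadial_iff (h : IsAdmissible Δ T) {P Q : ℤ × ℤ} (hP : P ∈ interiorPts Δ)
    (he : IsEdge T P Q) : IsRadial Δ T P Q ↔ ¬ InCone Δ P (toPlane Q - toPlane P) := by
  constructor
  · rintro ⟨-, -, -, x, hx⟩ ⟨ε, hε, hm⟩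
    have hPx : toPlane P ∈ segment ℝ (toPlane P) (toPlane Q) ∩ interiorPolygon Δ :=
      ⟨left_mem_segment ℝ _ _, toPlane_mem_interiorPolygon hP⟩
    have hδ : 0 < min ε 1 := lt_min hε one_pos
    have hQx : toPlane P + (min ε 1) • (toPlane Q - toPlane P) ∈
        segment ℝ (toPlane P) (toPlane Q) ∩ interiorPolygon Δ := by
      refine ⟨?_, InCone.mem_of_le hP hδ (min_le_left _ _) hm⟩
      rw [segment_eq_image']
      exact ⟨min ε 1, ⟨hδ.le, min_le_right _ _⟩, rfl⟩
    rw [hx, Set.mem_singleton_iff] at hPx hQx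
    rw [← hPx, add_eq_left, smul_eq_zero, sub_eq_zero] at hQx
    rcases hQx with h0 | h0
    · exact hδ.ne' h0
    · exact he.1 (toPlane_injective h0).symm
  · intro hn
    have hQ : toPlane Q ∉ interiorPolygon Δ := fun hQ => hn (inCone_sub hQ)
    have hQΔ : toPlane Q ∈ Δ := by
      obtain ⟨-, t, ht, -, hQt⟩ := he
      exact toPlane_mem_of_mem h.tri ht hQt
    refine ⟨he, hP, ?_, toPlane P, ?_⟩
    · rw [boundaryPts, Set.mem_ofPred_eq, h.closed.frontier_eq]
      exact ⟨hQΔ, fun hi => hQ (toPlane_mem_interiorPolygon hi)⟩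
    · ext x
      simp only [Set.mem_inter_iff, Set.mem_singleton_iff]
      constructor
      · rintro ⟨hxs, hx⟩
        rw [segment_eq_image'] at hxs
        obtain ⟨s, ⟨hs0, hs1⟩, rfl⟩ := hxs
        rcases eq_or_lt_of_le hs0 with h0 | h0
        · simp [← h0]
        · exact absurd ⟨s, h0, hx⟩ hn
      · rintro rfl
        exact ⟨left_mem_segment ℝ _ _, toPlane_mem_interiorPolygon hP⟩

theorem IsRadial.notMem {P Q : ℤ × ℤ} (hr : IsRadial Δ T P Q) :
    Q ∉ interiorPts Δ := by
  have := hr.2.2.1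
  rw [boundaryPts, Set.mem_ofPred_eq, frontier] at this
  exact this.2

theorem IsEdge.coreDart (h : IsAdmissible Δ T) {P Q : ℤ × ℤ} (he : IsEdge T P Q)
    (hP : P ∈ interiorPts Δ) : CoreDart Δ T P Q := by
  obtain ⟨R, hR | hR⟩ := (isEdge_iff h.tri).1 he
  · exact hR.coreDart h (Or.inl hP)
  · exact (hR.coreDart h (Or.inr hP)).symm

theorem Tri.isEdge {P Q R : ℤ × ℤ} (h : Tri T P Q R) : IsEdge T P Q :=
  ⟨h.ne, _, h.2, by simp, by simp⟩

theorem IsEdge.symm {P Q : ℤ × ℤ} (h : IsEdge T P Q) : IsEdge T Q P := by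
  obtain ⟨hne, t, ht, hP, hQ⟩ := h
  exact ⟨hne.symm, t, ht, hQ, hP⟩

/-- Interior lattice points strictly left of `QR` have `side` at least 1 by integrality, and so has
their hull. A tangent direction that leads below 1 therefore needs a lattice point on or beyond
`QR`. -/
theorem exists_beyond_of_inCone {P Q R : ℤ × ℤ} {v : ℝ × ℝ}
    (hv : InCone Δ P v) (hneg : ∀ ε : ℝ, 0 < ε → side Q R (toPlane P + ε • v) < 1) :
    ∃ A ∈ interiorPts Δ, idet Q R A ≤ 0 := by
  by_contra! hcon
  obtain ⟨ε, hε, hm⟩ := hv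
  have hconv : Convex ℝ {x | 1 ≤ side Q R x} := by
    intro x hx y hy a b ha hb hab
    simp only [Set.mem_ofPred_eq] at *
    rw [side_combo _ _ _ _ _ _ hab]
    nlinarith
  have hsub : interiorPolygon Δ ⊆ {x | 1 ≤ side Q R x} := by
    apply hull_subset hconv
    intro A hA
    simp only [Set.mem_ofPred_eq, side_toPlane]
    have : 1 ≤ idet Q R A := hcon A hA
    exact_mod_cast this
  have := hsub hm
  simp only [Set.mem_ofPred_eq] at this
  linarith [hneg ε hε]

/-- At a vertex with one interior vertex that is 2-valent in the pruned curve, both edges are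
radial. -/
theorem isRadial_of_not_core (h : IsAdmissible Δ T) {P Q R : ℤ × ℤ} (ht : Tri T P Q R)
    (hP : P ∈ interiorPts Δ) (hc : ¬ CoreDart Δ T Q R) : IsRadial Δ T P Q ∧ IsRadial Δ T P R := by
  have hQ : Q ∉ interiorPts Δ := fun hQ => hc (ht.rot.coreDart h (Or.inl hQ))
  have hR : R ∉ interiorPts Δ := fun hR => hc (ht.rot.coreDart h (Or.inr hR))
  -- `P` has `side` 1 with respect to `QR`. A tangent direction approaching `QR` yields an interior
  -- point beyond it, the apex across `QR` is then interior, and `QR` would be core.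
  have key : ∀ v, (∀ ε : ℝ, 0 < ε → side Q R (toPlane P + ε • v) < 1) → ¬ InCone Δ P v := by
    intro v hv hcone
    obtain ⟨A, hA, hA0⟩ := exists_beyond_of_inCone hcone hv
    have := idet_ne_zero h ht.rot hQ hR hA
    obtain ⟨S, hS, hRQ⟩ := exists_interior_opposite h ht hP hQ hR hA (by omega)
    exact hc ⟨P, S, ht.rot, hRQ, Or.inr (Or.inr ⟨hP, hS⟩)⟩
  constructor
  · rw [isRadial_iff h hP ht.isEdge]
    apply key
    intro ε hε
    rw [side_add_smul_sub, side_left_self, side_toPlane, ht.rot.1]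
    norm_num; linarith
  · rw [isRadial_iff h hP ht.rot.rot.isEdge.symm]
    apply key
    intro ε hε
    rw [side_add_smul_sub, side_right_self, side_toPlane, ht.rot.1]
    norm_num; linarith

/-- The relation of being equal, or radial at the same point. -/
def SameRadial (Δ : Set (ℝ × ℝ)) (T : Finset (Finset (ℤ × ℤ))) (e e' : Finset (ℤ × ℤ)) : Prop :=
  e = e' ∨ ∃ P Q Q', e = {P, Q} ∧ e' = {P, Q'} ∧ IsRadial Δ T P Q ∧ IsRadial Δ T P Q'

theorem SameRadial.symm {e e' : Finset (ℤ × ℤ)} (h : SameRadial Δ T e e') :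
    SameRadial Δ T e' e := by
  rcases h with rfl | ⟨P, Q, Q', h1, h2, h3, h4⟩
  · exact Or.inl rfl
  · exact Or.inr ⟨P, Q', Q, h2, h1, h4, h3⟩

theorem radial_pair_eq {P Q P' Q' : ℤ × ℤ} (h1 : IsRadial Δ T P Q) (h2 : IsRadial Δ T P' Q')
    (he : ({P, Q} : Finset (ℤ × ℤ)) = {P', Q'}) : P = P' ∧ Q = Q' := by
  rcases pair_eq he h1.1.1 with h | ⟨rfl, rfl⟩
  · exact h
  · exact absurd h1.2.1 h2.notMem

theorem SameRadial.trans {e e' e'' : Finset (ℤ × ℤ)} (h : SameRadial Δ T e e')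
    (h' : SameRadial Δ T e' e'') : SameRadial Δ T e e'' := by
  rcases h with rfl | ⟨P, Q, Q', h1, h2, h3, h4⟩
  · exact h'
  · rcases h' with rfl | ⟨A, B, B', g1, g2, g3, g4⟩
    · exact Or.inr ⟨P, Q, Q', h1, h2, h3, h4⟩
    · obtain ⟨rfl, rfl⟩ := radial_pair_eq h4 g3 (h2.symm.trans g1)
      exact Or.inr ⟨P, Q, B', h1, g2, h3, g4⟩

/-- At a 2-valent triangle the surviving edges are the two at its interior vertex, both radial. As
`SameRadial` is an equivalence, chains need no further argument. -/
theorem sameRadial_of_concatenated (h : IsAdmissible Δ T) {ω : ℤ × ℤ → ℝ} (hω : Supports T ω)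
    {e e' : Finset (ℤ × ℤ)} (hc : Concatenated T e e') : SameRadial Δ T e e' := by
  induction hc with
  | refl => exact Or.inl rfl
  | symm _ _ _ ih => exact ih.symm
  | trans _ _ _ _ _ ih1 ih2 => exact ih1.trans ih2
  | rel e e' hr =>
    obtain ⟨he, he', t, ht, hd, hsub, hsub'⟩ := hr
    have hi : ∃ P ∈ t, P ∈ interiorPts Δ := by
      by_contra! hcon
      rw [coreDegree_eq_zero h hω ht hcon] at hd
      omega
    obtain ⟨P, hPt, hP⟩ := hi
    obtain ⟨Q, R, hPQR, rfl⟩ := exists_tri_of_mem h.tri ht hPt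
    rcases coreDegree_of_inner h hω hPQR hP with ⟨-, hd'⟩ | ⟨hnc, -⟩
    · omega
    obtain ⟨r1, r2⟩ := isRadial_of_not_core h hPQR hP hnc
    have key : ∀ f ∈ coreEdges T, f ⊆ {P, Q, R} → f = {P, Q} ∨ f = {P, R} := by
      intro f hf hs
      obtain ⟨X, Y, rfl, hXY⟩ := (mem_coreEdges h hω).1 hf
      have hne : X ≠ Y := by obtain ⟨_, _, h1, -⟩ := hXY; exact h1.ne
      rcases pair_subset_cases hne hs with h1 | h1 | h1
      · exact Or.inl h1
      · exact absurd (hXY.of_pair_eq h1) hnc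
      · exact Or.inr (by rw [h1, Finset.pair_comm])
    rcases key e he hsub with rfl | rfl <;> rcases key e' he' hsub' with rfl | rfl
    · exact Or.inl rfl
    · exact Or.inr ⟨P, Q, R, rfl, rfl, r1, r2⟩
    · exact Or.inr ⟨P, R, Q, rfl, rfl, r2, r1⟩
    · exact Or.inl rfl

/-- The coordinate of `S` at `P` is `-1`. The other two sum to 2 and are positive integers because
`A` and `B` are not interior, so both are 1 and `P A S B` is a parallelogram. -/
theorem opposite_eq (h : IsAdmissible Δ T) {P A B S : ℤ × ℤ} (ht : Tri T P A B)
    (hA : A ∉ interiorPts Δ) (hB : B ∉ interiorPts Δ)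
    (hS : S ∈ interiorPts Δ) (hBA : Tri T B A S) :
    toPlane S - toPlane P = (toPlane A - toPlane P) + (toPlane B - toPlane P) := by
  have h0 : idet A B S = -1 := by
    have := hBA.1; rw [idet_swap] at this; omega
  have h1 := not_opposite h.convex ht.rot.1 hA (ht.mem₃ h) (ht.mem₁ h) hS
  have h2 := not_opposite h.convex ht.rot.rot.1 hB (ht.mem₁ h) (ht.mem₂ h) hS
  have hs := idet_sum ht.1 S
  have a1 : idet B P S = 1 := by omega
  have a2 : idet P A S = 1 := by omega
  have f1 := fst_eq_idet_combo ht.1 S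
  have f2 := snd_eq_idet_combo ht.1 S
  rw [h0, a1, a2] at f1 f2
  ext
  · simp only [toPlane, Prod.fst_sub, Prod.fst_add, f1]; push_cast; ring
  · simp only [toPlane, Prod.snd_sub, Prod.snd_add, f2]; push_cast; ring

/-- Neither end of `AB` is interior, so the edge is core because the apex across it is interior, and
that apex is the fourth vertex of the parallelogram on `P`, `A`, `B`. -/
theorem inCone_add_of_coreDart (h : IsAdmissible Δ T) {P A B : ℤ × ℤ} (ht : Tri T P A B)
    (hA : ¬ InCone Δ P (toPlane A - toPlane P))
    (hB : ¬ InCone Δ P (toPlane B - toPlane P)) (hc : CoreDart Δ T A B) :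
    InCone Δ P ((toPlane A - toPlane P) + (toPlane B - toPlane P)) := by
  have hA' : A ∉ interiorPts Δ := fun hi => hA (inCone_sub (toPlane_mem_interiorPolygon hi))
  have hB' : B ∉ interiorPts Δ := fun hi => hB (inCone_sub (toPlane_mem_interiorPolygon hi))
  obtain ⟨R, S, h1, h2, h3 | h3 | ⟨-, h3⟩⟩ := hc
  · exact absurd h3 hA'
  · exact absurd h3 hB'
  · rw [← opposite_eq h ht hA' hB' h3 h2]
    exact inCone_sub (toPlane_mem_interiorPolygon h3)

theorem concatenated_of_tri (h : IsAdmissible Δ T) {ω : ℤ × ℤ → ℝ} (hω : Supports T ω)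
    {P A B : ℤ × ℤ} (ht : Tri T P A B) (hP : P ∈ interiorPts Δ) (hc : ¬ CoreDart Δ T A B) :
    Concatenated T {P, A} {P, B} := by
  apply Relation.EqvGen.rel
  refine ⟨(pair_mem_coreEdges h hω).2 (ht.coreDart h (Or.inl hP)),
    (pair_mem_coreEdges h hω).2 (ht.rot.rot.coreDart h (Or.inr hP)).symm, _, ht.2, ?_, ?_, ?_⟩
  · rcases coreDegree_of_inner h hω ht hP with ⟨hcon, -⟩ | ⟨-, hd⟩
    · exact absurd hcon hc
    · exact hd
  · intro X; simp; tauto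
  · intro X; simp; tauto

theorem sub_eq_side_combo {P A B : ℤ × ℤ} (h : idet P A B = 1) (y : ℝ × ℝ) :
    y - toPlane P = side B P y • (toPlane A - toPlane P) + side P A y • (toPlane B - toPlane P) := by
  have h1 := side_sum h y
  have h2 : side A B y = 1 - side B P y - side P A y := by linarith
  conv_lhs => rw [eq_side_combo h y, h2]
  module

/-- Walking around `P` towards a point `y` opposite to the interior polygon, every radial edge is
concatenated to one in the triangle that contains the direction of `y`. -/
theorem exists_concatenated (h : IsAdmissible Δ T) {ω : ℤ × ℤ → ℝ} (hω : Supports T ω)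
    {P Q₁ : ℤ × ℤ} (hQ₁ : IsRadial Δ T P Q₁) {y : ℝ × ℝ}
    (hy : (2 : ℝ) • toPlane P - y ∈ interior (interiorPolygon Δ))
    (hgen : ∀ Q ∈ verts T, Q ≠ P → side P Q y ≠ 0) :
    ∃ A B, Tri T P A B ∧ 0 < side B P y ∧ 0 < side P A y ∧
      ((IsRadial Δ T P A ∧ Concatenated T {P, Q₁} {P, A}) ∨
        (IsRadial Δ T P B ∧ Concatenated T {P, Q₁} {P, B})) := by
  have hP : P ∈ interiorPts Δ := hQ₁.2.1
  obtain ⟨-, t₁, ht₁, hPt₁, hQt₁⟩ := hQ₁.1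
  -- The property carried along the walk is to contain a radial edge at `P` concatenated to the
  -- given one.
  obtain ⟨t, ht, ⟨Q, hPt, hQt, hQr, hQc⟩, hstuck⟩ := exists_stuck h.tri hω y
    (fun t => ∃ Q, P ∈ t ∧ Q ∈ t ∧ IsRadial Δ T P Q ∧ Concatenated T {P, Q₁} {P, Q})
    ⟨t₁, ht₁, Q₁, hPt₁, hQt₁, hQ₁, Relation.EqvGen.refl _⟩
  obtain ⟨A, B, hAB, rfl⟩ := exists_tri_of_mem h.tri ht hPt
  have eA : IsEdge T P A := hAB.isEdge
  have eB : IsEdge T P B := hAB.rot.rot.isEdge.symm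
  -- the point `x` opposite to `y`
  set κ : ℝ × ℝ := ((2 : ℝ) • toPlane P - y) - toPlane P with hκ
  have hκK : InCone Δ P κ := inCone_sub (interior_subset hy)
  have hκe : κ = (-side B P y) • (toPlane A - toPlane P) +
      (-side P A y) • (toPlane B - toPlane P) := by
    have : κ = -(y - toPlane P) := by rw [hκ]; module
    rw [this, sub_eq_side_combo hAB.1 y]; module
  have gA : side P A y ≠ 0 := hgen A hAB.rot.mem_verts hAB.ne.symm
  have gB : side B P y ≠ 0 := by
    rw [side_swap, neg_ne_zero]; exact hgen B hAB.rot.rot.mem_verts hAB.rot.rot.ne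
  have crossA : side P A y < 0 → ¬ (IsRadial Δ T P A ∧ Concatenated T {P, Q₁} {P, A}) := by
    rintro hneg ⟨r, c⟩
    obtain ⟨S, hS⟩ := exists_neighbour_of_inner h hAB (Or.inl hP)
    exact hstuck P A B S rfl hAB hS hneg ⟨A, by simp, by simp, r, c⟩
  have crossB : side B P y < 0 → ¬ (IsRadial Δ T P B ∧ Concatenated T {P, Q₁} {P, B}) := by
    rintro hneg ⟨r, c⟩
    obtain ⟨S, hS⟩ := exists_neighbour_of_inner h hAB.rot.rot (Or.inr hP)
    exact hstuck B P A S (by ext; simp; tauto) hAB.rot.rot hS hneg ⟨B, by simp, by simp, r, c⟩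
  refine ⟨A, B, hAB, ?_⟩
  simp only [Finset.mem_insert, Finset.mem_singleton] at hQt
  rcases hQt with rfl | rfl | rfl
  · exact absurd rfl hQr.1.1
  · -- the radial edge is the first one
    have hβ : 0 < side P Q y := lt_of_le_of_ne (not_lt.1 fun hneg => crossA hneg ⟨hQr, hQc⟩) gA.symm
    -- If `y` lay beyond `PB`, then adding `κ` to a multiple of `B - P`, or of the sum of both edge
    -- vectors, would give a positive multiple of `A - P`, which is not tangent. So `PB` is radial,
    -- the opposite edge is not core, and the walk could go on across `PB`.
    have hα : 0 < side B P y := by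
      by_contra hcon
      have hα : side B P y < 0 := lt_of_le_of_ne (not_lt.1 hcon) gB
      have nA := (isRadial_iff h hP eA).1 hQr
      have nB : ¬ InCone Δ P (toPlane B - toPlane P) := by
        intro hB
        have := hB.combo hP hκK hβ.le zero_le_one
        rw [hκe] at this
        apply nA
        apply InCone.of_smul (c := -side B P y) (by linarith)
        convert this using 1
        module
      have nc : ¬ CoreDart Δ T Q B := by
        intro hc
        have := (inCone_add_of_coreDart h hAB nA nB hc).combo hP hκK hβ.le zero_le_one
        rw [hκe] at this
        apply nA
        apply InCone.of_smul (c := side P Q y - side B P y) (by linarith)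
        convert this using 1
        module
      exact crossB hα ⟨(isRadial_iff h hP eB).2 nB,
        hQc.trans _ _ _ (concatenated_of_tri h hω hAB hP nc)⟩
    exact ⟨hα, hβ, Or.inl ⟨hQr, hQc⟩⟩
  · have hα : 0 < side Q P y := lt_of_le_of_ne (not_lt.1 fun hneg => crossB hneg ⟨hQr, hQc⟩) gB.symm
    have hβ : 0 < side P A y := by
      by_contra hcon
      have hβ : side P A y < 0 := lt_of_le_of_ne (not_lt.1 hcon) gA
      have nB := (isRadial_iff h hP eB).1 hQr
      have nA : ¬ InCone Δ P (toPlane A - toPlane P) := by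
        intro hA
        have := hA.combo hP hκK hα.le zero_le_one
        rw [hκe] at this
        apply nB
        apply InCone.of_smul (c := -side P A y) (by linarith)
        convert this using 1
        module
      have nc : ¬ CoreDart Δ T A Q := by
        intro hc
        have := (inCone_add_of_coreDart h hAB nA nB hc).combo hP hκK hα.le zero_le_one
        rw [hκe] at this
        apply nB
        apply InCone.of_smul (c := side Q P y - side P A y) (by linarith)
        convert this using 1
        module
      exact crossA hβ ⟨(isRadial_iff h hP eA).2 nA,
        hQc.trans _ _ _ ((concatenated_of_tri h hω hAB hP nc).symm)⟩
    exact ⟨hα, hβ, Or.inr ⟨hQr, hQc⟩⟩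

/-- A point on a line through `P` can be moved off it along the normal within an open set; the
finitely many lines are avoided one after another. -/
theorem exists_generic_point (P : ℤ × ℤ) (V : Finset (ℤ × ℤ)) : ∀ {U : Set (ℝ × ℝ)}, IsOpen U →
    U.Nonempty → ∃ x ∈ U, ∀ Q ∈ V, Q ≠ P → side P Q x ≠ 0 := by
  classical
  induction V using Finset.induction_on with
  | empty => intro U _ hU; obtain ⟨x, hx⟩ := hU; exact ⟨x, hx, by simp⟩
  | insert Q V _ ih =>
    intro U hU hne
    by_cases hQP : Q = P
    · obtain ⟨x, hx, hxV⟩ := ih hU hne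
      refine ⟨x, hx, fun Q' hQ' hne => ?_⟩
      rcases Finset.mem_insert.1 hQ' with rfl | hQ'
      · exact absurd hQP hne
      · exact hxV Q' hQ' hne
    · have hopen : IsOpen (U ∩ {x | side P Q x ≠ 0}) :=
        hU.inter (isOpen_ne_fun (continuous_side P Q) continuous_const)
      have hne' : (U ∩ {x | side P Q x ≠ 0}).Nonempty := by
        obtain ⟨x, hx⟩ := hne
        by_cases h0 : side P Q x = 0
        · obtain ⟨ε, hε, hm⟩ := exists_add_smul_mem_interior
            (by rwa [hU.interior_eq]) (-(Q.2 - P.2 : ℝ), (Q.1 - P.1 : ℝ)) (x := x)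
          refine ⟨_, interior_subset hm, ?_⟩
          have e : side P Q (x + ε • (-(Q.2 - P.2 : ℝ), (Q.1 - P.1 : ℝ))) =
              side P Q x + ε * (((Q.1 : ℝ) - P.1) ^ 2 + ((Q.2 : ℝ) - P.2) ^ 2) := by
            simp only [side, Prod.fst_add, Prod.snd_add, Prod.smul_fst, Prod.smul_snd, smul_eq_mul]
            ring
          simp only [Set.mem_ofPred_eq]
          rw [e, h0, zero_add]
          intro hcon
          rcases mul_eq_zero.1 hcon with h1 | h1
          · exact hε.ne' h1
          · have a1 : ((Q.1 : ℝ) - P.1) = 0 := by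
              nlinarith [sq_nonneg ((Q.1 : ℝ) - P.1), sq_nonneg ((Q.2 : ℝ) - P.2)]
            have a2 : ((Q.2 : ℝ) - P.2) = 0 := by
              nlinarith [sq_nonneg ((Q.1 : ℝ) - P.1), sq_nonneg ((Q.2 : ℝ) - P.2)]
            apply hQP
            apply Prod.ext
            · exact_mod_cast sub_eq_zero.1 a1
            · exact_mod_cast sub_eq_zero.1 a2
        · exact ⟨x, hx, h0⟩
      obtain ⟨x, hx, hxV⟩ := ih hopen hne'
      refine ⟨x, hx.1, fun Q' hQ' hne => ?_⟩
      rcases Finset.mem_insert.1 hQ' with rfl | hQ'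
      · exact hx.2
      · exact hxV Q' hQ' hne

/-- The radial edges at a point are concatenated. -/
theorem concatenated_of_radial (h : IsAdmissible Δ T) {ω : ℤ × ℤ → ℝ} (hω : Supports T ω)
    {P Q₁ Q₂ : ℤ × ℤ} (h₁ : IsRadial Δ T P Q₁) (h₂ : IsRadial Δ T P Q₂) :
    Concatenated T {P, Q₁} {P, Q₂} := by
  have hP := h₁.2.1
  obtain ⟨x, hx, hxV⟩ := exists_generic_point P (verts T) isOpen_interior h.nonhyp
  -- The reflection in `P` of a generic interior point of the interior polygon. The walks from both
  -- radial edges end in the one triangle at `P` whose angle contains the direction of `y`.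
  set y : ℝ × ℝ := (2 : ℝ) • toPlane P - x with hyd
  have hyx : (2 : ℝ) • toPlane P - y = x := by rw [hyd]; module
  have hgen : ∀ Q ∈ verts T, Q ≠ P → side P Q y ≠ 0 := by
    intro Q hQ hne h0
    apply hxV Q hQ hne
    have : side P Q y = - side P Q x := by
      simp only [hyd, side, toPlane, Prod.fst_sub, Prod.snd_sub, Prod.smul_fst, Prod.smul_snd,
        smul_eq_mul]; ring
    linarith
  obtain ⟨A, B, hAB, a1, a2, hA⟩ := exists_concatenated h hω h₁ (y := y) (by rwa [hyx]) hgen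
  obtain ⟨A', B', hAB', a1', a2', hA'⟩ := exists_concatenated h hω h₂ (y := y) (by rwa [hyx]) hgen
  obtain ⟨rfl, rfl⟩ := tri_eq_of_germ h.tri hAB hAB' a1 a2 a1'.le a2'.le
  have link : IsRadial Δ T P A → IsRadial Δ T P B → Concatenated T {P, A} {P, B} := by
    intro rA rB
    apply concatenated_of_tri h hω hAB hP
    have nA := (isRadial_iff h hP rA.1).1 rA
    have nB := (isRadial_iff h hP rB.1).1 rB
    intro hc
    have hsum := inCone_add_of_coreDart h hAB nA nB hc
    have hκe : x - toPlane P = (-side B P y) • (toPlane A - toPlane P) +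
        (-side P A y) • (toPlane B - toPlane P) := by
      have : x - toPlane P = -(y - toPlane P) := by rw [hyd]; module
      rw [this, sub_eq_side_combo hAB.1 y]; module
    rcases le_total (side P A y) (side B P y) with hle | hle
    -- The perturbation by `δ` covers the case of equal coefficients, in which the combination would
    -- otherwise vanish.
    · obtain ⟨δ, hδ, hK⟩ := inCone_of_interior (P := P) hx (-(toPlane A - toPlane P))
      have := hsum.combo hP hK (a := side B P y + δ) (b := 1) (by linarith) zero_le_one
      rw [hκe] at this
      apply nB
      apply InCone.of_smul (c := side B P y + δ - side P A y) (by linarith)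
      convert this using 1
      module
    · obtain ⟨δ, hδ, hK⟩ := inCone_of_interior (P := P) hx (-(toPlane B - toPlane P))
      have := hsum.combo hP hK (a := side P A y + δ) (b := 1) (by linarith) zero_le_one
      rw [hκe] at this
      apply nA
      apply InCone.of_smul (c := side P A y + δ - side B P y) (by linarith)
      convert this using 1
      module
  rcases hA with ⟨r, c⟩ | ⟨r, c⟩ <;> rcases hA' with ⟨r', c'⟩ | ⟨r', c'⟩
  · exact c.trans _ _ _ c'.symm
  · exact (c.trans _ _ _ (link r r')).trans _ _ _ c'.symm
  · exact (c.trans _ _ _ (link r' r).symm).trans _ _ _ c'.symm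
  · exact c.trans _ _ _ c'.symm

theorem concatenated_iff (h : IsAdmissible Δ T) {ω : ℤ × ℤ → ℝ} (hω : Supports T ω)
    {e e' : Finset (ℤ × ℤ)} : Concatenated T e e' ↔ SameRadial Δ T e e' := by
  refine ⟨sameRadial_of_concatenated h hω, ?_⟩
  rintro (rfl | ⟨P, Q, Q', rfl, rfl, h1, h2⟩)
  · exact Relation.EqvGen.refl _
  · exact concatenated_of_radial h hω h1 h2

/-- Boundary lattice points of the interior polygon have radial edges. -/
theorem exists_isRadial (h : IsAdmissible Δ T) {P : ℤ × ℤ} (hP : P ∈ interiorPts Δ)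
    (hP' : toPlane P ∉ interior (interiorPolygon Δ)) : ∃ Q, IsRadial Δ T P Q := by
  obtain ⟨x, hx⟩ := h.nonhyp
  -- In the triangle holding the direction away from the interior polygon, the two edges at `P`
  -- cannot both be tangent, for then that direction would be.
  obtain ⟨ε, hε, hm⟩ := exists_add_smul_mem_interior hP (toPlane P - x)
  obtain ⟨A, B, hAB, h1, h2⟩ := exists_germ_tri h.tri h.convex (interior_subset hP)
    (interior_subset hm)
  by_contra! hcon
  have kA : InCone Δ P (toPlane A - toPlane P) := by
    by_contra hn; exact hcon A ((isRadial_iff h hP hAB.isEdge).2 hn)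
  have kB : InCone Δ P (toPlane B - toPlane P) := by
    by_contra hn; exact hcon B ((isRadial_iff h hP hAB.rot.rot.isEdge.symm).2 hn)
  have := kA.combo hP kB h1 h2
  rw [← sub_eq_side_combo hAB.1, add_sub_cancel_left] at this
  exact not_inCone_opposite hP' hx (this.of_smul hε)

theorem not_isRadial_of_interior (h : IsAdmissible Δ T) {P Q : ℤ × ℤ}
    (hP' : toPlane P ∈ interior (interiorPolygon Δ)) : ¬ IsRadial Δ T P Q := by
  intro hr
  obtain ⟨ε, hε, hm⟩ := exists_add_smul_mem_interior hP' (toPlane Q - toPlane P)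
  exact (isRadial_iff h hr.2.1 hr.1).1 hr ⟨ε, hε, interior_subset hm⟩

end

end TropPlane

namespace TropPlane

/-! ## The combinatorial type of the skeleton -/

section

variable {Δ : Set (ℝ × ℝ)} {T : Finset (Finset (ℤ × ℤ))}

theorem exists_coreEdge_inner (h : IsAdmissible Δ T) {ω : ℤ × ℤ → ℝ} (hω : Supports T ω)
    {e t : Finset (ℤ × ℤ)} (he : e ∈ coreEdges T) (ht : t ∈ T) (het : e ⊆ t) :
    ∃ A ∈ t, A ∈ interiorPts Δ := by
  obtain ⟨P, Q, rfl, hc⟩ := (mem_coreEdges h hω).1 he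
  exact hc.exists_inner h.tri ht (het (by simp)) (het (by simp))

theorem coreDegree_two_or_three (h : IsAdmissible Δ T) {ω : ℤ × ℤ → ℝ} (hω : Supports T ω)
    {e t : Finset (ℤ × ℤ)} (he : e ∈ coreEdges T) (ht : t ∈ T) (het : e ⊆ t) :
    coreDegree T t = 2 ∨ coreDegree T t = 3 := by
  obtain ⟨A, hA, hAi⟩ := exists_coreEdge_inner h hω he ht het
  obtain ⟨Q, R, hQR, rfl⟩ := exists_tri_of_mem h.tri ht hA
  rcases coreDegree_of_inner h hω hQR hAi with ⟨-, hd⟩ | ⟨-, hd⟩ <;> simp [hd]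

/-- The pruned curve is connected. -/
theorem coreEdges_connected (h : IsAdmissible Δ T) {ω : ℤ × ℤ → ℝ} (hω : Supports T ω)
    (p : Finset (ℤ × ℤ) → Prop) (hp : ∃ e ∈ coreEdges T, p e)
    (hstep : ∀ t ∈ T, ∀ e ∈ coreEdges T, ∀ e' ∈ coreEdges T, e ⊆ t → e' ⊆ t → p e → p e') :
    ∀ e ∈ coreEdges T, p e := by
  intro f hf
  -- A triangle has `q` if it has a core edge with `p`; this passes to any triangle sharing a core
  -- edge with it.
  set q : Finset (ℤ × ℤ) → Prop := fun t => ∃ e ∈ coreEdges T, e ⊆ t ∧ p e with hq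
  have share : ∀ {P Q : ℤ × ℤ} {t t' : Finset (ℤ × ℤ)}, CoreDart Δ T P Q → t ∈ T →
      P ∈ t → Q ∈ t → P ∈ t' → Q ∈ t' → q t → q t' := by
    rintro P Q t t' hc ht hP hQ hP' hQ' ⟨e, he, het, hpe⟩
    have hPQ := (pair_mem_coreEdges h hω).2 hc
    refine ⟨{P, Q}, hPQ, ?_, hstep t ht e he _ hPQ het ?_ hpe⟩
    · intro X; simp only [Finset.mem_insert, Finset.mem_singleton]; rintro (rfl | rfl) <;> assumption
    · intro X; simp only [Finset.mem_insert, Finset.mem_singleton]; rintro (rfl | rfl) <;> assumption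
  obtain ⟨X, Y, Z, W, rfl, hXYZ, -⟩ := (mem_boundedEdges h.tri).1 (coreEdges_subset hf)
  have hft : ({X, Y} : Finset (ℤ × ℤ)) ⊆ {X, Y, Z} := by intro A; simp; tauto
  obtain ⟨B, hBt, hB⟩ := exists_coreEdge_inner h hω hf hXYZ.2 hft
  obtain ⟨e₀, he₀, hpe₀⟩ := hp
  obtain ⟨X₀, Y₀, Z₀, W₀, rfl, h₀, -⟩ := (mem_boundedEdges h.tri).1 (coreEdges_subset he₀)
  -- Walking towards an interior vertex `B` only core edges are crossed: they have an interior end,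
  -- or separate an interior apex from `B`. The star of `B` is then traversed through the edges at
  -- `B`, which are core too.
  have hwalk := exists_mem_of_walk h hω ((mem_verts_iff h).2 (interior_subset hB)) q
    ⟨_, h₀.2, {X₀, Y₀}, he₀, by intro A; simp; tauto, hpe₀⟩ (by
      intro P Q R S h1 h2 hneg hqt
      obtain ⟨e, he, het, -⟩ := id hqt
      obtain ⟨A, hA, hAi⟩ := exists_coreEdge_inner h hω he h1.2 het
      have hc : CoreDart Δ T P Q := by
        by_cases hPQ : P ∈ interiorPts Δ ∨ Q ∈ interiorPts Δ
        · exact h1.coreDart h hPQ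
        · push Not at hPQ
          simp only [Finset.mem_insert, Finset.mem_singleton] at hA
          rcases hA with rfl | rfl | rfl
          · exact absurd hAi hPQ.1
          · exact absurd hAi hPQ.2
          · obtain ⟨S', hS', hQP⟩ := exists_interior_opposite h h1.rot.rot hAi hPQ.1 hPQ.2 hB hneg
            exact ⟨A, S', h1, hQP, Or.inr (Or.inr ⟨hAi, hS'⟩)⟩
      exact share hc h1.2 (by simp) (by simp) (by simp) (by simp) hqt)
  have hqB : q {X, Y, Z} := forall_star h hω hB q hwalk (by
      intro Q R S h1 h2
      have hc : CoreDart Δ T B R := h2.coreDart h (Or.inl hB)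
      exact ⟨share hc h1.2 (by simp) (by simp) (by simp) (by simp),
        share hc h2.2 (by simp) (by simp) (by simp) (by simp)⟩) hXYZ.2 hBt
  obtain ⟨e, he, het, hpe⟩ := hqB
  exact hstep _ hXYZ.2 e he _ hf het hft hpe

theorem two_le_genus (h : IsAdmissible Δ T) : 2 ≤ (inner Δ T).card := by
  by_contra hcon
  have h1 : (inner Δ T).card ≤ 1 := by omega
  obtain ⟨P, hP⟩ := interiorPts_nonempty h
  obtain ⟨x, hx⟩ := h.nonhyp
  have hsub : interiorPolygon Δ ⊆ {toPlane P} := by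
    apply hull_subset (convex_singleton _)
    intro Q hQ
    rw [Finset.card_le_one_iff.1 h1 ((mem_inner h).2 hQ) ((mem_inner h).2 hP)]
    rfl
  have := interior_mono hsub hx
  rw [interior_singleton] at this
  exact this

theorem concatenated_of_degree_two {t e e' : Finset (ℤ × ℤ)} (ht : t ∈ T)
    (hd : coreDegree T t = 2) (he : e ∈ coreEdges T) (he' : e' ∈ coreEdges T) (het : e ⊆ t)
    (het' : e' ⊆ t) : Concatenated T e e' :=
  Relation.EqvGen.rel _ _ ⟨he, he', t, ht, hd, het, het'⟩

open Classical in
/-- The edges concatenated to `e₀`. -/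
noncomputable def edgeClass (T : Finset (Finset (ℤ × ℤ))) (e₀ : Finset (ℤ × ℤ)) :
    Finset (Finset (ℤ × ℤ)) := (coreEdges T).filter fun e => Concatenated T e₀ e

theorem mem_edgeClass {e₀ e : Finset (ℤ × ℤ)} :
    e ∈ edgeClass T e₀ ↔ e ∈ coreEdges T ∧ Concatenated T e₀ e := by
  simp [edgeClass]

/-- A class of concatenated edges is connected through 2-valent vertices. -/
theorem card_edgeClass_le {e₀ : Finset (ℤ × ℤ)}
    (he₀ : e₀ ∈ coreEdges T) : (edgeClass T e₀).card ≤
      (T.filter fun t => coreDegree T t = 2 ∧ ∃ e ∈ edgeClass T e₀, e ⊆ t).card + 1 := by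
  classical
  set C := edgeClass T e₀ with hC
  -- The edges of the class, linked at 2-valent vertices, form a connected graph, which has at most
  -- one vertex more than it has links.
  let G : SimpleGraph {e // e ∈ C} :=
    { Adj := fun e e' => e ≠ e' ∧ ∃ t ∈ T, coreDegree T t = 2 ∧ e.1 ⊆ t ∧ e'.1 ⊆ t
      symm := ⟨fun e e' ⟨hne, t, ht, hd, h1, h2⟩ => ⟨hne.symm, t, ht, hd, h2, h1⟩⟩
      loopless := ⟨fun e h => h.1 rfl⟩ }
  have hreach : ∀ e e', Concatenated T e e' → (e ∈ C ↔ e' ∈ C) ∧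
      ∀ (he : e ∈ C) (he' : e' ∈ C), G.Reachable ⟨e, he⟩ ⟨e', he'⟩ := by
    intro e e' hc
    induction hc with
    | refl e => exact ⟨Iff.rfl, fun _ _ => SimpleGraph.Reachable.refl _⟩
    | symm e e' _ ih => exact ⟨ih.1.symm, fun he he' => (ih.2 he' he).symm⟩
    | trans e e' e'' _ _ ih1 ih2 =>
      exact ⟨ih1.1.trans ih2.1, fun he he'' =>
        (ih1.2 he (ih1.1.1 he)).trans (ih2.2 (ih1.1.1 he) he'')⟩
    | rel e e' hr =>
      have hcc : Concatenated T e e' := Relation.EqvGen.rel _ _ hr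
      refine ⟨⟨fun he => ?_, fun he' => ?_⟩, fun he he' => ?_⟩
      · exact mem_edgeClass.2 ⟨hr.2.1, (mem_edgeClass.1 he).2.trans _ _ _ hcc⟩
      · exact mem_edgeClass.2 ⟨hr.1, (mem_edgeClass.1 he').2.trans _ _ _ hcc.symm⟩
      · by_cases heq : e = e'
        · subst heq; exact SimpleGraph.Reachable.refl _
        · obtain ⟨-, -, t, ht, hd, h1, h2⟩ := hr
          exact SimpleGraph.Adj.reachable ⟨fun hcon => heq (congrArg Subtype.val hcon), t, ht, hd,
            h1, h2⟩
  have hself : e₀ ∈ C := mem_edgeClass.2 ⟨he₀, Relation.EqvGen.refl _⟩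
  have hconn : G.Connected := by
    have : Nonempty {e // e ∈ C} := ⟨⟨e₀, hself⟩⟩
    refine SimpleGraph.Connected.mk fun a b => ?_
    have ha := (hreach _ _ (mem_edgeClass.1 a.2).2).2 hself a.2
    have hb := (hreach _ _ (mem_edgeClass.1 b.2).2).2 hself b.2
    exact ha.symm.trans hb
  have hcard := hconn.card_vert_le_card_edgeSet_add_one
  rw [Nat.card_eq_fintype_card, Fintype.card_coe] at hcard
  refine hcard.trans (Nat.add_le_add_right ?_ 1)
  -- choose a 2-valent vertex for every link
  have hch : ∀ s : G.edgeSet, ∃ t ∈ T, coreDegree T t = 2 ∧ ∀ e ∈ s.1, e.1 ⊆ t := by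
    rintro ⟨s, hs⟩
    induction s using Sym2.ind with
    | _ a b =>
      obtain ⟨-, t, ht, hd, h1, h2⟩ := (SimpleGraph.mem_edgeSet G).1 hs
      refine ⟨t, ht, hd, fun e he => ?_⟩
      rcases Sym2.mem_iff.1 he with rfl | rfl <;> assumption
  choose f hfT hfd hfe using hch
  -- A 2-valent triangle contains only two core edges, so it accounts for a single link.
  have hinj : Function.Injective f := by
    rintro ⟨s, hs⟩ ⟨s', hs'⟩ hff
    induction s using Sym2.ind with
    | _ a b =>
    induction s' using Sym2.ind with
    | _ c d =>
      have hab : a ≠ b := ((SimpleGraph.mem_edgeSet G).1 hs).1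
      have hcd : c ≠ d := ((SimpleGraph.mem_edgeSet G).1 hs').1
      have ha := hfe ⟨_, hs⟩ a (by simp)
      have hb := hfe ⟨_, hs⟩ b (by simp)
      have hc := hfe ⟨_, hs'⟩ c (by simp)
      have hd := hfe ⟨_, hs'⟩ d (by simp)
      rw [← hff] at hc hd
      have hdeg := hfd ⟨_, hs⟩
      rw [coreDegree, Finset.card_eq_two] at hdeg
      obtain ⟨x, y, -, hxy⟩ := hdeg
      have hm : ∀ z : {e // e ∈ C}, z.1 ⊆ f ⟨_, hs⟩ → z.1 = x ∨ z.1 = y := by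
        intro z hz
        have : z.1 ∈ (coreEdges T).filter fun e => e ⊆ f ⟨_, hs⟩ :=
          Finset.mem_filter.2 ⟨(mem_edgeClass.1 z.2).1, hz⟩
        rw [hxy] at this
        simpa using this
      have hab' : a.1 ≠ b.1 := fun hcon => hab (Subtype.ext hcon)
      have hcd' : c.1 ≠ d.1 := fun hcon => hcd (Subtype.ext hcon)
      apply Subtype.ext
      rw [Sym2.eq_iff]
      rcases hm a ha with h1 | h1 <;> rcases hm b hb with h2 | h2 <;>
        rcases hm c hc with h3 | h3 <;> rcases hm d hd with h4 | h4 <;>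
        first
        | exact absurd (h1.trans h2.symm) hab'
        | exact absurd (h3.trans h4.symm) hcd'
        | exact Or.inl ⟨Subtype.ext (h1.trans h3.symm), Subtype.ext (h2.trans h4.symm)⟩
        | exact Or.inr ⟨Subtype.ext (h1.trans h4.symm), Subtype.ext (h2.trans h3.symm)⟩
  have hinj' : Function.Injective (fun s : G.edgeSet => (⟨f s, by
      rw [Finset.mem_filter]
      refine ⟨hfT s, hfd s, ?_⟩
      have := hfe s
      obtain ⟨s, hs⟩ := s
      induction s using Sym2.ind with
      | _ a b => exact ⟨a.1, a.2, this a (by simp)⟩⟩ :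
      {t // t ∈ T.filter fun t => coreDegree T t = 2 ∧ ∃ e ∈ C, e ⊆ t})) :=
    fun s s' hss => hinj (congrArg Subtype.val hss)
  refine (Nat.card_le_card_of_injective _ hinj').trans (le_of_eq ?_)
  rw [Nat.card_eq_fintype_card, Fintype.card_coe]

/-- A class of concatenated edges has two ends at trivalent vertices. -/
theorem sum_edgeClass_ends (h : IsAdmissible Δ T) {ω : ℤ × ℤ → ℝ} (hω : Supports T ω)
    {e₀ : Finset (ℤ × ℤ)} (he₀ : e₀ ∈ coreEdges T) :
    ∑ t ∈ T.filter (fun t => coreDegree T t = 3), ((edgeClass T e₀).filter fun e => e ⊆ t).card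
      = 2 := by
  classical
  set C := edgeClass T e₀ with hC
  have hCc : ∀ e ∈ C, e ∈ coreEdges T := fun e he => (mem_edgeClass.1 he).1
  have hclosed : ∀ t ∈ T, coreDegree T t = 2 → ∀ e ∈ C, ∀ e' ∈ coreEdges T, e ⊆ t → e' ⊆ t →
      e' ∈ C := by
    intro t ht hd e he e' he' h1 h2
    exact mem_edgeClass.2 ⟨he', (mem_edgeClass.1 he).2.trans _ _ _
      (concatenated_of_degree_two ht hd (hCc e he) he' h1 h2)⟩
  have htot : ∑ t ∈ T, (C.filter fun e => e ⊆ t).card = 2 * C.card := by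
    have := Finset.sum_card_bipartiteAbove_eq_sum_card_bipartiteBelow
      (s := T) (t := C) (fun t e => e ⊆ t)
    simp only [Finset.bipartiteAbove, Finset.bipartiteBelow] at this
    rw [this, Finset.sum_const_nat (m := 2), mul_comm]
    intro e he
    exact card_triangles_of_edge h.tri (coreEdges_subset (hCc e he))
  have hsplit : ∀ t ∈ T, (C.filter fun e => e ⊆ t).card =
      (if coreDegree T t = 3 then (C.filter fun e => e ⊆ t).card else 0) +
      2 * (if coreDegree T t = 2 ∧ ∃ e ∈ C, e ⊆ t then 1 else 0) := by
    intro t ht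
    by_cases hex : ∃ e ∈ C, e ⊆ t
    · obtain ⟨e, he, het⟩ := hex
      rcases coreDegree_two_or_three h hω (hCc e he) ht het with hd | hd
      · rw [if_neg (by omega), if_pos ⟨hd, e, he, het⟩]
        have : C.filter (fun e => e ⊆ t) = (coreEdges T).filter fun e => e ⊆ t := by
          ext e'
          simp only [Finset.mem_filter]
          exact ⟨fun h' => ⟨hCc e' h'.1, h'.2⟩,
            fun h' => ⟨hclosed t ht hd e he e' h'.1 het h'.2, h'.2⟩⟩
        rw [this, ← coreDegree, hd]
      · rw [if_pos hd, if_neg (by omega)]; simp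
    · have : C.filter (fun e => e ⊆ t) = ∅ := by
        rw [Finset.filter_eq_empty_iff]
        intro e he het; exact hex ⟨e, he, het⟩
      simp [this, hex]
  rw [Finset.sum_congr rfl hsplit, Finset.sum_add_distrib, ← Finset.mul_sum, ← Finset.card_filter,
    ← Finset.sum_filter] at htot
  have hle := card_edgeClass_le he₀
  rw [← hC] at hle
  -- Were there no end at a trivalent vertex, the class would be closed under adjacency and exhaust
  -- the connected core, although trivalent vertices exist.
  have hne : ∑ t ∈ T.filter (fun t => coreDegree T t = 3), (C.filter fun e => e ⊆ t).card ≠ 0 := by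
    intro hzero
    rw [Finset.sum_eq_zero_iff] at hzero
    have hno : ∀ t ∈ T, coreDegree T t = 3 → ∀ e ∈ C, ¬ e ⊆ t := by
      intro t ht hd e he het
      have := hzero t (Finset.mem_filter.2 ⟨ht, hd⟩)
      rw [Finset.card_eq_zero, Finset.filter_eq_empty_iff] at this
      exact this he het
    have hall := coreEdges_connected h hω (fun e => e ∈ C)
      ⟨e₀, he₀, mem_edgeClass.2 ⟨he₀, Relation.EqvGen.refl _⟩⟩ (by
        intro t ht e he e' he' h1 h2 heC
        rcases coreDegree_two_or_three h hω he ht h1 with hd | hd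
        · exact hclosed t ht hd e heC e' he' h1 h2
        · exact absurd h1 (hno t ht hd e heC))
    have h3 := card_trivalent h hω
    have hg := two_le_genus h
    have hpos : 0 < (T.filter fun t => coreDegree T t = 3).card := by omega
    obtain ⟨t, ht⟩ := Finset.card_pos.1 hpos
    rw [Finset.mem_filter] at ht
    have hd := ht.2
    have : 0 < ((coreEdges T).filter fun e => e ⊆ t).card := by rw [← coreDegree]; omega
    obtain ⟨e, he⟩ := Finset.card_pos.1 this
    rw [Finset.mem_filter] at he
    exact hno t ht.1 hd e (hall e he.1) he.2
  -- The number of ends is even, at most 2 by the bound on the class, and not 0.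
  omega

theorem endCount_mk {V : Type*} [DecidableEq V] (a b v : V) :
    endCount s(a, b) v = (if v = a then 1 else 0) + (if v = b then 1 else 0) := by
  unfold endCount
  by_cases h1 : v = a <;> by_cases h2 : v = b <;> simp [h1, h2] <;> grind

/-- Total multiplicity 2 means two distinct ends or one end taken twice, a loop; they are found by
removing one index and then another. -/
theorem exists_sym2_of_sum {n : ℕ} (f : Fin n → ℕ) (hf : ∑ i, f i = 2) :
    ∃ s : Sym2 (Fin n), ∀ i, endCount s i = f i := by
  classical
  obtain ⟨a, -, ha⟩ := Finset.exists_ne_zero_of_sum_ne_zero (by rw [hf]; norm_num :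
    ∑ i, f i ≠ 0)
  have hsum : ∑ i, (f i - if i = a then 1 else 0) = 1 := by
    have : ∑ i, f i = ∑ i, (f i - if i = a then 1 else 0) + ∑ i, if i = a then 1 else 0 := by
      rw [← Finset.sum_add_distrib]
      apply Finset.sum_congr rfl
      intro i _
      by_cases hi : i = a
      · subst hi; simp; omega
      · simp [hi]
    rw [hf, Finset.sum_ite_eq' Finset.univ a] at this
    simp at this
    omega
  obtain ⟨b, -, hb⟩ := Finset.exists_ne_zero_of_sum_ne_zero (by rw [hsum]; norm_num :
    ∑ i, (f i - if i = a then 1 else 0) ≠ 0)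
  refine ⟨s(a, b), fun i => ?_⟩
  rw [endCount_mk]
  have hrest : ∀ i, f i - (if i = a then 1 else 0) = if i = b then 1 else 0 := by
    intro i
    by_cases hi : i = b
    · subst hi
      have := Finset.single_le_sum (f := fun i => f i - if i = a then 1 else 0)
        (fun _ _ => Nat.zero_le _) (Finset.mem_univ i)
      rw [hsum] at this
      rw [if_pos rfl]
      omega
    · rw [if_neg hi]
      have := Finset.add_le_sum (f := fun i => f i - if i = a then 1 else 0) (s := Finset.univ)
        (fun _ _ => Nat.zero_le _) (Finset.mem_univ i) (Finset.mem_univ b) hi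
      rw [hsum] at this
      omega
  have := hrest i
  by_cases hi : i = a
  · subst hi; simp only [if_true] at this ⊢; omega
  · simp only [hi, if_false] at this ⊢; omega

/-- The combinatorial type of the skeletons of the curves dual to `T`. -/
theorem exists_combinatorial_type (h : IsAdmissible Δ T) {ω : ℤ × ℤ → ℝ} (hω : Supports T ω)
    {g : ℕ} (hg : g = (inner Δ T).card) :
    ∃ (vert : Fin (2 * g - 2) → Finset (ℤ × ℤ)) (cls : Finset (ℤ × ℤ) → Fin (3 * g - 3))
      (G : TrivalentGraph g),
    Set.BijOn vert Set.univ {t | t ∈ T ∧ coreDegree T t = 3} ∧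
    (∀ j, ∃ e ∈ coreEdges T, cls e = j) ∧
    (∀ e ∈ coreEdges T, ∀ e' ∈ coreEdges T, cls e = cls e' ↔ Concatenated T e e') ∧
    (∀ i j, ((coreEdges T).filter fun e => e ⊆ vert i ∧ cls e = j).card
      = endCount (G.ends j) i) := by
  classical
  have hg2 : 2 ≤ g := hg ▸ two_le_genus h
  set T3 := T.filter fun t => coreDegree T t = 3 with hT3
  have hT3c : T3.card = 2 * g - 2 := by
    have := card_trivalent h hω; rw [← hT3, ← hg] at this; omega
  set Cl := (coreEdges T).image (edgeClass T) with hCl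
  have hclass : ∀ e ∈ coreEdges T, ∀ e' ∈ coreEdges T,
      edgeClass T e = edgeClass T e' ↔ Concatenated T e e' := by
    intro e he e' he'
    constructor
    · intro heq
      have : e' ∈ edgeClass T e := by
        rw [heq]; exact mem_edgeClass.2 ⟨he', Relation.EqvGen.refl _⟩
      exact (mem_edgeClass.1 this).2
    · intro hc
      ext f
      simp only [mem_edgeClass]
      exact ⟨fun hf => ⟨hf.1, hc.symm.trans _ _ _ hf.2⟩, fun hf => ⟨hf.1, hc.trans _ _ _ hf.2⟩⟩
  have hfib : ∀ e₀ ∈ coreEdges T,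
      (coreEdges T).filter (fun e => edgeClass T e = edgeClass T e₀) = edgeClass T e₀ := by
    intro e₀ he₀
    ext e
    simp only [Finset.mem_filter, mem_edgeClass]
    constructor
    · rintro ⟨he, heq⟩; exact ⟨he, ((hclass e he e₀ he₀).1 heq).symm⟩
    · rintro ⟨he, hc⟩; exact ⟨he, (hclass e he e₀ he₀).2 hc.symm⟩
  -- Counting ends at trivalent vertices: three at each vertex, two for each class.
  have hClc : Cl.card = 3 * g - 3 := by
    have e1 : ∑ t ∈ T3, coreDegree T t = 3 * (2 * g - 2) := by
      rw [Finset.sum_const_nat (m := 3) (fun t ht => (Finset.mem_filter.1 ht).2), hT3c, mul_comm]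
    have e2 : ∑ t ∈ T3, coreDegree T t = 2 * Cl.card := by
      have : ∀ t ∈ T3, coreDegree T t = ∑ c ∈ Cl, (c.filter fun e => e ⊆ t).card := by
        intro t _
        rw [coreDegree, Finset.card_eq_sum_card_fiberwise (f := edgeClass T) (t := Cl)]
        · apply Finset.sum_congr rfl
          intro c hc
          obtain ⟨e₀, he₀, rfl⟩ := Finset.mem_image.1 hc
          rw [Finset.filter_filter]
          conv_rhs => rw [← hfib e₀ he₀, Finset.filter_filter]
          congr 1
          apply Finset.filter_congr
          intro e _
          exact and_comm
        · intro e he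
          exact Finset.mem_coe.2 (Finset.mem_image_of_mem _
            (Finset.mem_filter.1 (Finset.mem_coe.1 he)).1)
      rw [Finset.sum_congr rfl this, Finset.sum_comm, Finset.sum_const_nat (m := 2), mul_comm]
      intro c hc
      obtain ⟨e₀, he₀, rfl⟩ := Finset.mem_image.1 hc
      exact sum_edgeClass_ends h hω he₀
    omega
  let eV : Fin (2 * g - 2) ≃ T3 := (Finset.equivFinOfCardEq hT3c).symm
  let eC : Cl ≃ Fin (3 * g - 3) := Finset.equivFinOfCardEq hClc
  have hpos : 0 < 3 * g - 3 := by omega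
  -- The value off the core is arbitrary.
  let cls : Finset (ℤ × ℤ) → Fin (3 * g - 3) := fun e =>
    if he : e ∈ coreEdges T then eC ⟨edgeClass T e, Finset.mem_image_of_mem _ he⟩ else ⟨0, hpos⟩
  let vert : Fin (2 * g - 2) → Finset (ℤ × ℤ) := fun i => (eV i).1
  have hcls : ∀ e (he : e ∈ coreEdges T), cls e = eC ⟨edgeClass T e, Finset.mem_image_of_mem _ he⟩ :=
    fun e he => by simp [cls, he]
  have hcls_iff : ∀ e ∈ coreEdges T, ∀ e' ∈ coreEdges T,
      cls e = cls e' ↔ Concatenated T e e' := by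
    intro e he e' he'
    rw [hcls e he, hcls e' he', eC.apply_eq_iff_eq, Subtype.mk.injEq, hclass e he e' he']
  have hsurj : ∀ j, ∃ e ∈ coreEdges T, cls e = j := by
    intro j
    obtain ⟨e, he, heq⟩ := Finset.mem_image.1 (eC.symm j).2
    refine ⟨e, he, ?_⟩
    rw [hcls e he, ← eC.apply_symm_apply j]
    congr 1
    exact Subtype.ext heq
  have hvert : ∀ i, vert i ∈ T ∧ coreDegree T (vert i) = 3 := fun i =>
    Finset.mem_filter.1 (eV i).2
  have hvertsurj : ∀ t ∈ T, coreDegree T t = 3 → ∃ i, vert i = t := by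
    intro t ht hd
    exact ⟨eV.symm ⟨t, Finset.mem_filter.2 ⟨ht, hd⟩⟩, by simp [vert]⟩
  have hsum2 : ∀ j, ∑ i, ((coreEdges T).filter fun e => e ⊆ vert i ∧ cls e = j).card = 2 := by
    intro j
    obtain ⟨e₀, he₀, rfl⟩ := hsurj j
    refine Eq.trans ?_ (sum_edgeClass_ends h hω he₀)
    rw [← hT3, ← Finset.sum_coe_sort T3, ← eV.sum_comp]
    apply Finset.sum_congr rfl
    intro i _
    congr 1
    ext e
    simp only [Finset.mem_filter, mem_edgeClass]
    constructor
    · rintro ⟨he, h1, h2⟩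
      exact ⟨⟨he, ((hcls_iff e he e₀ he₀).1 h2).symm⟩, h1⟩
    · rintro ⟨⟨he, h2⟩, h1⟩
      exact ⟨he, h1, (hcls_iff e he e₀ he₀).2 h2.symm⟩
  choose ends hends using fun j => exists_sym2_of_sum _ (hsum2 j)
  have hmem : ∀ j i, endCount (ends j) i ≠ 0 ↔ i ∈ ends j := by
    intro j i
    unfold endCount
    by_cases hi : i ∈ ends j
    · simp [hi]
    · have : ends j ≠ s(i, i) := fun heq => hi (by rw [heq]; simp)
      simp [hi, this]
  have hinc : ∀ i, ∀ e ∈ coreEdges T, e ⊆ vert i → i ∈ ends (cls e) := by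
    intro i e he hei
    rw [← hmem, hends]
    apply Finset.card_ne_zero_of_mem (a := e)
    simp [he, hei]
  have hstepR : ∀ u j a b, Relation.ReflTransGen (fun a b => ∃ e, ends e = s(a, b)) u a →
      a ∈ ends j → b ∈ ends j → Relation.ReflTransGen (fun a b => ∃ e, ends e = s(a, b)) u b := by
    intro u j a b hua ha hb
    by_cases hab : a = b
    · exact hab ▸ hua
    · exact hua.tail ⟨j, (Sym2.mem_and_mem_iff hab).1 ⟨ha, hb⟩⟩
  have hedge : ∀ i, ∃ e ∈ coreEdges T, e ⊆ vert i := by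
    intro i
    have : 0 < ((coreEdges T).filter fun e => e ⊆ vert i).card := by
      rw [← coreDegree, (hvert i).2]; norm_num
    obtain ⟨e, he⟩ := Finset.card_pos.1 this
    exact ⟨e, (Finset.mem_filter.1 he).1, (Finset.mem_filter.1 he).2⟩
  refine ⟨vert, cls, ⟨ends, ?_, ?_⟩, ⟨?_, ?_, ?_⟩, hsurj, hcls_iff, fun i j => (hends j i).symm⟩
  · intro i
    simp only [hends]
    refine Eq.trans ?_ (hvert i).2
    rw [coreDegree,
      Finset.card_eq_sum_card_fiberwise (f := cls) (t := Finset.univ) (by intro _ _; simp)]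
    simp only [Finset.filter_filter]
  · intro u v
    have hall := coreEdges_connected h hω (fun e => ∃ w,
      Relation.ReflTransGen (fun a b => ∃ e, ends e = s(a, b)) u w ∧ w ∈ ends (cls e))
      (by
        obtain ⟨e, he, heu⟩ := hedge u
        exact ⟨e, he, u, Relation.ReflTransGen.refl, hinc u e he heu⟩)
      (by
        rintro t ht e he e' he' h1 h2 ⟨w, hw, hwe⟩
        rcases coreDegree_two_or_three h hω he ht h1 with hd | hd
        · rw [← (hcls_iff e he e' he').2 (concatenated_of_degree_two ht hd he he' h1 h2)]
          exact ⟨w, hw, hwe⟩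
        · obtain ⟨i, rfl⟩ := hvertsurj t ht hd
          exact ⟨i, hstepR u (cls e) w i hw hwe (hinc i e he h1), hinc i e' he' h2⟩)
    obtain ⟨f, hf, hfv⟩ := hedge v
    obtain ⟨w, hw, hwf⟩ := hall f hf
    exact hstepR u (cls f) w v hw hwf (hinc v f hf hfv)
  · intro i _; exact hvert i
  · intro i _ j _ hij
    exact eV.injective (Subtype.ext hij)
  · rintro t ⟨ht, hd⟩
    obtain ⟨i, rfl⟩ := hvertsurj t ht hd
    exact ⟨i, trivial, rfl⟩

end

end TropPlane

namespace TropPlane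

/-! ## Edge lengths as linear functions of the heights -/

/-- The height of `ω` at `S` above the affine interpolation of `ω` on the triangle `PQR`. -/
def bend (P Q R S : ℤ × ℤ) : (ℤ × ℤ → ℝ) →ₗ[ℝ] ℝ where
  toFun ω := ω S - interp ω P Q R (toPlane S)
  map_add' ω η := by simp only [interp, Pi.add_apply]; ring
  map_smul' c ω := by simp only [interp, Pi.smul_apply, smul_eq_mul, RingHom.id_apply]; ring

theorem bend_apply (P Q R S : ℤ × ℤ) (ω : ℤ × ℤ → ℝ) :
    bend P Q R S ω = ω S - interp ω P Q R (toPlane S) := rfl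

theorem bend_symm {P Q R S : ℤ × ℤ} (h : idet P Q R = 1) (h' : idet Q P S = 1) :
    bend Q P S R = bend P Q R S := by
  ext1 ω
  have h1 : side Q P (toPlane R) = -1 := by rw [side_swap, side_toPlane, h]; norm_num
  rw [bend_apply, bend_apply, interp_cross h h', interp_vertex h ω (by simp), h1]
  ring

open Classical in
/-- The lattice length of the bounded edge dual to `e`, as a linear function of the heights. -/
noncomputable def edgeLength (T : Finset (Finset (ℤ × ℤ))) (e : Finset (ℤ × ℤ)) :
    (ℤ × ℤ → ℝ) →ₗ[ℝ] ℝ :=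
  if h : ∃ d : ((ℤ × ℤ) × (ℤ × ℤ)) × ((ℤ × ℤ) × (ℤ × ℤ)),
      e = {d.1.1, d.1.2} ∧ Tri T d.1.1 d.1.2 d.2.1 ∧ Tri T d.1.2 d.1.1 d.2.2 then
    bend h.choose.1.1 h.choose.1.2 h.choose.2.1 h.choose.2.2
  else 0

/-- The dot product of the plane. -/
def dot (x y : ℝ × ℝ) : ℝ := x.1 * y.1 + x.2 * y.2

/-- The rate of change, up to scaling, of the squared length of the edge `e` if its ends move with
velocities `u`. -/
def stress (u : ℤ × ℤ → ℝ × ℝ) (e : Finset (ℤ × ℤ)) : ℝ :=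
  ∑ X ∈ e, dot (u X) (∑ Y ∈ e, (toPlane Y - toPlane X))

theorem stress_pair (u : ℤ × ℤ → ℝ × ℝ) {P Q : ℤ × ℤ} (h : P ≠ Q) :
    stress u {P, Q} = dot (u P - u Q) (toPlane Q - toPlane P) := by
  rw [stress, Finset.sum_pair h, Finset.sum_pair h, Finset.sum_pair h]
  simp only [dot, Prod.fst_sub, Prod.snd_sub, Prod.fst_add, Prod.snd_add]
  ring

/-- `S - P` and `S - Q` form a basis of the plane. -/
theorem eq_zero_of_dot {P Q S : ℤ × ℤ} (h : idet Q P S = 1) {v : ℝ × ℝ}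
    (h1 : dot v (toPlane S - toPlane P) = 0) (h2 : dot v (toPlane S - toPlane Q) = 0) : v = 0 := by
  have h' : ((idet Q P S : ℤ) : ℝ) = 1 := by rw [h]; simp
  simp only [idet] at h'; push_cast at h'
  simp only [dot, toPlane, Prod.fst_sub, Prod.snd_sub] at h1 h2
  apply Prod.ext
  · simp only [Prod.fst_zero]
    linear_combination (-v.1) * h' + (-((S.2 : ℝ) - Q.2)) * h1 + ((S.2 : ℝ) - P.2) * h2
  · simp only [Prod.snd_zero]
    linear_combination (-v.2) * h' + ((S.1 : ℝ) - Q.1) * h1 - ((S.1 : ℝ) - P.1) * h2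

theorem dualVertex_rot (ω : ℤ × ℤ → ℝ) (P Q R : ℤ × ℤ) :
    dualVertex ω Q R P = dualVertex ω P Q R := by
  simp only [dualVertex]
  apply Prod.ext <;> simp only <;> ring

/-- The gradient of the interpolation jumps by a multiple of the normal of the common edge. The
normal is primitive, so the factor `bend` is the lattice length of the dual edge. -/
theorem dualVertex_cross {P Q R S : ℤ × ℤ} (h : idet P Q R = 1) (h' : idet Q P S = 1)
    (ω : ℤ × ℤ → ℝ) : dualVertex ω Q P S =
      dualVertex ω P Q R + bend P Q R S ω • ((P.2 : ℝ) - Q.2, (Q.1 : ℝ) - P.1) := by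
  have e : ∀ A B C : ℤ × ℤ, dualVertex ω A B C = (interp ω A B C 0 - interp ω A B C (1, 0),
      interp ω A B C 0 - interp ω A B C (0, 1)) := by
    intro A B C
    simp only [dualVertex, interp, side, Prod.fst_zero, Prod.snd_zero]
    apply Prod.ext <;> simp only <;> ring
  rw [e, e, interp_cross h h', interp_cross h h', interp_cross h h', ← bend_apply]
  simp only [side, Prod.fst_zero, Prod.snd_zero]
  apply Prod.ext <;>
    simp only [Prod.fst_add, Prod.snd_add, Prod.smul_fst, Prod.smul_snd, smul_eq_mul] <;> ring

/-! ### The relations between the edge lengths: rigidity and closing polygons. -/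

section

variable {Δ : Set (ℝ × ℝ)} {T : Finset (Finset (ℤ × ℤ))}

theorem edgeLength_eq (hT : IsUnimodularTriangulation Δ T) {P Q R S : ℤ × ℤ} (h : Tri T P Q R)
    (h' : Tri T Q P S) : edgeLength T {P, Q} = bend P Q R S := by
  have hex : ∃ d : ((ℤ × ℤ) × (ℤ × ℤ)) × ((ℤ × ℤ) × (ℤ × ℤ)),
      ({P, Q} : Finset (ℤ × ℤ)) = {d.1.1, d.1.2} ∧ Tri T d.1.1 d.1.2 d.2.1 ∧
        Tri T d.1.2 d.1.1 d.2.2 := ⟨((P, Q), (R, S)), rfl, h, h'⟩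
  rw [edgeLength, dif_pos hex]
  obtain ⟨he, h1, h2⟩ := hex.choose_spec
  revert he h1 h2
  generalize hex.choose = d
  obtain ⟨⟨A, B⟩, ⟨C, D⟩⟩ := d
  intro he h1 h2
  simp only at he h1 h2 ⊢
  rcases pair_eq he h.ne with ⟨rfl, rfl⟩ | ⟨rfl, rfl⟩
  · rw [h1.unique hT h, h2.unique hT h']
  · rw [h1.unique hT h', h2.unique hT h, bend_symm h.1 h'.1]

theorem edgeLength_pos (hT : IsUnimodularTriangulation Δ T) {ω : ℤ × ℤ → ℝ} (hω : Supports T ω)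
    {e : Finset (ℤ × ℤ)} (he : e ∈ boundedEdges T) : 0 < edgeLength T e ω := by
  obtain ⟨P, Q, R, S, rfl, h1, h2⟩ := (mem_boundedEdges hT).1 he
  rw [edgeLength_eq hT h1 h2, bend_apply, sub_pos]
  exact hω P Q R h1 S h2.rot.rot.mem_verts (notMem_of_cross h1 h2)

/-- A height function on which all lengths vanish is determined by its values on a triangle. -/
theorem eq_zero_of_edgeLength (h : IsAdmissible Δ T) {ω₀ : ℤ × ℤ → ℝ} (hω₀ : Supports T ω₀)
    {ω : ℤ × ℤ → ℝ} (hω : ∀ e ∈ boundedEdges T, edgeLength T e ω = 0)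
    {t : Finset (ℤ × ℤ)} (ht : t ∈ T) (h0 : ∀ X ∈ t, ω X = 0) {B : ℤ × ℤ} (hB : B ∈ verts T) :
    ω B = 0 := by
  obtain ⟨t', -, hBt', hp⟩ := exists_mem_of_walk h hω₀ hB (fun t => ∀ X ∈ t, ω X = 0) ⟨t, ht, h0⟩ (by
    intro P Q R S h1 h2 _ hp
    have hP := hp P (by simp)
    have hQ := hp Q (by simp)
    have hR := hp R (by simp)
    have hb := hω {P, Q} ((mem_boundedEdges h.tri).2 ⟨P, Q, R, S, rfl, h1, h2⟩)
    rw [edgeLength_eq h.tri h1 h2, bend_apply, interp, hP, hQ, hR] at hb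
    intro X hX
    simp only [Finset.mem_insert, Finset.mem_singleton] at hX
    rcases hX with rfl | rfl | rfl
    · exact hQ
    · exact hP
    · linarith)
  exact hp B hBt'

/-- Infinitesimal rigidity: a motion that preserves the lengths of all edges and fixes the boundary
vertices is zero. -/
theorem eq_zero_of_stress (h : IsAdmissible Δ T) {ω₀ : ℤ × ℤ → ℝ} (hω₀ : Supports T ω₀)
    {u : ℤ × ℤ → ℝ × ℝ} (hu : ∀ X, X ∉ interiorPts Δ → u X = 0)
    (hs : ∀ e ∈ boundedEdges T, stress u e = 0) {B : ℤ × ℤ} (hB : B ∈ verts T) : u B = 0 := by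
  have hedge : ∀ {P Q R : ℤ × ℤ}, Tri T P Q R → dot (u P - u Q) (toPlane Q - toPlane P) = 0 := by
    intro P Q R ht
    by_cases hPQ : P ∈ interiorPts Δ ∨ Q ∈ interiorPts Δ
    · obtain ⟨S, hS⟩ := exists_neighbour_of_inner h ht hPQ
      rw [← stress_pair u ht.ne]
      exact hs _ ((mem_boundedEdges h.tri).2 ⟨P, Q, R, S, rfl, ht, hS⟩)
    · push Not at hPQ
      rw [hu P hPQ.1, hu Q hPQ.2]; simp [dot]
  -- A fixed edge fixes the apex, as its velocity is orthogonal to two independent edges. Starting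
  -- at a boundary edge, this propagates through the triangulation.
  have hthird : ∀ {P Q R : ℤ × ℤ}, Tri T P Q R → u P = 0 → u Q = 0 → u R = 0 := by
    intro P Q R ht hP hQ
    have h1 := hedge ht.rot
    have h2 := hedge ht.rot.rot
    rw [hQ] at h1
    rw [hP] at h2
    apply eq_zero_of_dot ht.1
    · simp only [dot, Prod.fst_sub, Prod.snd_sub, Prod.fst_zero, Prod.snd_zero] at h1 ⊢
      linarith
    · simp only [dot, Prod.fst_sub, Prod.snd_sub, Prod.fst_zero, Prod.snd_zero] at h2 ⊢
      linarith
  obtain ⟨P, hP⟩ : ∃ P, P ∈ outer Δ T := by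
    apply Finset.card_pos.1
    have := (card_triangles h).2
    omega
  obtain ⟨hPΔ, hPi⟩ := (mem_outer h).1 hP
  obtain ⟨Q, R, ht, hside⟩ := exists_boundary_edge h hPΔ hPi
  have hQ : Q ∉ interiorPts Δ := by
    intro hQ
    obtain ⟨S, hS⟩ := exists_neighbour_of_inner h ht (Or.inr hQ)
    have := hside _ (hS.mem₃ h)
    rw [side_swap, side_toPlane, hS.1] at this
    norm_num at this
  obtain ⟨t', -, hBt', hp⟩ := exists_mem_of_walk h hω₀ hB (fun t => ∀ X ∈ t, u X = 0)
    ⟨_, ht.2, by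
      intro X hX
      simp only [Finset.mem_insert, Finset.mem_singleton] at hX
      rcases hX with rfl | rfl | rfl
      · exact hu _ hPi
      · exact hu _ hQ
      · exact hthird ht (hu _ hPi) (hu _ hQ)⟩ (by
    intro P Q R S h1 h2 _ hp
    have hP := hp P (by simp)
    have hQ := hp Q (by simp)
    intro X hX
    simp only [Finset.mem_insert, Finset.mem_singleton] at hX
    rcases hX with rfl | rfl | rfl
    · exact hQ
    · exact hP
    · exact hthird h2 hQ hP)
  exact hp B hBt'

/-- The edges dual to those at an interior vertex bound a closed polygon. -/
theorem sum_edges_at (h : IsAdmissible Δ T) {P : ℤ × ℤ} (hP : P ∈ interiorPts Δ)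
    (ω : ℤ × ℤ → ℝ) :
    ∑ e ∈ (boundedEdges T).filter (fun e => P ∈ e),
      edgeLength T e ω • (∑ Y ∈ e, (toPlane Y - toPlane P)) = 0 := by
  classical
  have hnext : ∀ Q, ∃ R, (P, Q) ∈ darts T → Tri T P Q R := by
    intro Q
    by_cases hQ : (P, Q) ∈ darts T
    · obtain ⟨R, hR⟩ := mem_darts.1 hQ; exact ⟨R, fun _ => hR⟩
    · exact ⟨0, fun h => absurd h hQ⟩
  have hprev : ∀ Q, ∃ S, (P, Q) ∈ darts T → Tri T P S Q := by
    intro Q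
    by_cases hQ : (P, Q) ∈ darts T
    · obtain ⟨R, hR⟩ := mem_darts.1 hQ
      obtain ⟨S, hS⟩ := exists_neighbour_of_inner h hR (Or.inl hP)
      exact ⟨S, fun _ => hS.rot⟩
    · exact ⟨0, fun h => absurd h hQ⟩
  choose next hnext using hnext
  choose prev hprev using hprev
  set N := (verts T).filter fun Q => (P, Q) ∈ darts T with hN
  have hNd : ∀ {Q}, Q ∈ N ↔ (P, Q) ∈ darts T := by
    intro Q
    rw [hN, Finset.mem_filter, and_iff_right_iff_imp]
    intro hd
    obtain ⟨R, hR⟩ := mem_darts.1 hd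
    exact hR.rot.mem_verts
  have hinner : ∀ {Q R}, Tri T P Q R → (P, R) ∈ darts T := by
    intro Q R ht
    obtain ⟨S, hS⟩ := exists_neighbour_of_inner h ht.rot.rot (Or.inr hP)
    exact mem_darts.2 ⟨S, hS⟩
  have hsum : ∑ e ∈ (boundedEdges T).filter (fun e => P ∈ e),
      edgeLength T e ω • (∑ Y ∈ e, (toPlane Y - toPlane P)) =
      ∑ Q ∈ N, edgeLength T {P, Q} ω • (toPlane Q - toPlane P) := by
    symm
    apply Finset.sum_bij (fun Q _ => ({P, Q} : Finset (ℤ × ℤ)))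
    · intro Q hQ
      have h1 := hnext Q (hNd.1 hQ)
      have h2 := hprev Q (hNd.1 hQ)
      rw [Finset.mem_filter]
      exact ⟨(mem_boundedEdges h.tri).2 ⟨P, Q, _, _, rfl, h1, h2.rot.rot⟩, by simp⟩
    · intro Q hQ Q' hQ' he
      rcases pair_eq he (hnext Q (hNd.1 hQ)).ne with h1 | h1
      · exact h1.2
      · exact h1.2.trans h1.1
    · intro e he
      rw [Finset.mem_filter] at he
      obtain ⟨A, B, R, S, rfl, h1, h2⟩ := (mem_boundedEdges h.tri).1 he.1
      have := he.2
      simp only [Finset.mem_insert, Finset.mem_singleton] at this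
      rcases this with rfl | rfl
      · exact ⟨B, hNd.2 (mem_darts.2 ⟨_, h1⟩), rfl⟩
      · exact ⟨A, hNd.2 (mem_darts.2 ⟨_, h2⟩), Finset.pair_comm _ _⟩
    · intro Q hQ
      rw [Finset.sum_pair (hnext Q (hNd.1 hQ)).ne]
      simp
  -- Both sides run over the triangles around `P`, once labelled by the edge before and once by the
  -- edge after.
  have htele : ∑ Q ∈ N, dualVertex ω P Q (next Q) = ∑ Q ∈ N, dualVertex ω P (prev Q) Q := by
    apply Finset.sum_bij (fun Q _ => next Q)
    · intro Q hQ; exact hNd.2 (hinner (hnext Q (hNd.1 hQ)))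
    · intro Q hQ Q' hQ' heq
      have h1 := hnext Q (hNd.1 hQ)
      have h2 := hnext Q' (hNd.1 hQ')
      rw [← heq] at h2
      exact (h1.rot.rot).unique h.tri h2.rot.rot
    · intro Q hQ
      have h1 := hprev Q (hNd.1 hQ)
      have hd : (P, prev Q) ∈ darts T := mem_darts.2 ⟨_, h1⟩
      exact ⟨prev Q, hNd.2 hd, (hnext _ hd).unique h.tri h1⟩
    · intro Q hQ
      have h1 := hnext Q (hNd.1 hQ)
      have h2 := hprev (next Q) (hinner h1)
      rw [(h2.rot.rot).unique h.tri h1.rot.rot]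
  -- Each summand is the rotated difference of the dual vertices on the two sides of the edge, so
  -- the sum telescopes.
  have hterm : ∀ Q ∈ N, edgeLength T {P, Q} ω • (toPlane Q - toPlane P) =
      (((dualVertex ω P (prev Q) Q).2 - (dualVertex ω P Q (next Q)).2),
        -((dualVertex ω P (prev Q) Q).1 - (dualVertex ω P Q (next Q)).1)) := by
    intro Q hQ
    have h1 := hnext Q (hNd.1 hQ)
    have h2 := (hprev Q (hNd.1 hQ)).rot.rot
    rw [edgeLength_eq h.tri h1 h2, dualVertex_rot ω Q P (prev Q), dualVertex_cross h1.1 h2.1 ω]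
    simp only [toPlane]
    apply Prod.ext <;> simp only [Prod.fst_add, Prod.snd_add, Prod.smul_fst, Prod.smul_snd,
      smul_eq_mul, Prod.fst_sub, Prod.snd_sub] <;> ring
  rw [hsum, Finset.sum_congr rfl hterm]
  have e1 := congrArg Prod.fst htele
  have e2 := congrArg Prod.snd htele
  rw [Prod.fst_sum, Prod.fst_sum] at e1
  rw [Prod.snd_sum, Prod.snd_sum] at e2
  apply Prod.ext
  · rw [Prod.fst_sum, Finset.sum_sub_distrib, e2]; simp
  · rw [Prod.snd_sum, Finset.sum_neg_distrib, Finset.sum_sub_distrib, e1]; simp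

/-- Every stress annihilates the edge lengths. -/
theorem sum_stress_mul_edgeLength (h : IsAdmissible Δ T) {u : ℤ × ℤ → ℝ × ℝ}
    (hu : ∀ X, X ∉ interiorPts Δ → u X = 0) (ω : ℤ × ℤ → ℝ) :
    ∑ e ∈ boundedEdges T, stress u e * edgeLength T e ω = 0 := by
  classical
  have hsub : ∀ e ∈ boundedEdges T, e ⊆ verts T := by
    intro e he
    obtain ⟨P, Q, R, S, rfl, h1, h2⟩ := (mem_boundedEdges h.tri).1 he
    intro X hX
    simp only [Finset.mem_insert, Finset.mem_singleton] at hX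
    rcases hX with rfl | rfl
    · exact h1.mem_verts
    · exact h2.mem_verts
  -- Regrouped by endpoints, the sum pairs each `u X` with the closing condition at `X`.
  have e1 : ∀ e ∈ boundedEdges T, stress u e * edgeLength T e ω = ∑ X ∈ verts T,
      if X ∈ e then dot (u X) (edgeLength T e ω • ∑ Y ∈ e, (toPlane Y - toPlane X)) else 0 := by
    intro e he
    rw [stress, Finset.sum_mul, ← Finset.sum_filter, Finset.filter_mem_eq_inter,
      Finset.inter_eq_right.2 (hsub e he)]
    apply Finset.sum_congr rfl
    intro X _
    simp only [dot, Prod.smul_fst, Prod.smul_snd, smul_eq_mul]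
    ring
  rw [Finset.sum_congr rfl e1, Finset.sum_comm]
  apply Finset.sum_eq_zero
  intro X _
  by_cases hX : X ∈ interiorPts Δ
  · rw [← Finset.sum_filter]
    have := sum_edges_at h hX ω
    have h1 := congrArg Prod.fst this
    have h2 := congrArg Prod.snd this
    rw [Prod.fst_sum] at h1
    rw [Prod.snd_sum] at h2
    simp only [dot, Finset.sum_add_distrib, ← Finset.mul_sum, h1, h2]
    simp
  · rw [hu X hX]; simp [dot]

end

end TropPlane

namespace TropPlane

/-! ## The dimension of the space of skeleton lengths -/

-- The dot product identifies `N` with the dual annihilator of `S`.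
open Module in
theorem finrank_perp {ι : Type*} [Fintype ι] (S : Submodule ℝ (ι → ℝ)) (N : Submodule ℝ (ι → ℝ))
    (hN : ∀ y, y ∈ N ↔ ∀ x ∈ S, ∑ i, y i * x i = 0) :
    finrank ℝ S + finrank ℝ N = Fintype.card ι := by
  classical
  have hmap : N.map (dotProductEquiv ℝ ι).toLinearMap = S.dualAnnihilator := by
    ext φ
    rw [Submodule.mem_map, Submodule.mem_dualAnnihilator]
    constructor
    · rintro ⟨y, hy, rfl⟩ x hx
      simpa [dotProduct] using (hN y).1 hy x hx
    · intro hφ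
      refine ⟨(dotProductEquiv ℝ ι).symm φ, (hN _).2 fun x hx => ?_, by simp⟩
      rw [← hφ x hx]
      conv_rhs => rw [← (dotProductEquiv ℝ ι).apply_symm_apply φ]
      simp only [dotProductEquiv_apply_apply, dotProduct]
  have h1 := Subspace.finrank_add_finrank_dualAnnihilator_eq S
  rw [← hmap, LinearEquiv.finrank_map_eq, Module.finrank_pi] at h1
  exact h1

/-- The vectors orthogonal to all differences of points of `A`. -/
def orthoDiff (A : Set (ℤ × ℤ)) : Submodule ℝ (ℝ × ℝ) where
  carrier := {v | ∀ Q ∈ A, ∀ Q' ∈ A, dot v (toPlane Q - toPlane Q') = 0}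
  zero_mem' := by intro Q _ Q' _; simp [dot]
  add_mem' := by
    intro v w hv hw Q hQ Q' hQ'
    have h1 := hv Q hQ Q' hQ'
    have h2 := hw Q hQ Q' hQ'
    simp only [dot, Prod.fst_add, Prod.snd_add] at h1 h2 ⊢
    linarith
  smul_mem' := by
    intro c v hv Q hQ Q' hQ'
    have h1 := hv Q hQ Q' hQ'
    simp only [dot, Prod.smul_fst, Prod.smul_snd, smul_eq_mul] at h1 ⊢
    linear_combination c * h1

theorem mem_orthoDiff {A : Set (ℤ × ℤ)} {v : ℝ × ℝ} :
    v ∈ orthoDiff A ↔ ∀ Q ∈ A, ∀ Q' ∈ A, dot v (toPlane Q - toPlane Q') = 0 := Iff.rfl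

/-- The dimensions 2, 1 and 0 found here and in the next two lemmas are the contributions of a
single interior lattice point to the number of relations. -/
theorem finrank_orthoDiff_of_subsingleton {A : Set (ℤ × ℤ)} (hA : A.Subsingleton) :
    Module.finrank ℝ (orthoDiff A) = 2 := by
  have : orthoDiff A = ⊤ := by
    rw [eq_top_iff]
    intro v _ Q hQ Q' hQ'
    rw [hA hQ hQ']; simp [dot]
  rw [this, finrank_top]; simp

theorem finrank_orthoDiff_of_collinear {A : Set (ℤ × ℤ)} (hA : ¬ A.Subsingleton)
    (hc : Collinear ℝ (toPlane '' A)) : Module.finrank ℝ (orthoDiff A) = 1 := by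
  rw [Set.not_subsingleton_iff] at hA
  obtain ⟨P, hP, Q, hQ, hne⟩ := hA
  rw [collinear_iff_of_mem (Set.mem_image_of_mem _ hP)] at hc
  obtain ⟨w, hw⟩ := hc
  have hw' : ∀ X ∈ A, ∃ r : ℝ, toPlane X = r • w + toPlane P := fun X hX => by
    simpa using hw _ (Set.mem_image_of_mem _ hX)
  obtain ⟨r, hr⟩ := hw' Q hQ
  have hw0 : w ≠ 0 := by
    rintro rfl
    apply hne
    apply toPlane_injective
    simpa using hr.symm
  have hr0 : r ≠ 0 := by
    rintro rfl
    apply hne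
    apply toPlane_injective
    simpa using hr.symm
  have hspan : orthoDiff A = Submodule.span ℝ {((-w.2, w.1) : ℝ × ℝ)} := by
    ext v
    rw [mem_orthoDiff, Submodule.mem_span_singleton]
    constructor
    · intro hv
      have h1 := hv Q hQ P hP
      rw [hr] at h1
      simp only [dot, Prod.fst_sub, Prod.snd_sub, Prod.fst_add, Prod.snd_add, Prod.smul_fst,
        Prod.smul_snd, smul_eq_mul] at h1
      have h2 : v.1 * w.1 + v.2 * w.2 = 0 := by
        have : r * (v.1 * w.1 + v.2 * w.2) = 0 := by linear_combination h1
        exact (mul_eq_zero.1 this).resolve_left hr0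
      have hn : w.1 ^ 2 + w.2 ^ 2 ≠ 0 := by
        intro h0
        apply hw0
        have a1 : w.1 = 0 := by nlinarith [sq_nonneg w.1, sq_nonneg w.2]
        have a2 : w.2 = 0 := by nlinarith [sq_nonneg w.1, sq_nonneg w.2]
        exact Prod.ext a1 a2
      refine ⟨(v.2 * w.1 - v.1 * w.2) / (w.1 ^ 2 + w.2 ^ 2), ?_⟩
      apply Prod.ext
      · simp only [Prod.smul_fst, smul_eq_mul]
        field_simp
        linear_combination (-w.1) * h2
      · simp only [Prod.smul_snd, smul_eq_mul]
        field_simp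
        linear_combination (-w.2) * h2
    · rintro ⟨c, rfl⟩ X hX Y hY
      obtain ⟨a, ha⟩ := hw' X hX
      obtain ⟨b, hb⟩ := hw' Y hY
      rw [ha, hb]
      simp only [dot, Prod.fst_sub, Prod.snd_sub, Prod.fst_add, Prod.snd_add, Prod.smul_fst,
        Prod.smul_snd, smul_eq_mul]
      ring
  rw [hspan, finrank_span_singleton]
  intro h0
  apply hw0
  have a1 := congrArg Prod.fst h0
  have a2 := congrArg Prod.snd h0
  simp only [Prod.fst_zero, Prod.snd_zero, neg_eq_zero] at a1 a2
  exact Prod.ext a2 a1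

theorem finrank_orthoDiff_of_not_collinear {A : Set (ℤ × ℤ)}
    (hc : ¬ Collinear ℝ (toPlane '' A)) : Module.finrank ℝ (orthoDiff A) = 0 := by
  have hbot : orthoDiff A = ⊥ := by
    rw [eq_bot_iff]
    intro v hv
    rw [Submodule.mem_bot]
    by_contra hv0
    apply hc
    have hn : v.1 ^ 2 + v.2 ^ 2 ≠ 0 := by
      intro h0
      apply hv0
      have a1 : v.1 = 0 := by nlinarith [sq_nonneg v.1, sq_nonneg v.2]
      have a2 : v.2 = 0 := by nlinarith [sq_nonneg v.1, sq_nonneg v.2]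
      exact Prod.ext a1 a2
    rcases A.eq_empty_or_nonempty with rfl | ⟨P, hP⟩
    · simp [collinear_empty]
    rw [collinear_iff_of_mem (Set.mem_image_of_mem _ hP)]
    refine ⟨(-v.2, v.1), ?_⟩
    rintro _ ⟨X, hX, rfl⟩
    have h2 := hv X hX P hP
    simp only [dot, Prod.fst_sub, Prod.snd_sub] at h2
    refine ⟨(((toPlane X).2 - (toPlane P).2) * v.1 - ((toPlane X).1 - (toPlane P).1) * v.2) /
      (v.1 ^ 2 + v.2 ^ 2), ?_⟩
    rw [vadd_eq_add]
    apply Prod.ext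
    · simp only [Prod.fst_add, Prod.smul_fst, smul_eq_mul]
      field_simp
      linear_combination (v.1) * h2
    · simp only [Prod.snd_add, Prod.smul_snd, smul_eq_mul]
      field_simp
      linear_combination (v.2) * h2
  rw [hbot, finrank_bot]

/-- The lengths of the classes of concatenated edges. -/
noncomputable def classLength (T : Finset (Finset (ℤ × ℤ))) {m : ℕ} (cls : Finset (ℤ × ℤ) → Fin m) :
    (ℤ × ℤ → ℝ) →ₗ[ℝ] (Fin m → ℝ) :=
  LinearMap.pi fun j => ∑ e ∈ (coreEdges T).filter (fun e => cls e = j), edgeLength T e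

theorem classLength_apply (T : Finset (Finset (ℤ × ℤ))) {m : ℕ} (cls : Finset (ℤ × ℤ) → Fin m)
    (ω : ℤ × ℤ → ℝ) (j : Fin m) : classLength T cls ω j =
      ∑ e ∈ (coreEdges T).filter (fun e => cls e = j), edgeLength T e ω := by
  simp [classLength]

/-! ### The rank of the skeleton lengths. -/

section

variable {Δ : Set (ℝ × ℝ)} {T : Finset (Finset (ℤ × ℤ))}

/-- The extension of a motion of the interior vertices by zero. -/
noncomputable def extendInner (Δ : Set (ℝ × ℝ)) (T : Finset (Finset (ℤ × ℤ))) :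
    (inner Δ T → ℝ × ℝ) →ₗ[ℝ] (ℤ × ℤ → ℝ × ℝ) where
  toFun u X := if hX : X ∈ inner Δ T then u ⟨X, hX⟩ else 0
  map_add' u v := by ext1 X; by_cases hX : X ∈ inner Δ T <;> simp [hX]
  map_smul' c u := by ext1 X; by_cases hX : X ∈ inner Δ T <;> simp [hX]

theorem extendInner_of_notMem (h : IsAdmissible Δ T) (u : inner Δ T → ℝ × ℝ) (X : ℤ × ℤ)
    (hX : X ∉ interiorPts Δ) : extendInner Δ T u X = 0 := by
  simp [extendInner, mem_inner h, hX]

theorem extendInner_coe (u : inner Δ T → ℝ × ℝ) (X : inner Δ T) :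
    extendInner Δ T u X = u X := by
  simp [extendInner]

/-- The stresses on the bounded edges caused by a motion of the interior vertices. -/
noncomputable def stressMap (Δ : Set (ℝ × ℝ)) (T : Finset (Finset (ℤ × ℤ))) :
    (inner Δ T → ℝ × ℝ) →ₗ[ℝ] (boundedEdges T → ℝ) where
  toFun u e := stress (extendInner Δ T u) e
  map_add' u v := by
    ext1 e
    simp only [stress, map_add, Pi.add_apply, dot, Prod.fst_add, Prod.snd_add,
      ← Finset.sum_add_distrib]
    exact Finset.sum_congr rfl fun _ _ => by ring
  map_smul' c u := by
    ext1 e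
    simp only [stress, map_smul, Pi.smul_apply, dot, Prod.smul_fst, Prod.smul_snd, smul_eq_mul,
      Finset.mul_sum, RingHom.id_apply]
    exact Finset.sum_congr rfl fun _ _ => by ring

theorem stressMap_injective (h : IsAdmissible Δ T) {ω₀ : ℤ × ℤ → ℝ} (hω₀ : Supports T ω₀) :
    Function.Injective (stressMap Δ T) := by
  rw [injective_iff_map_eq_zero]
  intro u hu
  ext1 X
  rw [← extendInner_coe u X]
  refine eq_zero_of_stress h hω₀ (extendInner_of_notMem h u) (fun e he => ?_) ?_
  · exact congrFun hu ⟨e, he⟩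
  · exact (mem_verts_iff h).2 (interior_subset ((mem_inner h).1 X.2))

/-- All edge lengths. -/
noncomputable def lengthMap (T : Finset (Finset (ℤ × ℤ))) :
    (ℤ × ℤ → ℝ) →ₗ[ℝ] (boundedEdges T → ℝ) := LinearMap.pi fun e => edgeLength T e

-- Heights with all edge lengths zero are determined by their values on one triangle, so the kernel
-- on the vertices has dimension at most 3; the rest is the count of edges and vertices.
open Module in
theorem le_finrank_range_lengthMap (h : IsAdmissible Δ T) {ω₀ : ℤ × ℤ → ℝ} (hω₀ : Supports T ω₀) :
    (boundedEdges T).card ≤ finrank ℝ (LinearMap.range (lengthMap T)) + 2 * (inner Δ T).card := by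
  classical
  let ext : (verts T → ℝ) →ₗ[ℝ] (ℤ × ℤ → ℝ) :=
    { toFun := fun u X => if hX : X ∈ verts T then u ⟨X, hX⟩ else 0
      map_add' := fun u v => by ext1 X; by_cases hX : X ∈ verts T <;> simp [hX]
      map_smul' := fun c u => by ext1 X; by_cases hX : X ∈ verts T <;> simp [hX] }
  have hext : ∀ u (X : verts T), ext u X = u X := fun u X => by simp [ext]
  set D := (lengthMap T).comp ext with hD
  have hrn := D.finrank_range_add_finrank_ker
  rw [Module.finrank_pi, Fintype.card_coe] at hrn
  have hle : finrank ℝ (LinearMap.range D) ≤ finrank ℝ (LinearMap.range (lengthMap T)) :=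
    Submodule.finrank_mono (LinearMap.range_comp_le_range _ _)
  have hker : finrank ℝ (LinearMap.ker D) ≤ 3 := by
    obtain ⟨P, hP⟩ := interiorPts_nonempty h
    obtain ⟨t, ht, -⟩ := Finset.mem_biUnion.1 ((mem_verts_iff h).2 (interior_subset hP))
    obtain ⟨A, B, C, hABC, rfl⟩ := exists_tri h.tri ht
    have hsub : ∀ X ∈ ({A, B, C} : Finset (ℤ × ℤ)), X ∈ verts T :=
      fun X hX => Finset.mem_biUnion.2 ⟨_, ht, hX⟩
    let ev : LinearMap.ker D →ₗ[ℝ] (({A, B, C} : Finset (ℤ × ℤ)) → ℝ) :=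
      (LinearMap.pi fun X => LinearMap.proj (⟨X.1, hsub X.1 X.2⟩ : verts T)).comp
        (LinearMap.ker D).subtype
    have hinj : Function.Injective ev := by
      rw [injective_iff_map_eq_zero]
      rintro ⟨u, hu⟩ h0
      apply Subtype.ext
      ext1 X
      refine (hext u X).symm.trans ?_
      refine eq_zero_of_edgeLength h hω₀ (fun e he => ?_) ht (fun Y hY => ?_) X.2
      · exact congrFun (LinearMap.mem_ker.1 hu) ⟨e, he⟩
      · have := congrFun h0 ⟨Y, hY⟩
        rw [hext u ⟨Y, hsub Y hY⟩]
        exact this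
    have := LinearMap.finrank_le_finrank_of_injective hinj
    rw [Module.finrank_pi, Fintype.card_coe] at this
    exact this.trans Finset.card_le_three
  have h1 := (card_boundedEdges h).1
  have h2 := card_verts (Δ := Δ) (T := T)
  omega

open Module in
/-- The relations between the edge lengths are the stresses. -/
theorem mem_range_stressMap_iff (h : IsAdmissible Δ T) {ω₀ : ℤ × ℤ → ℝ} (hω₀ : Supports T ω₀)
    (y : boundedEdges T → ℝ) :
    y ∈ LinearMap.range (stressMap Δ T) ↔ ∀ ω, ∑ e, y e * edgeLength T e ω = 0 := by
  let N : Submodule ℝ (boundedEdges T → ℝ) :=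
    { carrier := {y | ∀ ω, ∑ e, y e * edgeLength T e ω = 0}
      zero_mem' := by intro ω; simp
      add_mem' := by
        intro a b ha hb ω
        simp only [Pi.add_apply, add_mul, Finset.sum_add_distrib, ha ω, hb ω, add_zero]
      smul_mem' := by
        intro c a ha ω
        simp only [Pi.smul_apply, smul_eq_mul, mul_assoc, ← Finset.mul_sum, ha ω, mul_zero] }
  have hN := finrank_perp (LinearMap.range (lengthMap T)) N (by
    intro y
    constructor
    · rintro hy _ ⟨ω, rfl⟩; exact hy ω
    · intro hy ω; exact hy _ ⟨ω, rfl⟩)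
  have hle : LinearMap.range (stressMap Δ T) ≤ N := by
    rintro _ ⟨u, rfl⟩ ω
    rw [← sum_stress_mul_edgeLength h (extendInner_of_notMem h u) ω]
    exact Finset.sum_coe_sort (boundedEdges T)
      (fun e => stress (extendInner Δ T u) e * edgeLength T e ω)
  have hr := LinearMap.finrank_range_of_inj (stressMap_injective h hω₀)
  have hd := le_finrank_range_lengthMap h hω₀
  rw [Module.finrank_pi_fintype] at hr
  simp only [Module.finrank_prod, Module.finrank_self, Finset.sum_const, Finset.card_univ,
    Fintype.card_coe, smul_eq_mul] at hr
  rw [Fintype.card_coe] at hN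
  -- Injectivity gives the stresses dimension `2g`, and the rank of the length map bounds the
  -- dimension of all relations by `2g`.
  have heq : LinearMap.range (stressMap Δ T) = N :=
    Submodule.eq_of_le_of_finrank_le hle (by omega)
  rw [heq]
  rfl

theorem stress_radial (h : IsAdmissible Δ T) (u : inner Δ T → ℝ × ℝ) {P Q : ℤ × ℤ}
    (hr : IsRadial Δ T P Q) : stress (extendInner Δ T u) {P, Q} =
      dot (extendInner Δ T u P) (toPlane Q - toPlane P) := by
  rw [stress_pair _ hr.1.1, extendInner_of_notMem h u Q hr.notMem, sub_zero]

-- A relation between class lengths is a relation between edge lengths that is constant on classes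
-- and vanishes off the core, that is, an element of the intersection `K` below. Described by a
-- motion `u`, such an element is one for which each `u P` is orthogonal to the differences of the
-- radial ends at `P`, with no condition linking different points.
open Module in
theorem finrank_classLength (h : IsAdmissible Δ T) {ω₀ : ℤ × ℤ → ℝ} (hω₀ : Supports T ω₀)
    {m : ℕ} {cls : Finset (ℤ × ℤ) → Fin m} (hsurj : ∀ j, ∃ e ∈ coreEdges T, cls e = j)
    (hcls : ∀ e ∈ coreEdges T, ∀ e' ∈ coreEdges T, cls e = cls e' ↔ Concatenated T e e') :
    finrank ℝ (LinearMap.range (classLength T cls)) +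
      ∑ P ∈ inner Δ T, finrank ℝ (orthoDiff (radialEnds Δ T P)) = m := by
  classical
  -- functions constant on classes and zero off the core
  let Ψ : (Fin m → ℝ) →ₗ[ℝ] (boundedEdges T → ℝ) :=
    { toFun := fun y e => if e.1 ∈ coreEdges T then y (cls e.1) else 0
      map_add' := fun y z => by ext1 e; by_cases he : e.1 ∈ coreEdges T <;> simp [he]
      map_smul' := fun c y => by ext1 e; by_cases he : e.1 ∈ coreEdges T <;> simp [he] }
  have hΨapp : ∀ y (e : boundedEdges T), Ψ y e = if e.1 ∈ coreEdges T then y (cls e.1) else 0 :=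
    fun _ _ => rfl
  have hΨinj : Function.Injective Ψ := by
    rw [injective_iff_map_eq_zero]
    intro y hy
    ext1 j
    obtain ⟨e, he, rfl⟩ := hsurj j
    have := congrFun hy ⟨e, coreEdges_subset he⟩
    rw [hΨapp] at this
    simpa [he] using this
  set K := LinearMap.range Ψ ⊓ LinearMap.range (stressMap Δ T) with hK
  have hperp := finrank_perp (LinearMap.range (classLength T cls)) (K.comap Ψ) (by
    intro y
    rw [Submodule.mem_comap, hK, Submodule.mem_inf, mem_range_stressMap_iff h hω₀]
    have key : ∀ ω, ∑ e, Ψ y e * edgeLength T e ω = ∑ j, y j * classLength T cls ω j := by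
      intro ω
      refine (Finset.sum_coe_sort (boundedEdges T)
        (fun e => (if e ∈ coreEdges T then y (cls e) else 0) * edgeLength T e ω)).trans ?_
      simp only [ite_mul, zero_mul, classLength_apply, Finset.mul_sum]
      rw [← Finset.sum_filter, Finset.filter_mem_eq_inter, Finset.inter_eq_right.2 coreEdges_subset,
        ← Finset.sum_fiberwise (coreEdges T) cls]
      apply Finset.sum_congr rfl
      intro j _
      apply Finset.sum_congr rfl
      intro e he
      rw [(Finset.mem_filter.1 he).2]
    constructor
    · rintro ⟨-, hy⟩ _ ⟨ω, rfl⟩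
      rw [← key]; exact hy ω
    · intro hy
      exact ⟨⟨y, rfl⟩, fun ω => by rw [key]; exact hy _ ⟨ω, rfl⟩⟩)
  rw [Fintype.card_fin] at hperp
  -- both preimages of `K` are isomorphic to `K`
  have hdim1 : finrank ℝ (K.comap Ψ) = finrank ℝ K := by
    have hmap : (K.comap Ψ).map Ψ = K := by
      rw [Submodule.map_comap_eq]; exact inf_eq_right.2 inf_le_left
    rw [(Submodule.equivMapOfInjective Ψ hΨinj (K.comap Ψ)).finrank_eq, hmap]
  have hdim2 : finrank ℝ (K.comap (stressMap Δ T)) = finrank ℝ K := by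
    have hmap : (K.comap (stressMap Δ T)).map (stressMap Δ T) = K := by
      rw [Submodule.map_comap_eq]; exact inf_eq_right.2 inf_le_right
    rw [(Submodule.equivMapOfInjective _ (stressMap_injective h hω₀)
      (K.comap (stressMap Δ T))).finrank_eq, hmap]
  have hmem : ∀ u, u ∈ K.comap (stressMap Δ T) ↔
      ∀ P : inner Δ T, u P ∈ orthoDiff (radialEnds Δ T P) := by
    intro u
    rw [Submodule.mem_comap, hK, Submodule.mem_inf]
    constructor
    · rintro ⟨⟨y, hy⟩, -⟩ P Q hQ Q' hQ'
      have hP := hQ.2.1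
      have val : ∀ X, IsRadial Δ T P X →
          dot (u P) (toPlane X - toPlane P) = y (cls {(P : ℤ × ℤ), X}) ∧
          {(P : ℤ × ℤ), X} ∈ coreEdges T := by
        intro X hX
        have hc := (pair_mem_coreEdges h hω₀).2 (hX.1.coreDart h hP)
        have := congrFun hy ⟨_, coreEdges_subset hc⟩
        rw [hΨapp, if_pos hc] at this
        refine ⟨?_, hc⟩
        rw [this, ← extendInner_coe u P, ← stress_radial h u hX]
        rfl
      obtain ⟨v1, c1⟩ := val Q hQ
      obtain ⟨v2, c2⟩ := val Q' hQ'
      rw [(hcls _ c1 _ c2).2 (concatenated_of_radial h hω₀ hQ hQ'), ← v2] at v1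
      simp only [dot, Prod.fst_sub, Prod.snd_sub] at v1 ⊢
      linarith
    · intro hu
      refine ⟨?_, ⟨u, rfl⟩⟩
      choose rep hrep hrepc using hsurj
      refine ⟨fun j => stress (extendInner Δ T u) (rep j), ?_⟩
      ext1 ⟨e, he⟩
      rw [hΨapp]
      change _ = stress (extendInner Δ T u) e
      by_cases hc : e ∈ coreEdges T
      · rw [if_pos hc]
        have hcc := (hcls _ (hrep (cls e)) e hc).1 (hrepc (cls e))
        rcases (concatenated_iff h hω₀).1 hcc with heq | ⟨P, Q, Q', h1, h2, h3, h4⟩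
        · rw [heq]
        · simp only
          rw [h1, h2, stress_radial h u h3, stress_radial h u h4]
          have := hu ⟨P, (mem_inner h).2 h3.2.1⟩ Q h3 Q' h4
          rw [← extendInner_coe u] at this
          simp only [dot, Prod.fst_sub, Prod.snd_sub] at this ⊢
          linarith
      · rw [if_neg hc]
        -- An edge off the core has both ends on the boundary, where the motion is zero.
        obtain ⟨P, Q, R, S, rfl, h1, h2⟩ := (mem_boundedEdges h.tri).1 he
        have hPQ : ¬ (P ∈ interiorPts Δ ∨ Q ∈ interiorPts Δ) := fun hPQ =>
          hc ((pair_mem_coreEdges h hω₀).2 (h1.coreDart h hPQ))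
        push Not at hPQ
        rw [stress_pair _ h1.ne, extendInner_of_notMem h u P hPQ.1,
          extendInner_of_notMem h u Q hPQ.2]
        simp [dot]
  let eqv : K.comap (stressMap Δ T) ≃ₗ[ℝ] ((P : inner Δ T) → orthoDiff (radialEnds Δ T P)) :=
    { toFun := fun u P => ⟨u.1 P, (hmem u.1).1 u.2 P⟩
      invFun := fun f => ⟨fun P => (f P).1, (hmem _).2 fun P => (f P).2⟩
      map_add' := fun _ _ => rfl
      map_smul' := fun _ _ => rfl
      left_inv := fun _ => rfl
      right_inv := fun _ => rfl }
  have hdim3 := eqv.finrank_eq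
  rw [Module.finrank_pi_fintype,
    Finset.sum_coe_sort (inner Δ T) (fun P => finrank ℝ (orthoDiff (radialEnds Δ T P)))] at hdim3
  omega

theorem mem_boundaryPts_interiorPolygon (h : IsAdmissible Δ T) {P : ℤ × ℤ} :
    P ∈ boundaryPts (interiorPolygon Δ) ↔
      P ∈ interiorPts Δ ∧ toPlane P ∉ interior (interiorPolygon Δ) := by
  have hfin : (interiorPts Δ).Finite := by
    have : interiorPts Δ = (inner Δ T : Set (ℤ × ℤ)) := by ext X; simp [mem_inner h]
    rw [this]; exact Finset.finite_toSet _
  have hcl : IsClosed (interiorPolygon Δ) := (isCompact_hull hfin).isClosed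
  rw [boundaryPts, Set.mem_ofPred_eq, hcl.frontier_eq, Set.mem_sdiff, mem_interiorPolygon_iff h]

theorem finite_radialEnds (P : ℤ × ℤ) : (radialEnds Δ T P).Finite := by
  apply (Finset.finite_toSet (verts T)).subset
  intro Q hQ
  obtain ⟨-, t, ht, -, hQt⟩ := hQ.1
  exact Finset.mem_coe.2 (Finset.mem_biUnion.2 ⟨t, ht, hQt⟩)

-- Radial edges are absent at interior points of the interior polygon, which contribute 2, and
-- present at its boundary points, which contribute 2, 1 or 0.
open Module in
theorem sum_finrank_orthoDiff (h : IsAdmissible Δ T) :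
    ∑ P ∈ inner Δ T, finrank ℝ (orthoDiff (radialEnds Δ T P)) =
      2 * genus (interiorPolygon Δ) + 2 * b₁ Δ T + b₂ Δ T := by
  classical
  have count : ∀ p : ℤ × ℤ → Prop, (∀ P, p P → P ∈ interiorPts Δ) →
      {P | p P}.ncard = ∑ P ∈ inner Δ T, if p P then 1 else 0 := by
    intro p hp
    rw [← Finset.card_filter, ← Set.ncard_coe_finset]
    congr 1
    ext P
    simp only [Finset.coe_filter, Set.mem_ofPred_eq, mem_inner h]
    exact ⟨fun hP => ⟨hp P hP, hP⟩, fun hP => hP.2⟩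
  have c1 := count (fun P => toPlane P ∈ interior (interiorPolygon Δ))
    (fun P hP => (mem_interiorPolygon_iff h).1 (interior_subset hP))
  have c2 := count (fun P => P ∈ boundaryPts (interiorPolygon Δ) ∧ (radialEnds Δ T P).ncard = 1)
    (fun P hP => ((mem_boundaryPts_interiorPolygon h).1 hP.1).1)
  have c3 := count (fun P => P ∈ boundaryPts (interiorPolygon Δ) ∧ 2 ≤ (radialEnds Δ T P).ncard ∧
    Collinear ℝ (toPlane '' radialEnds Δ T P))
    (fun P hP => ((mem_boundaryPts_interiorPolygon h).1 hP.1).1)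
  rw [genus, interiorPts, c1, b₁, c2, b₂, c3, Finset.mul_sum, Finset.mul_sum,
    ← Finset.sum_add_distrib, ← Finset.sum_add_distrib]
  apply Finset.sum_congr rfl
  intro P hP
  rw [mem_inner h] at hP
  have hb := mem_boundaryPts_interiorPolygon h (P := P)
  have hfin := finite_radialEnds (Δ := Δ) (T := T) P
  have : Finite (radialEnds Δ T P) := hfin
  by_cases hPi : toPlane P ∈ interior (interiorPolygon Δ)
  · have hempty : radialEnds Δ T P = ∅ :=
      Set.eq_empty_of_forall_notMem fun Q hQ => not_isRadial_of_interior h hPi hQ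
    have hPb : P ∉ boundaryPts (interiorPolygon Δ) := fun hh => (hb.1 hh).2 hPi
    rw [finrank_orthoDiff_of_subsingleton (by rw [hempty]; exact Set.subsingleton_empty)]
    simp [hPi, hPb]
  · have hPb : P ∈ boundaryPts (interiorPolygon Δ) := hb.2 ⟨hP, hPi⟩
    obtain ⟨Q, hQ⟩ := exists_isRadial h hP hPi
    have hpos : 0 < (radialEnds Δ T P).ncard := (Set.ncard_pos hfin).2 ⟨Q, hQ⟩
    by_cases hsub : (radialEnds Δ T P).Subsingleton
    · have h1 : (radialEnds Δ T P).ncard = 1 := by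
        have := (Set.ncard_le_one_iff_subsingleton).2 hsub
        omega
      rw [finrank_orthoDiff_of_subsingleton hsub]
      simp [hPi, hPb, h1]
    · have h2 : 2 ≤ (radialEnds Δ T P).ncard := by
        by_contra hlt
        exact hsub ((Set.ncard_le_one_iff_subsingleton).1 (by omega))
      have h1 : (radialEnds Δ T P).ncard ≠ 1 := by omega
      by_cases hcol : Collinear ℝ (toPlane '' radialEnds Δ T P)
      · rw [finrank_orthoDiff_of_collinear hsub hcol]
        simp [hPi, hPb, h1, h2, hcol]
      · rw [finrank_orthoDiff_of_not_collinear hcol]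
        simp [hPi, h1, hcol]

end

end TropPlane

namespace TropPlane

/-! ## Lattice lengths of the edges of the curve -/

theorem latticeLength_segment {j : ℤ × ℤ} (hj : IsCoprime j.1 j.2) (p₀ : ℝ × ℝ) {l : ℝ}
    (hl : 0 ≤ l) : latticeLength {p | ∃ s : ℝ, 0 ≤ s ∧ s ≤ l ∧ p = p₀ + s • toPlane j} = l := by
  apply IsGreatest.csSup_eq
  constructor
  · exact ⟨j, hj, p₀, ⟨0, le_rfl, hl, by simp⟩, l, hl, le_rfl, rfl⟩
  · rintro s ⟨v, hv, p, ⟨α, hα, hα', rfl⟩, β, hβ, hβ', he⟩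
    have e1 := congrArg Prod.fst he
    have e2 := congrArg Prod.snd he
    simp only [toPlane, Prod.fst_add, Prod.snd_add, Prod.smul_fst, Prod.smul_snd,
      smul_eq_mul] at e1 e2
    obtain ⟨x, y, hxy⟩ := hv
    obtain ⟨x', y', hxy'⟩ := hj
    have hxyR : (x : ℝ) * v.1 + y * v.2 = 1 := by exact_mod_cast hxy
    have hxyR' : (x' : ℝ) * j.1 + y' * j.2 = 1 := by exact_mod_cast hxy'
    set a := β - α with ha
    set k : ℤ := x * j.1 + y * j.2 with hk
    set k' : ℤ := x' * v.1 + y' * v.2 with hk'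
    -- By Bézout the parameters along the primitive vectors `v` and `j` are integral multiples of
    -- each other, so for `s ≠ 0` they agree up to sign.
    have hs : s = a * k := by
      rw [hk]; push_cast
      linear_combination (-s) * hxyR + (x : ℝ) * e1 + (y : ℝ) * e2
    have hs' : a = s * k' := by
      rw [hk']; push_cast
      linear_combination (-a) * hxyR' - (x' : ℝ) * e1 - (y' : ℝ) * e2
    have hle : |a| ≤ l := abs_le.2 ⟨by linarith, by linarith⟩
    by_cases hs0 : s = 0
    · rw [hs0]; exact hl
    · have hkk : (k' : ℝ) * k = 1 := by
        have : s * ((k' : ℝ) * k - 1) = 0 := by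
          rw [hs'] at hs; linear_combination -hs
        have := (mul_eq_zero.1 this).resolve_left hs0
        linarith
      have hkk' : k' * k = 1 := by exact_mod_cast hkk
      rcases Int.isUnit_iff.1 (IsUnit.of_mul_eq_one_right _ hkk') with h1 | h1
      · rw [hs, h1]; push_cast
        linarith [le_abs_self a]
      · rw [hs, h1]; push_cast
        linarith [neg_abs_le a]

section

variable {Δ : Set (ℝ × ℝ)} {T : Finset (Finset (ℤ × ℤ))}

theorem dualVertex_mem_dualCell (h : IsAdmissible Δ T) {ω : ℤ × ℤ → ℝ} (hω : Supports T ω)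
    {P Q R : ℤ × ℤ} (ht : Tri T P Q R) :
    dualVertex ω P Q R ∈ dualCell Δ ω (({P, Q} : Finset (ℤ × ℤ)) : Set (ℤ × ℤ)) := by
  intro X hX Y hY
  have hX' : X ∈ ({P, Q, R} : Finset (ℤ × ℤ)) := by
    simp only [Finset.coe_insert, Finset.coe_singleton, Set.mem_insert_iff,
      Set.mem_singleton_iff] at hX
    rcases hX with rfl | rfl <;> simp
  rw [monomialValue_dualVertex, monomialValue_dualVertex, interp_vertex ht.1 ω hX']
  have := hω.interp_le ht ((mem_verts_iff h).2 hY)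
  linarith

/-- Equality of the monomials at `P` and `Q` cuts out a line; `R` bounds its parameter from below
and `S` from above. Conversely, both ends are dual vertices lying in the cell, and the defining
inequalities are affine along the line. -/
theorem dualCell_edge (h : IsAdmissible Δ T) {ω : ℤ × ℤ → ℝ} (hω : Supports T ω)
    {P Q R S : ℤ × ℤ} (h1 : Tri T P Q R) (h2 : Tri T Q P S) :
    dualCell Δ ω (({P, Q} : Finset (ℤ × ℤ)) : Set (ℤ × ℤ)) =
      {p | ∃ s : ℝ, 0 ≤ s ∧ s ≤ bend P Q R S ω ∧
        p = dualVertex ω P Q R + s • toPlane (P.2 - Q.2, Q.1 - P.1)} := by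
  have hJ : toPlane (P.2 - Q.2, Q.1 - P.1) = ((P.2 : ℝ) - Q.2, (Q.1 : ℝ) - P.1) := by
    simp [toPlane]
  have d1 : ((idet P Q R : ℤ) : ℝ) = 1 := by rw [h1.1]; simp
  have d2 : ((idet Q P S : ℤ) : ℝ) = 1 := by rw [h2.1]; simp
  simp only [idet] at d1 d2; push_cast at d1 d2
  have m1 := dualVertex_mem_dualCell h hω h1
  have m2 := dualVertex_mem_dualCell h hω h2
  rw [Finset.pair_comm, dualVertex_cross h1.1 h2.1 ω, ← hJ] at m2
  have hPc : P ∈ (({P, Q} : Finset (ℤ × ℤ)) : Set (ℤ × ℤ)) := by simp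
  have hQc : Q ∈ (({P, Q} : Finset (ℤ × ℤ)) : Set (ℤ × ℤ)) := by simp
  set p₀ := dualVertex ω P Q R with hp₀
  set l := bend P Q R S ω with hl
  have hl0 : 0 < l := by
    rw [hl, bend_apply, sub_pos]
    exact hω P Q R h1 S h2.rot.rot.mem_verts (notMem_of_cross h1 h2)
  have hmove : ∀ (X : ℤ × ℤ) (s : ℝ), monomialValue ω X (p₀ + s • toPlane (P.2 - Q.2, Q.1 - P.1)) =
      monomialValue ω X p₀ + s * (X.1 * ((P.2 : ℝ) - Q.2) + X.2 * ((Q.1 : ℝ) - P.1)) := by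
    intro X s
    rw [hJ]
    simp only [monomialValue, Prod.fst_add, Prod.snd_add, Prod.smul_fst, Prod.smul_snd, smul_eq_mul]
    ring
  ext p
  constructor
  · intro hp
    have hPQ := le_antisymm (hp P hPc Q (h1.mem₂ h)) (hp Q hQc P (h1.mem₁ h))
    have hPQ' := le_antisymm (m1 P hPc Q (h1.mem₂ h)) (m1 Q hQc P (h1.mem₁ h))
    obtain ⟨s, rfl⟩ : ∃ s : ℝ, p = p₀ + s • toPlane (P.2 - Q.2, Q.1 - P.1) := by
      refine ⟨(R.1 - P.1) * (p.1 - p₀.1) + (R.2 - P.2) * (p.2 - p₀.2), ?_⟩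
      rw [hJ]
      simp only [monomialValue] at hPQ hPQ'
      apply Prod.ext
      · simp only [Prod.fst_add, Prod.smul_fst, smul_eq_mul]
        linear_combination (-(p.1 - p₀.1)) * d1 + (-((R.2 : ℝ) - P.2)) * (hPQ - hPQ')
      · simp only [Prod.snd_add, Prod.smul_snd, smul_eq_mul]
        linear_combination (-(p.2 - p₀.2)) * d1 + ((R.1 : ℝ) - P.1) * (hPQ - hPQ')
    have hR := hp P hPc R (h1.mem₃ h)
    have hS := hp P hPc S (h2.mem₃ h)
    rw [hmove, hmove, hp₀, monomialValue_dualVertex, monomialValue_dualVertex,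
      interp_vertex h1.1 ω (X := P) (by simp)] at hR hS
    rw [interp_vertex h1.1 ω (X := R) (by simp)] at hR
    rw [← bend_apply, ← hl] at hS
    refine ⟨s, ?_, ?_, rfl⟩
    -- Along the line, the monomial at `R` gains `s` relative to that at `P`; the monomial at `S`
    -- loses `s`.
    · have e : s * (R.1 * ((P.2 : ℝ) - Q.2) + R.2 * ((Q.1 : ℝ) - P.1)) -
          s * (P.1 * ((P.2 : ℝ) - Q.2) + P.2 * ((Q.1 : ℝ) - P.1)) = s := by
        linear_combination s * d1
      linarith
    · have e : s * (S.1 * ((P.2 : ℝ) - Q.2) + S.2 * ((Q.1 : ℝ) - P.1)) -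
          s * (P.1 * ((P.2 : ℝ) - Q.2) + P.2 * ((Q.1 : ℝ) - P.1)) = -s := by
        linear_combination (-s) * d2
      linarith
  · rintro ⟨s, hs, hs', rfl⟩ X hX Y hY
    have a1 := m1 X hX Y hY
    have a2 := m2 X hX Y hY
    rw [hmove, hmove] at a2
    rw [hmove, hmove]
    set u := (X.1 * ((P.2 : ℝ) - Q.2) + X.2 * ((Q.1 : ℝ) - P.1))
    set v := (Y.1 * ((P.2 : ℝ) - Q.2) + Y.2 * ((Q.1 : ℝ) - P.1))
    set x := monomialValue ω X p₀
    set y := monomialValue ω Y p₀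
    have b1 := mul_le_mul_of_nonneg_left a1 (sub_nonneg.2 hs')
    have b2 := mul_le_mul_of_nonneg_left a2 hs
    have : l * (x + s * u) ≤ l * (y + s * v) := by linarith
    exact le_of_mul_le_mul_left this hl0

theorem latticeLength_dualCell (h : IsAdmissible Δ T) {ω : ℤ × ℤ → ℝ} (hω : Supports T ω)
    {e : Finset (ℤ × ℤ)} (he : e ∈ boundedEdges T) :
    latticeLength (dualCell Δ ω (e : Set (ℤ × ℤ))) = edgeLength T e ω := by
  have hpos := edgeLength_pos h.tri hω he
  obtain ⟨P, Q, R, S, rfl, h1, h2⟩ := (mem_boundedEdges h.tri).1 he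
  rw [edgeLength_eq h.tri h1 h2] at hpos ⊢
  rw [dualCell_edge h hω h1 h2]
  refine latticeLength_segment ?_ _ hpos.le
  refine ⟨R.1 - P.1, R.2 - P.2, ?_⟩
  have := h1.1
  simp only [idet] at this
  linear_combination this

end

end TropPlane

namespace TropPlane

/-! ## The dimension of the moduli space of a triangulation -/

/-- If a simplex is covered by finitely many subspaces, then one of them contains it. -/
theorem exists_forall_mem_of_hull_subset {E ι : Type*} [AddCommGroup E] [Module ℝ E] [Finite ι]
    {k : ℕ} (p : Fin (k + 1) → E) (L : ι → Submodule ℝ E)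
    (hp : ∀ x ∈ convexHull ℝ (Set.range p), ∃ i, x ∈ L i) : ∃ i, ∀ j, p j ∈ L i := by
  -- The points of a moment curve, normalized to convex combinations. One subspace receives
  -- infinitely many of them, so a functional vanishing on it gives a polynomial with infinitely
  -- many roots whose coefficients are its values at the `p j`.
  have hcurve : ∀ t : ℕ, ∃ i, ∑ j : Fin (k + 1), ((t : ℝ) + 1) ^ (j : ℕ) • p j ∈ L i := by
    intro t
    have hpos : ∀ j : Fin (k + 1), 0 < ((t : ℝ) + 1) ^ (j : ℕ) := fun j => by positivity
    have hsum : 0 < ∑ j : Fin (k + 1), ((t : ℝ) + 1) ^ (j : ℕ) :=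
      Finset.sum_pos (fun j _ => hpos j) Finset.univ_nonempty
    obtain ⟨i, hi⟩ := hp _ (Finset.centerMass_mem_convexHull (R := ℝ) Finset.univ
      (w := fun j : Fin (k + 1) => ((t : ℝ) + 1) ^ (j : ℕ)) (fun j _ => (hpos j).le) hsum
      (fun j _ => Set.mem_range_self (f := p) j))
    refine ⟨i, ?_⟩
    have := (L i).smul_mem (∑ j : Fin (k + 1), ((t : ℝ) + 1) ^ (j : ℕ)) hi
    rwa [Finset.centerMass, smul_smul, mul_inv_cancel₀ hsum.ne', one_smul] at this
  choose f hf using hcurve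
  obtain ⟨i, hi⟩ := Finite.exists_infinite_fiber f
  refine ⟨i, fun j => ?_⟩
  rw [← Subspace.forall_mem_dualAnnihilator_apply_eq_zero_iff]
  intro φ hφ
  rw [Submodule.mem_dualAnnihilator] at hφ
  set q : Polynomial ℝ := ∑ j : Fin (k + 1), Polynomial.C (φ (p j)) * Polynomial.X ^ (j : ℕ) with hq
  have hq0 : q = 0 := by
    apply Polynomial.eq_zero_of_infinite_isRoot
    have hinf : (f ⁻¹' {i}).Infinite := Set.infinite_coe_iff.1 hi
    have hinj : Set.InjOn (fun t : ℕ => (t : ℝ) + 1) (f ⁻¹' {i}) := by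
      intro a _ b _ hab; simpa using hab
    refine (hinf.image hinj).mono ?_
    rintro _ ⟨t, ht, rfl⟩
    have h1 := hφ _ ((by rw [← (show f t = i from ht)]; exact hf t :
      ∑ j : Fin (k + 1), ((t : ℝ) + 1) ^ (j : ℕ) • p j ∈ L i))
    simp only [map_sum, map_smul, smul_eq_mul] at h1
    change Polynomial.eval _ q = 0
    rw [hq, Polynomial.eval_finsetSum, ← h1]
    exact Finset.sum_congr rfl fun j _ => by
      rw [Polynomial.eval_mul, Polynomial.eval_C, Polynomial.eval_pow, Polynomial.eval_X, mul_comm]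
  have hc : q.coeff j = φ (p j) := by
    rw [hq, Polynomial.finsetSum_coeff, Finset.sum_eq_single j]
    · simp
    · intro b _ hb
      rw [Polynomial.coeff_C_mul, Polynomial.coeff_X_pow, if_neg, mul_zero]
      exact fun hjb => hb (Fin.ext hjb.symm)
    · simp
  rw [← hc, hq0, Polynomial.coeff_zero]

theorem card_le_of_affineIndependent {m k : ℕ} {p : Fin (k + 1) → Fin m → ℝ}
    (hp : AffineIndependent ℝ p) {L : Submodule ℝ (Fin m → ℝ)} (hL : ∀ j, p j ∈ L) :
    k ≤ Module.finrank ℝ L := by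
  rw [← hp.finrank_vectorSpan (n := k) (by simp)]
  apply Submodule.finrank_mono
  rw [vectorSpan_def, Submodule.span_le]
  rintro _ ⟨_, ⟨a, rfl⟩, _, ⟨b, rfl⟩, rfl⟩
  exact L.sub_mem (hL a) (hL b)

/-- An isomorphism matches the edges of nonzero length; the remaining edges have length 0 on both
sides and may be matched arbitrarily. -/
theorem exists_perm_of_iso {g : ℕ} {x y : LengthGraph g} (h : LengthGraph.Iso x y) :
    ∃ π : Equiv.Perm (Fin (3 * g - 3)), ∀ e, y.2 (π e) = x.2 e := by
  classical
  obtain ⟨-, σ, hσ, -⟩ := h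
  let σ' : {e // x.2 e ≠ 0} ≃ {e // y.2 e ≠ 0} := σ
  refine ⟨σ'.extendSubtype, fun e => ?_⟩
  by_cases he : x.2 e ≠ 0
  · rw [Equiv.extendSubtype_apply_of_mem σ' e he]
    exact hσ ⟨e, he⟩
  · have := Equiv.extendSubtype_not_mem σ' e he
    rw [not_ne_iff] at he this
    rw [he, this]

/-- The length graphs whose lengths lie in `L` after a permutation of the edges. -/
def permuted {g : ℕ} (L : Submodule ℝ (Fin (3 * g - 3) → ℝ)) : Set (LengthGraph g) :=
  {x | ∃ π : Equiv.Perm (Fin (3 * g - 3)), (fun j => (x.2 (π j) : ℝ)) ∈ L}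

theorem permuted_of_iso {g : ℕ} {L : Submodule ℝ (Fin (3 * g - 3) → ℝ)} {x y : LengthGraph g}
    (h : LengthGraph.Iso x y) (hx : x ∈ permuted L) : y ∈ permuted L := by
  obtain ⟨τ, hτ⟩ := exists_perm_of_iso h
  obtain ⟨π, hπ⟩ := hx
  refine ⟨π.trans τ, ?_⟩
  convert hπ using 2
  rw [Equiv.trans_apply, hτ]

theorem isClosed_permuted {g : ℕ} (L : Submodule ℝ (Fin (3 * g - 3) → ℝ)) :
    IsClosed (permuted L) := by
  rw [isClosed_sigma_iff]
  intro G
  have : (fun ℓ : Fin (3 * g - 3) → ℝ≥0 => (⟨G, ℓ⟩ : LengthGraph g)) ⁻¹' permuted L =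
      ⋃ π : Equiv.Perm (Fin (3 * g - 3)), (fun ℓ j => (ℓ (π j) : ℝ)) ⁻¹' (L : Set _) := by
    ext ℓ; simp [permuted]
  refine this ▸ ?_
  refine isClosed_iUnion_of_finite fun π => ?_
  exact (Submodule.closed_of_finiteDimensional L).preimage (by fun_prop)

/-- The set `permuted L` is closed and saturated under isomorphism, so its image is closed in the
quotient. -/
theorem isClosed_image_permuted {g : ℕ} (L : Submodule ℝ (Fin (3 * g - 3) → ℝ)) :
    IsClosed (Quotient.mk (LengthGraph.setoid g) '' permuted L) := by
  rw [← isQuotientMap_quotient_mk'.isClosed_preimage]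
  convert isClosed_permuted L using 1
  ext x
  constructor
  · rintro ⟨y, hy, he⟩
    exact permuted_of_iso (Quotient.exact he) hy
  · intro hx; exact ⟨x, hx, rfl⟩

theorem exists_perm_of_labels {α : Type*} {m : ℕ} {s : Set α} {c c' : α → Fin m}
    (hc : ∀ j, ∃ e ∈ s, c e = j) (hcc : ∀ e ∈ s, ∀ e' ∈ s, c e = c e' ↔ c' e = c' e') :
    ∃ π : Equiv.Perm (Fin m), ∀ e ∈ s, c' e = π (c e) := by
  choose r hr hrc using hc
  have key : ∀ e ∈ s, c' e = c' (r (c e)) := fun e he =>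
    (hcc e he _ (hr _)).1 (hrc (c e)).symm
  have hinj : Function.Injective fun j => c' (r j) := by
    intro i j hij
    have := (hcc _ (hr i) _ (hr j)).2 hij
    rwa [hrc, hrc] at this
  exact ⟨Equiv.ofBijective _ (Finite.injective_iff_bijective.1 hinj), key⟩

/-! ### The lengths realized by the cone of heights, and the dimension. -/

section

variable {Δ : Set (ℝ × ℝ)} {T : Finset (Finset (ℤ × ℤ))}

theorem sum_latticeLength (h : IsAdmissible Δ T) {ω : ℤ × ℤ → ℝ} (hω : Supports T ω) {m : ℕ}
    (cls : Finset (ℤ × ℤ) → Fin m) (j : Fin m) :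
    ∑ e ∈ (coreEdges T).filter (fun e => cls e = j), latticeLength (dualCell Δ ω (e : Set (ℤ × ℤ)))
      = classLength T cls ω j := by
  rw [classLength_apply]
  exact Finset.sum_congr rfl fun e he =>
    latticeLength_dualCell h hω (coreEdges_subset (Finset.mem_filter.1 he).1)

theorem classLength_nonneg (h : IsAdmissible Δ T) {ω : ℤ × ℤ → ℝ} (hω : Supports T ω) {m : ℕ}
    (cls : Finset (ℤ × ℤ) → Fin m) (j : Fin m) : 0 ≤ classLength T cls ω j := by
  rw [classLength_apply]
  exact Finset.sum_nonneg fun e he =>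
    (edgeLength_pos h.tri hω (coreEdges_subset (Finset.mem_filter.1 he).1)).le

/-- The cone of heights is given by finitely many strict linear inequalities, whence its convexity
and its openness along lines. -/
theorem supports_iff {ω : ℤ × ℤ → ℝ} : Supports T ω ↔ ∀ d ∈ triples T, ∀ S ∈ verts T,
    S ∉ ({d.1, d.2.1, d.2.2} : Finset (ℤ × ℤ)) → 0 < bend d.1 d.2.1 d.2.2 S ω := by
  constructor
  · rintro hω ⟨P, Q, R⟩ hd S hS hSt
    rw [bend_apply, sub_pos]
    exact hω P Q R (mem_triples.1 hd) S hS hSt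
  · intro hω P Q R ht S hS hSt
    have := hω (P, Q, R) (mem_triples.2 ht) S hS hSt
    rwa [bend_apply, sub_pos] at this

theorem convex_supports : Convex ℝ {ω | Supports T ω} := by
  intro ω hω η hη a b ha hb hab
  rw [Set.mem_ofPred_eq, supports_iff] at *
  intro d hd S hS hSt
  have h1 := hω d hd S hS hSt
  have h2 := hη d hd S hS hSt
  rw [map_add, map_smul, map_smul, smul_eq_mul, smul_eq_mul]
  rcases eq_or_lt_of_le ha with rfl | ha'
  · have : b = 1 := by linarith
    subst this; simpa using h2
  · have := mul_pos ha' h1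
    have := mul_nonneg hb h2.le
    linarith

open Filter Topology in
theorem eventually_supports {ω : ℤ × ℤ → ℝ} (hω : Supports T ω) (η : ℤ × ℤ → ℝ) :
    ∀ᶠ ε : ℝ in 𝓝[>] 0, Supports T (ω + ε • η) := by
  simp only [supports_iff]
  rw [Finset.eventually_all]
  intro d hd
  rw [Finset.eventually_all]
  intro S hS
  by_cases hSt : S ∈ ({d.1, d.2.1, d.2.2} : Finset (ℤ × ℤ))
  · simp [hSt]
  · have h1 := supports_iff.1 hω d hd S hS hSt
    have hc : Continuous fun ε : ℝ => bend d.1 d.2.1 d.2.2 S (ω + ε • η) := by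
      simp only [map_add, map_smul, smul_eq_mul]; fun_prop
    have : ∀ᶠ ε : ℝ in 𝓝 0, 0 < bend d.1 d.2.1 d.2.2 S (ω + ε • η) :=
      (isOpen_Ioi.preimage hc).mem_nhds (by simpa using h1)
    filter_upwards [nhdsWithin_le_nhds this] with ε hε _ using hε

/-- The moduli space of a regular triangulation has the dimension of the space of the lengths of
the skeletons. -/
theorem hasDim_of_combinatorial_type (h : IsAdmissible Δ T) {ω₀ : ℤ × ℤ → ℝ} (hω₀ : Supports T ω₀)
    {vert : Fin (2 * genus Δ - 2) → Finset (ℤ × ℤ)}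
    {cls : Finset (ℤ × ℤ) → Fin (3 * genus Δ - 3)} {G : TrivalentGraph (genus Δ)}
    (hvert : Set.BijOn vert Set.univ {t | t ∈ T ∧ coreDegree T t = 3})
    (hsurj : ∀ j, ∃ e ∈ coreEdges T, cls e = j)
    (hcls : ∀ e ∈ coreEdges T, ∀ e' ∈ coreEdges T, cls e = cls e' ↔ Concatenated T e e')
    (hends : ∀ i j, ((coreEdges T).filter fun e => e ⊆ vert i ∧ cls e = j).card
      = endCount (G.ends j) i) :
    HasDim (moduliOf Δ T) (Module.finrank ℝ (LinearMap.range (classLength T cls))) := by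
  set L := LinearMap.range (classLength T cls) with hL
  constructor
  · refine ⟨Module.finrank ℝ L, ⟨G, ?_⟩, rfl⟩
    let b := Module.finBasis ℝ L
    choose η hη using fun i => (b i).2
    obtain ⟨ε, hε, hε0⟩ := ((Filter.eventually_all.2 fun i =>
      eventually_supports hω₀ (η i)).and self_mem_nhdsWithin).exists
    replace hε0 : 0 < ε := hε0
    -- Small perturbations of `ω₀` by heights over a basis of `L`; their lengths span a simplex of
    -- full dimension in `L`.
    let w : Fin (Module.finrank ℝ L + 1) → ℤ × ℤ → ℝ := Fin.cons ω₀ fun i => ω₀ + ε • η i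
    have hw : ∀ i, Supports T (w i) := by
      intro i
      refine Fin.cases ?_ (fun i => ?_) i
      · exact hω₀
      · exact hε i
    refine ⟨fun i => classLength T cls (w i), ?_, ?_⟩
    · rw [affineIndependent_iff_linearIndependent_vsub ℝ _ 0]
      have hli : LinearIndependent ℝ fun i => ε • ((b i : L) : Fin (3 * genus Δ - 3) → ℝ) := by
        have h1 : LinearIndependent ℝ fun i => ((b i : L) : Fin (3 * genus Δ - 3) → ℝ) :=
          b.linearIndependent.map' L.subtype L.ker_subtype
        exact h1.units_smul fun _ => Units.mk0 ε hε0.ne'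
      have := hli.comp (fun x : {x : Fin (Module.finrank ℝ L + 1) // x ≠ 0} => x.1.pred x.2)
        (fun x y hxy => Subtype.ext (Fin.pred_inj.1 hxy))
      have hfun : ∀ x : {x : Fin (Module.finrank ℝ L + 1) // x ≠ 0},
          classLength T cls (w x) -ᵥ classLength T cls (w 0) =
            ε • ((b (x.1.pred x.2) : L) : Fin (3 * genus Δ - 3) → ℝ) := ?_
      · exact (funext hfun) ▸ this
      rintro ⟨x, hx⟩
      obtain ⟨i, rfl⟩ := Fin.exists_succ_eq.2 hx
      simp only [Fin.pred_succ, vsub_eq_sub, w, Fin.cons_succ, Fin.cons_zero,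
        map_add, map_smul, hη, add_sub_cancel_left]
    · have hsub : convexHull ℝ (Set.range fun i => classLength T cls (w i)) ⊆
          classLength T cls '' {ω | Supports T ω} := by
        apply convexHull_min
        · rintro _ ⟨i, rfl⟩; exact ⟨w i, hw i, rfl⟩
        · exact convex_supports.linear_image _
      refine hsub.trans ?_
      rintro _ ⟨ω, hω, rfl⟩
      refine ⟨fun j => ⟨classLength T cls ω j, classLength_nonneg h hω cls j⟩, ?_, rfl⟩
      apply subset_closure
      refine ⟨ω, induces_of_supports h hω, _, ⟨vert, cls, hvert, hsurj, hcls, hends, ?_⟩, rfl⟩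
      intro j
      rw [sum_latticeLength h hω]
      rfl
  · rintro _ ⟨k, ⟨G', p, hp, hsub⟩, rfl⟩
    -- All skeletons have lengths in `L` up to the labelling of the edges, and this closed condition
    -- survives the closure.
    have hX : moduliOf Δ T ⊆ Quotient.mk (LengthGraph.setoid (genus Δ)) '' permuted L := by
      apply closure_minimal _ (isClosed_image_permuted L)
      rintro _ ⟨ω, hω, x, ⟨vert', cls', -, -, hcls', -, hlen⟩, rfl⟩
      have hω' := supports_of_induces h hω
      refine ⟨x, ?_, rfl⟩
      obtain ⟨π, hπ⟩ := exists_perm_of_labels (s := (coreEdges T : Set (Finset (ℤ × ℤ))))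
        (c := cls) (c' := cls') hsurj
        (fun e he e' he' => (hcls e he e' he').trans (hcls' e he e' he').symm)
      refine ⟨π, ω, ?_⟩
      ext1 j
      rw [hlen, sum_latticeLength h hω', classLength_apply, classLength_apply]
      apply Finset.sum_congr _ fun _ _ => rfl
      apply Finset.filter_congr
      intro e he
      rw [hπ e he, π.apply_eq_iff_eq]
    obtain ⟨π, hπ⟩ := exists_forall_mem_of_hull_subset p
      (fun π : Equiv.Perm (Fin (3 * genus Δ - 3)) => L.comap (LinearMap.funLeft ℝ ℝ π)) (by
        intro y hy
        obtain ⟨ℓ, hℓ, rfl⟩ := hsub hy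
        obtain ⟨x, hx, he⟩ := hX hℓ
        obtain ⟨π, hπ⟩ := permuted_of_iso (Quotient.exact he) hx
        exact ⟨π, hπ⟩)
    have hk := card_le_of_affineIndependent hp hπ
    have hd : Module.finrank ℝ (L.comap (LinearMap.funLeft ℝ ℝ π)) ≤ Module.finrank ℝ L := by
      have hinj : Function.Injective (LinearMap.funLeft ℝ ℝ π) :=
        LinearMap.funLeft_injective_of_surjective _ _ _ π.surjective
      rw [(Submodule.equivMapOfInjective _ hinj _).finrank_eq]
      exact Submodule.finrank_mono (Submodule.map_comap_le _ _)
    simp only [Nat.cast_le]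
    exact hk.trans hd

/-- The dimension of the moduli space of a regular unimodular triangulation. -/
theorem hasDim_moduliOf (h : IsAdmissible Δ T) (hreg : IsRegularTriangulation Δ T) :
    HasDim (moduliOf Δ T)
      (3 * (genus Δ : ℤ) - 3 - 2 * (genus (interiorPolygon Δ) : ℤ)
        - 2 * (b₁ Δ T : ℤ) - (b₂ Δ T : ℤ)) := by
  obtain ⟨ω, hω⟩ := hreg
  have hω' := supports_of_induces h hω
  obtain ⟨vert, cls, G, h1, h2, h3, h4⟩ := exists_combinatorial_type h hω' (genus_eq_card h)
  have key := hasDim_of_combinatorial_type h hω' h1 h2 h3 h4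
  have hd := finrank_classLength h hω' h2 h3
  rw [sum_finrank_orthoDiff h] at hd
  have hg := two_le_genus h
  rw [← genus_eq_card h] at hg
  convert key using 1
  omega

end

end TropPlane

namespace TropPlane

/-! ## Honeycomb triangulations -/

/-- The six edge directions of a honeycomb triangulation. -/
def hexDirs : Finset (ℤ × ℤ) := {(1, 0), (0, 1), (-1, 1), (-1, 0), (0, -1), (1, -1)}

/-- The rotation of the six directions. -/
def hexRot (d : ℤ × ℤ) : ℤ × ℤ := (-d.2, d.1 + d.2)

theorem neg_mem_hexDirs : ∀ d ∈ hexDirs, -d ∈ hexDirs := by decide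

theorem exists_iterate_hexRot : ∀ d ∈ hexDirs, ∀ d' ∈ hexDirs, ∃ n < 6, hexRot^[n] d = d' := by
  decide

theorem idet_hexDirs : ∀ e ∈ hexDirs, ∀ d ∈ hexDirs, -1 ≤ idet 0 e d ∧ idet 0 e d ≤ 1 := by decide

theorem eq_of_idet_hexDirs : ∀ e ∈ hexDirs, ∀ d ∈ hexDirs, idet 0 e d = -1 →
    d = -hexRot e ∨ d = -hexRot e + e := by decide

theorem idet_neg_hexRot : ∀ e ∈ hexDirs, -hexRot e ∈ hexDirs ∧ -hexRot e + e ∈ hexDirs ∧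
    idet 0 e (-hexRot e) = -1 ∧ idet 0 e (-hexRot e + e) = -1 := by decide

theorem eq_or_neg_of_idet_hexDirs : ∀ e ∈ hexDirs, ∀ e' ∈ hexDirs, idet 0 e e' = 0 →
    e' = e ∨ e' = -e := by decide

theorem idet_sub (v P Q R : ℤ × ℤ) : idet (P - v) (Q - v) (R - v) = idet P Q R := by
  simp only [idet, Prod.fst_sub, Prod.snd_sub]; ring

theorem idet_add_left (P d X : ℤ × ℤ) : idet P (P + d) X = idet 0 d (X - P) := by
  simp only [idet, Prod.fst_sub, Prod.snd_sub, Prod.fst_add, Prod.snd_add, Prod.fst_zero,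
    Prod.snd_zero]
  ring

theorem hex_triangle : ∀ s ∈ ({{0, (1, 0), (0, 1)}, {0, (-1, 0), (0, -1)}} :
    Finset (Finset (ℤ × ℤ))), ∀ p ∈ s, ∀ q ∈ s, ∀ r ∈ s, idet p q r = 1 →
      q - p ∈ hexDirs ∧ r - p = hexRot (q - p) := by decide

section

variable {Δ : Set (ℝ × ℝ)} {T : Finset (Finset (ℤ × ℤ))}

theorem Tri.hex (hH : IsHoneycomb T) {P Q R : ℤ × ℤ} (ht : Tri T P Q R) :
    Q - P ∈ hexDirs ∧ R - P = hexRot (Q - P) := by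
  obtain ⟨v, hv⟩ := hH _ ht.2
  have key : ∃ s ∈ ({{0, (1, 0), (0, 1)}, {0, (-1, 0), (0, -1)}} :
      Finset (Finset (ℤ × ℤ))), ∀ X ∈ ({P, Q, R} : Finset (ℤ × ℤ)), X - v ∈ s := by
    rcases hv with hv | hv
    · refine ⟨_, Finset.mem_insert_self _ _, fun X hX => ?_⟩
      rw [hv] at hX
      simp only [Finset.mem_insert, Finset.mem_singleton] at hX
      rcases hX with rfl | rfl | rfl <;> simp
    · refine ⟨_, Finset.mem_insert_of_mem (Finset.mem_singleton_self _), fun X hX => ?_⟩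
      rw [hv] at hX
      simp only [Finset.mem_insert, Finset.mem_singleton] at hX
      rcases hX with rfl | rfl | rfl <;> simp
  obtain ⟨s, hs, hX⟩ := key
  have := hex_triangle s hs (P - v) (hX P (by simp)) (Q - v) (hX Q (by simp)) (R - v)
    (hX R (by simp)) (by rw [idet_sub]; exact ht.1)
  simpa using this

/-- An interior vertex of a honeycomb triangulation has six neighbours. -/
theorem hex_star (h : IsAdmissible Δ T) (hH : IsHoneycomb T) {P : ℤ × ℤ} (hP : P ∈ interiorPts Δ)
    {d : ℤ × ℤ} (hd : d ∈ hexDirs) : Tri T P (P + d) (P + hexRot d) := by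
  obtain ⟨t, ht, hPt⟩ := Finset.mem_biUnion.1 ((mem_verts_iff h).2 (interior_subset hP))
  obtain ⟨Q, R, hQR, -⟩ := exists_tri_of_mem h.tri ht hPt
  have step : ∀ {Q R : ℤ × ℤ}, Tri T P Q R → Tri T P (P + (Q - P)) (P + hexRot (Q - P)) := by
    intro Q R hQR
    rw [← (hQR.hex hH).2]
    simpa using hQR
  -- Turning around `P` from neighbour to neighbour realizes all six directions.
  have hall : ∀ n, Tri T P (P + hexRot^[n] (Q - P)) (P + hexRot (hexRot^[n] (Q - P))) := by
    intro n
    induction n with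
    | zero => exact step hQR
    | succ n ih =>
      obtain ⟨S, hS⟩ := exists_neighbour_of_inner h ih.rot.rot (Or.inr hP)
      have := step hS
      rw [add_sub_cancel_left] at this
      rwa [Function.iterate_succ_apply']
  obtain ⟨n, -, rfl⟩ := exists_iterate_hexRot _ (hQR.hex hH).1 d hd
  exact hall n

/-- A neighbour of an interior point that is not an interior point lies beyond an edge of the
interior polygon. -/
theorem exists_active (h : IsAdmissible Δ T) (hH : IsHoneycomb T) {P d : ℤ × ℤ}
    (hP : P ∈ interiorPts Δ) (hd : d ∈ hexDirs) (hn : P + d ∉ interiorPts Δ) :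
    ∃ e ∈ hexDirs, idet 0 e d = -1 ∧ ∀ X ∈ interiorPts Δ, 0 ≤ idet P (P + e) X := by
  have hmem := (hex_star h hH hP hd).mem₂ h
  obtain ⟨Q, R, ht, hside⟩ := exists_boundary_edge h hmem hn
  have he := (ht.hex hH).1
  set e := Q - (P + d) with hed
  have hQ : Q = P + d + e := by rw [hed]; abel
  -- Interior points have lattice distance at least 1 from the boundary edge at `P + d`. `P` has
  -- distance at most 1, hence exactly 1, and all interior points are at least as far.
  have hpos : ∀ X ∈ interiorPts Δ, 1 ≤ idet 0 e (X - P) - idet 0 e d := by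
    intro X hX
    have hX0 : 0 ≤ idet (P + d) Q X := by
      have := hside _ (interior_subset hX)
      rw [side_toPlane] at this
      exact_mod_cast this
    have hX1 : idet (P + d) Q X ≠ 0 := by
      intro h0
      obtain ⟨ε, hε, hm⟩ := exists_add_smul_mem_interior hX (toPlane (P + d) - toPlane R)
      have := hside _ (interior_subset hm)
      have e0 : side (P + d) Q (toPlane X) = 0 := by rw [side_toPlane, h0]; simp
      have e1 : side (P + d) Q (toPlane R) = 1 := by rw [side_toPlane, ht.1]; simp
      have e2 : side (P + d) Q (toPlane X + ε • (toPlane (P + d) - toPlane R)) =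
          side (P + d) Q (toPlane X) - ε * side (P + d) Q (toPlane R) := by
        simp only [side, toPlane, Prod.fst_add, Prod.snd_add, Prod.smul_fst, Prod.smul_snd,
          smul_eq_mul, Prod.fst_sub, Prod.snd_sub]
        push_cast
        ring
      rw [e2, e0, e1] at this
      linarith
    have hX2 : idet (P + d) Q X = idet 0 e (X - P) - idet 0 e d := by
      rw [hQ, idet_add_left]
      simp only [idet, Prod.fst_sub, Prod.snd_sub, Prod.fst_add, Prod.snd_add, Prod.fst_zero,
        Prod.snd_zero]
      ring
    omega
  have hPpos := hpos P hP
  have h0 : idet 0 e (P - P) = 0 := by simp [idet]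
  have hb := idet_hexDirs e he d hd
  refine ⟨e, he, by omega, fun X hX => ?_⟩
  rw [idet_add_left]
  have := hpos X hX
  omega

theorem side_nonneg_of_active {P e : ℤ × ℤ} (he : ∀ X ∈ interiorPts Δ, 0 ≤ idet P (P + e) X)
    {x : ℝ × ℝ} (hx : x ∈ interiorPolygon Δ) : 0 ≤ side P (P + e) x := by
  refine hull_subset (convex_side P (P + e)) (fun X hX => ?_) hx
  rw [Set.mem_ofPred_eq, side_toPlane]
  exact_mod_cast he X hX

/-- Otherwise the interior polygon would lie on a line. -/
theorem not_active_neg (h : IsAdmissible Δ T) {P e : ℤ × ℤ} (he0 : e ≠ 0)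
    (he : ∀ X ∈ interiorPts Δ, 0 ≤ idet P (P + e) X) :
    ¬ ∀ X ∈ interiorPts Δ, 0 ≤ idet P (P + -e) X := by
  intro he'
  have hzero : ∀ x ∈ interiorPolygon Δ, side P (P + e) x = 0 := by
    intro x hx
    have h1 := side_nonneg_of_active he hx
    have h2 := side_nonneg_of_active he' hx
    have h3 : side P (P + -e) x = - side P (P + e) x := by
      simp only [side, Prod.fst_add, Prod.snd_add, Prod.fst_neg, Prod.snd_neg]
      push_cast
      ring
    linarith
  obtain ⟨x, hx⟩ := h.nonhyp
  obtain ⟨ε, hε, hm⟩ := exists_add_smul_mem_interior hx (-(e.2 : ℝ), (e.1 : ℝ))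
  have h1 := hzero x (interior_subset hx)
  have h2 := hzero _ (interior_subset hm)
  simp only [side, Prod.fst_add, Prod.snd_add, Prod.smul_fst, Prod.smul_snd, smul_eq_mul] at h1 h2
  push_cast at h1 h2
  have h3 : ε * ((e.1 : ℝ) ^ 2 + (e.2 : ℝ) ^ 2) = 0 := by linear_combination h2 - h1
  have h4 := (mul_eq_zero.1 h3).resolve_left hε.ne'
  apply he0
  have a1 : (e.1 : ℝ) = 0 := by nlinarith [sq_nonneg (e.1 : ℝ), sq_nonneg (e.2 : ℝ)]
  have a2 : (e.2 : ℝ) = 0 := by nlinarith [sq_nonneg (e.1 : ℝ), sq_nonneg (e.2 : ℝ)]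
  exact Prod.ext (by exact_mod_cast a1) (by exact_mod_cast a2)

/-- By `exists_active`, a line through `P` supporting the interior polygon separates it from a
neighbour that is not interior, so the edge leaves the polygon at once. -/
theorem isRadial_hex_iff (h : IsAdmissible Δ T) (hH : IsHoneycomb T) {P Q : ℤ × ℤ}
    (hP : P ∈ interiorPts Δ) :
    IsRadial Δ T P Q ↔ ∃ d ∈ hexDirs, Q = P + d ∧ P + d ∉ interiorPts Δ := by
  constructor
  · intro hr
    have hd : Q - P ∈ hexDirs := by
      obtain ⟨R, hR | hR⟩ := (isEdge_iff h.tri).1 hr.1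
      · exact (hR.hex hH).1
      · have := neg_mem_hexDirs _ (hR.hex hH).1
        rwa [neg_sub] at this
    exact ⟨Q - P, hd, by abel, by rw [add_sub_cancel]; exact hr.notMem⟩
  · rintro ⟨d, hd, rfl, hn⟩
    rw [isRadial_iff h hP (hex_star h hH hP hd).isEdge]
    rintro ⟨ε, hε, hm⟩
    obtain ⟨e, he, hed, hact⟩ := exists_active h hH hP hd hn
    have h1 := side_nonneg_of_active hact hm
    have h2 : side P (P + e) (toPlane P + ε • (toPlane (P + d) - toPlane P)) =
        ε * (idet 0 e d : ℝ) := by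
      simp only [side, idet, toPlane, Prod.fst_add, Prod.snd_add, Prod.smul_fst, Prod.smul_snd,
        smul_eq_mul, Prod.fst_sub, Prod.snd_sub, Prod.fst_zero, Prod.snd_zero]
      push_cast
      ring
    rw [h2, hed] at h1
    push_cast at h1
    linarith

theorem notMem_of_active {P e d : ℤ × ℤ} (hact : ∀ X ∈ interiorPts Δ, 0 ≤ idet P (P + e) X)
    (hd : idet 0 e d = -1) : P + d ∉ interiorPts Δ := by
  intro hin
  have := hact _ hin
  rw [idet_add_left, add_sub_cancel_left] at this
  omega

/-- The two radial edges beyond an edge of the interior polygon. -/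
theorem radialEnds_of_active (h : IsAdmissible Δ T) (hH : IsHoneycomb T) {P e : ℤ × ℤ}
    (hP : P ∈ interiorPts Δ) (he : e ∈ hexDirs)
    (hact : ∀ X ∈ interiorPts Δ, 0 ≤ idet P (P + e) X) :
    P + -hexRot e ∈ radialEnds Δ T P ∧ P + (-hexRot e + e) ∈ radialEnds Δ T P := by
  obtain ⟨m1, m2, i1, i2⟩ := idet_neg_hexRot e he
  exact ⟨(isRadial_hex_iff h hH hP).2 ⟨_, m1, rfl, notMem_of_active hact i1⟩,
    (isRadial_hex_iff h hH hP).2 ⟨_, m2, rfl, notMem_of_active hact i2⟩⟩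

theorem hexDirs_ne_zero : ∀ e ∈ hexDirs, e ≠ 0 := by decide

theorem idet_hexRot : ∀ e ∈ hexDirs, idet 0 e (hexRot e) = 1 := by decide

theorem exists_active_of_boundary (h : IsAdmissible Δ T) (hH : IsHoneycomb T) {P : ℤ × ℤ}
    (hP : P ∈ boundaryPts (interiorPolygon Δ)) :
    ∃ e ∈ hexDirs, ∀ X ∈ interiorPts Δ, 0 ≤ idet P (P + e) X := by
  obtain ⟨hPi, hPb⟩ := (mem_boundaryPts_interiorPolygon h).1 hP
  obtain ⟨Q, hQ⟩ := exists_isRadial h hPi hPb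
  obtain ⟨d, hd, rfl, hn⟩ := (isRadial_hex_iff h hH hPi).1 hQ
  obtain ⟨e, he, -, hact⟩ := exists_active h hH hPi hd hn
  exact ⟨e, he, hact⟩

theorem two_le_ncard_radialEnds (h : IsAdmissible Δ T) (hH : IsHoneycomb T) {P : ℤ × ℤ}
    (hP : P ∈ boundaryPts (interiorPolygon Δ)) : 2 ≤ (radialEnds Δ T P).ncard := by
  obtain ⟨e, he, hact⟩ := exists_active_of_boundary h hH hP
  obtain ⟨r1, r2⟩ := radialEnds_of_active h hH ((mem_boundaryPts_interiorPolygon h).1 hP).1 he hact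
  have : 1 < (radialEnds Δ T P).ncard := by
    rw [Set.one_lt_ncard (finite_radialEnds P)]
    refine ⟨_, r1, _, r2, fun heq => hexDirs_ne_zero e he ?_⟩
    simpa using heq
  exact this

/-- For a supporting direction `e`, two radial ends lie on the parallel to `e` at distance 1.
Collinearity keeps `P + e` and `P - e` from being radial ends, so both are interior and `P` is their
midpoint. Conversely a segment through `P` in the polygon forces all supporting directions to be
parallel to it, which leaves one direction and only its two ends. -/
theorem collinear_radialEnds_iff (h : IsAdmissible Δ T) (hH : IsHoneycomb T) {P : ℤ × ℤ}
    (hP : P ∈ boundaryPts (interiorPolygon Δ)) :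
    Collinear ℝ (toPlane '' radialEnds Δ T P) ↔
      toPlane P ∉ Set.extremePoints ℝ (interiorPolygon Δ) := by
  have hPi := ((mem_boundaryPts_interiorPolygon h).1 hP).1
  obtain ⟨e, he, hact⟩ := exists_active_of_boundary h hH hP
  obtain ⟨r1, r2⟩ := radialEnds_of_active h hH hPi he hact
  constructor
  · intro hcol hext
    -- both neighbours along the edge of the interior polygon are interior points
    have hnb : ∀ d ∈ hexDirs, idet 0 e d = 0 → P + d ∈ interiorPts Δ := by
      intro d hd hed
      by_contra hn
      have r3 : P + d ∈ radialEnds Δ T P := (isRadial_hex_iff h hH hPi).2 ⟨d, hd, rfl, hn⟩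
      rw [collinear_iff_of_mem (Set.mem_image_of_mem _ r1)] at hcol
      obtain ⟨w, hw⟩ := hcol
      obtain ⟨a, ha⟩ := hw _ (Set.mem_image_of_mem _ r2)
      obtain ⟨b, hb⟩ := hw _ (Set.mem_image_of_mem _ r3)
      have hrot := idet_hexRot e he
      have hrotR : ((idet 0 e (hexRot e) : ℤ) : ℝ) = 1 := by rw [hrot]; simp
      have hedR : ((idet 0 e d : ℤ) : ℝ) = 0 := by rw [hed]; simp
      have a1 := congrArg Prod.fst ha
      have a2 := congrArg Prod.snd ha
      have b1 := congrArg Prod.fst hb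
      have b2 := congrArg Prod.snd hb
      simp only [idet, toPlane, vadd_eq_add, Prod.fst_add, Prod.snd_add, Prod.smul_fst,
        Prod.smul_snd, smul_eq_mul, Prod.fst_neg, Prod.snd_neg, Prod.fst_zero, Prod.snd_zero]
        at a1 a2 b1 b2 hrotR hedR
      push_cast at a1 a2 b1 b2 hrotR hedR
      have E1 : (e.1 : ℝ) = a * w.1 := by linarith
      have E2 : (e.2 : ℝ) = a * w.2 := by linarith
      have D1 : (d.1 : ℝ) + (hexRot e).1 = b * w.1 := by linarith
      have D2 : (d.2 : ℝ) + (hexRot e).2 = b * w.2 := by linarith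
      have : (1 : ℝ) = 0 := by
        linear_combination (-1 : ℝ) * hrotR - hedR + (e.1 : ℝ) * D2 - (e.2 : ℝ) * D1 +
          b * w.2 * E1 - b * w.1 * E2
      norm_num at this
    have h1 := hnb e he (by simp [idet]; ring)
    have h2 := hnb (-e) (neg_mem_hexDirs e he) (by simp [idet]; ring)
    rw [mem_extremePoints] at hext
    have hseg : toPlane P ∈ openSegment ℝ (toPlane (P + e)) (toPlane (P + -e)) := by
      refine ⟨1 / 2, 1 / 2, by norm_num, by norm_num, by norm_num, ?_⟩
      apply Prod.ext
      · simp only [toPlane, Prod.fst_add, Prod.smul_fst, smul_eq_mul, Prod.fst_neg]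
        push_cast; ring
      · simp only [toPlane, Prod.snd_add, Prod.smul_snd, smul_eq_mul, Prod.snd_neg]
        push_cast; ring
    have := (hext.2 _ (toPlane_mem_interiorPolygon h1) _ (toPlane_mem_interiorPolygon h2) hseg).1
    have := toPlane_injective this
    exact hexDirs_ne_zero e he (by simpa using this)
  · intro hext
    rw [mem_extremePoints] at hext
    push Not at hext
    obtain ⟨x, hx, y, hy, hseg, hne⟩ := hext (toPlane_mem_interiorPolygon hPi)
    obtain ⟨a, b, ha, hb, hab, hxy⟩ := hseg
    have hxy1 := congrArg Prod.fst hxy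
    have hxy2 := congrArg Prod.snd hxy
    simp only [toPlane, Prod.fst_add, Prod.snd_add, Prod.smul_fst, Prod.smul_snd,
      smul_eq_mul] at hxy1 hxy2
    have hxP : x ≠ toPlane P := by
      intro hxP
      have hyP : y = toPlane P := by
        rw [hxP] at hxy
        have : b • y = b • toPlane P := by
          have e1 : a • toPlane P + b • y = a • toPlane P + b • toPlane P := by
            rw [hxy, ← add_smul, hab, one_smul]
          exact add_left_cancel e1
        exact smul_right_injective _ hb.ne' this
      exact hne hxP hyP
    -- A supporting function is nonnegative at `x` and `y` and zero at `P` between them, so it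
    -- vanishes along the segment.
    have hpar : ∀ e' : ℤ × ℤ, (∀ X ∈ interiorPts Δ, 0 ≤ idet P (P + e') X) →
        (e'.1 : ℝ) * (x.2 - P.2) - e'.2 * (x.1 - P.1) = 0 := by
      intro e' hact'
      have s1 := side_nonneg_of_active hact' hx
      have s2 := side_nonneg_of_active hact' hy
      have s3 : a * side P (P + e') x + b * side P (P + e') y = 0 := by
        rw [← side_combo P (P + e') x y a b hab, hxy, side_left_self]
      have s4 : side P (P + e') x = 0 := by
        have t1 := mul_nonneg ha.le s1
        have t2 := mul_nonneg hb.le s2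
        have t3 : a * side P (P + e') x = 0 := by linarith
        exact (mul_eq_zero.1 t3).resolve_left ha.ne'
      simp only [side, Prod.fst_add, Prod.snd_add] at s4
      push_cast at s4
      linear_combination s4
    have huniq : ∀ e' ∈ hexDirs, (∀ X ∈ interiorPts Δ, 0 ≤ idet P (P + e') X) → e' = e := by
      intro e' he' hact'
      have p1 := hpar e hact
      have p2 := hpar e' hact'
      have h0 : idet 0 e e' = 0 := by
        have hR : ((idet 0 e e' : ℤ) : ℝ) = 0 := by
          simp only [idet, Prod.fst_zero, Prod.snd_zero]
          push_cast
          by_contra hcon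
          apply hxP
          apply Prod.ext
          · have : ((e.1 : ℝ) * e'.2 - e.2 * e'.1) * (x.1 - P.1) = 0 := by
              linear_combination (e'.1 : ℝ) * p1 - (e.1 : ℝ) * p2
            have := (mul_eq_zero.1 this).resolve_left (by simpa using hcon)
            simp only [toPlane]; linarith
          · have : ((e.1 : ℝ) * e'.2 - e.2 * e'.1) * (x.2 - P.2) = 0 := by
              linear_combination (e'.2 : ℝ) * p1 - (e.2 : ℝ) * p2
            have := (mul_eq_zero.1 this).resolve_left (by simpa using hcon)
            simp only [toPlane]; linarith
        exact_mod_cast hR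
      rcases eq_or_neg_of_idet_hexDirs e he e' he' h0 with h1 | rfl
      · exact h1
      · exact absurd hact' (not_active_neg h (hexDirs_ne_zero e he) hact)
    have hsub : toPlane '' radialEnds Δ T P ⊆
        {toPlane (P + -hexRot e), toPlane (P + (-hexRot e + e))} := by
      rintro _ ⟨Q, hQ, rfl⟩
      obtain ⟨d, hd, rfl, hn⟩ := (isRadial_hex_iff h hH hPi).1 hQ
      obtain ⟨e', he', hed, hact'⟩ := exists_active h hH hPi hd hn
      rw [huniq e' he' hact'] at hed
      rcases eq_of_idet_hexDirs e he d hd hed with rfl | rfl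
      · exact Or.inl rfl
      · exact Or.inr rfl
    exact (collinear_pair ℝ _ _).subset hsub

theorem b₁_honeycomb (h : IsAdmissible Δ T) (hH : IsHoneycomb T) : b₁ Δ T = 0 := by
  have : {P | P ∈ boundaryPts (interiorPolygon Δ) ∧ (radialEnds Δ T P).ncard = 1} = ∅ := by
    apply Set.eq_empty_of_forall_notMem
    rintro P ⟨hP, h1⟩
    have := two_le_ncard_radialEnds h hH hP
    omega
  rw [b₁, this, Set.ncard_empty]

theorem b₂_honeycomb (h : IsAdmissible Δ T) (hH : IsHoneycomb T) :
    b₂ Δ T = nonvertexBoundaryCount (interiorPolygon Δ) := by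
  rw [b₂, nonvertexBoundaryCount]
  congr 1
  ext P
  constructor
  · rintro ⟨hP, -, hc⟩
    exact ⟨hP, (collinear_radialEnds_iff h hH hP).1 hc⟩
  · rintro ⟨hP, hc⟩
    exact ⟨hP, two_le_ncard_radialEnds h hH hP, (collinear_radialEnds_iff h hH hP).2 hc⟩

end

end TropPlane

/-! ### The dimension formula and its honeycomb case. -/

theorem theorem1p2 (Δ : Set (ℝ × ℝ)) (T : Finset (Finset (ℤ × ℤ)))
    (hΔ : IsLatticePolygon Δ) (hΔ' : IsNonhyperelliptic Δ)
    (hT : IsUnimodularTriangulation Δ T) (hreg : IsRegularTriangulation Δ T) :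
    HasDim (moduliOf Δ T)
      (3 * (genus Δ : ℤ) - 3 - 2 * (genus (interiorPolygon Δ) : ℤ)
        - 2 * (b₁ Δ T : ℤ) - (b₂ Δ T : ℤ)) ∧
    (IsHoneycomb T →
      b₁ Δ T = 0 ∧ b₂ Δ T = nonvertexBoundaryCount (interiorPolygon Δ) ∧
      HasDim (moduliOf Δ T)
        (3 * (genus Δ : ℤ) - 3 - 2 * (genus (interiorPolygon Δ) : ℤ)
          - (nonvertexBoundaryCount (interiorPolygon Δ) : ℤ))) := by
  have h : IsAdmissible Δ T := isAdmissible_of hΔ hΔ' hT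
  have hdim := hasDim_moduliOf h hreg
  refine ⟨hdim, fun hH => ?_⟩
  have h1 := b₁_honeycomb h hH
  have h2 := b₂_honeycomb h hH
  refine ⟨h1, h2, ?_⟩
  rw [← h2]
  simpa [h1] using hdim
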